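/- Let $\mathcal W=\mathcal W(\mathfrak{sl}_2)$ be the $bc\beta\gamma$ system over $\mathbb C$ attached to $\mathfrak{sl}_2$ with standard basis $x,y,h$ ($[x,y]=h$, $[h,x]=2x$, $[h,y]=-2y$) and dual basis $x',y',h'$: it has even generators $\beta^{\xi},\gamma^{\xi'}$ and odd generators $b^{\xi},c^{\xi'}$, the nontrivial OPEs being $\beta^{\xi}(z)\gamma^{\eta'}(w)\sim\langle\eta',\xi\rangle(z-w)^{-1}$ and $b^{\xi}(z)c^{\eta'}(w)\sim\langle\eta',\xi\rangle(z-w)^{-1}$, and it is realised by fields on its Fock space. Write $\circ_n$ for the circle products, $:ab:\,=a\circ_{-1}b$ for the Wick product and $\partial$ for the derivative of fields; a subalgebra is a linear subspace containing $1$ and closed under all $\circ_n$, $n\in\mathbb Z$. Put $$v^x=\tfrac12\big(:\gamma^{h'}\gamma^{h'}:+:\gamma^{x'}\gamma^{y'}:\big),\quad v^y=-\tfrac12\big(:\beta^h\beta^h:+4:\beta^x\beta^y:\big),\quad v^h=\sum_{\xi\in\{x,y,h\}}:\beta^\xi\gamma^{\xi'}:,$$ $$K=\sum_{\xi\in\{x,y,h\}}:\gamma^{\xi'}b^{\xi}:,\qquad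 Q^{\beta b}=:\beta^hb^h:+2:\beta^xb^y:+2:\beta^yb^x:,\qquad F=-\sum_{\xi\in\{x,y,h\}}:b^\xi c^{\xi'}:,$$ and let $\mathcal D\subset\mathcal W$ be the subalgebra generated by $v^x,v^y,v^h,K,Q^{\beta b}$. Let $K(0)$ act on $\mathcal W$ by $u\mapsto K\circ_0u$, and for $k\ge0$ let $\mathcal D^{(k)}=\{u\in\mathcal D:\ -F\circ_0u=k\,u\}$ be the part of $b$-number $k$. Then $\mathcal D=\bigoplus_{k\ge 0}\mathcal D^{(k)}$, and $K(0)$ maps $\mathcal D^{(k)}$ into $\mathcal D^{(k+1)}$ and has square zero on $\mathcal D$; let $H^{(k)}(\mathcal D,K(0))$ be the cohomology of this complex at $\mathcal D^{(k)}$. Let $\langle\gamma\rangle\subset\mathcal W$ be the subalgebra generated by $\gamma^{x'},\gamma^{y'},\gamma^{h'}$, and let $\langle\gamma\rangle^{\mathfrak{sl}_2[t]}$ be the space of $u\in\langle\gamma\rangle$ with $\Theta^\xi_{\mathcal W}\circ_nu=0$ for all $\xi\in\{x,y,h\}$ and all $n\ge0$, where, for $\xi_1,\xi_2,\xi_3$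 the basis $x,y,h$, $$\Theta^\xi_{\mathcal W}=\sum_{i=1}^3\big(:b^{[\xi,\xi_i]}c^{\xi_i'}:-:\beta^{[\xi,\xi_i]}\gamma^{\xi_i'}:\big).$$ Then: 1. $H^{(k)}(\mathcal D,K(0))=0$ for all $k>0$. 2. $H^{(0)}(\mathcal D,K(0))\cong\langle\gamma\rangle^{\mathfrak{sl}_2[t]}$, the isomorphism sending a class to its (unique) representative. 3. Under the Wick product, $\langle\gamma\rangle^{\mathfrak{sl}_2[t]}$ is the polynomial algebra over $\mathbb C$ on the generators $\partial^kv^x$, $k\ge0$. -/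

import Mathlib

open scoped TensorProduct

noncomputable section

namespace WeilVA

/-! ### Fields on a super vector space and their circle products

`QO V` is Mathlib's `VertexOperator ℂ V`, the space of linear maps `V → V((z))`; the Fourier mode
`a(n)` is `VertexOperator.ncoeff a n`.  The super structure of `V = V₀ ⊕ V₁` is recorded by its
parity automorphism `σ`, which acts by `1` on `V₀` and by `-1` on `V₁`. -/

section Fields

variable {V : Type} [AddCommGroup V] [Module ℂ V]

/-- `QO(V)`: the space of fields, i.e. linear maps `V → V((z))`. -/
def QO (V : Type) [AddCommGroup V] [Module ℂ V] : Type := VertexOperator ℂ V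

instance : AddCommGroup (QO V) := inferInstanceAs (AddCommGroup (VertexOperator ℂ V))

instance : Module ℂ (QO V) := inferInstanceAs (Module ℂ (VertexOperator ℂ V))

/-- The Fourier mode `a(n)` of `a(z) = ∑ a(n) z ^ (-n-1)`. -/
def mode (a : QO V) (n : ℤ) : Module.End ℂ V := VertexOperator.ncoeff (R := ℂ) (V := V) a n

/-- The field with prescribed Fourier modes `f n`. -/
def ofModes (f : ℤ → Module.End ℂ V) (hf : ∀ v, ∃ N : ℤ, ∀ n, N ≤ n → f n v = 0) :
    QO V :=
  VertexOperator.of_coeff (fun k => f (-k - 1)) (by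
    intro v
    obtain ⟨N, hN⟩ := hf v
    refine ⟨-N, fun k hk => ?_⟩
    by_contra hlt
    exact hk (hN _ (by omega)))

theorem mode_ofModes (f : ℤ → Module.End ℂ V)
    (hf : ∀ v, ∃ N : ℤ, ∀ n, N ≤ n → f n v = 0) (n : ℤ) : mode (ofModes f hf) n = f n := by
  rw [mode, ofModes, VertexOperator.ncoeff_of_coeff, show -(-n - 1) - 1 = n by ring]

theorem exists_mode_eq_zero (a : QO V) (v : V) :
    ∃ N : ℤ, ∀ n, N ≤ n → mode a n v = 0 := by
  let a' : VertexOperator ℂ V := a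
  refine ⟨-HahnSeries.order ((HahnModule.of ℂ).symm (a' v)), fun n hn => ?_⟩
  exact VertexOperator.ncoeff_eq_zero_of_lt_order a' n v (by omega)

theorem mode_add (a b : QO V) (n : ℤ) : mode (a + b) n = mode a n + mode b n :=
  congrFun (map_add (VertexOperator.ncoeff (R := ℂ) (V := V)) a b) n

theorem mode_smul (r : ℂ) (a : QO V) (n : ℤ) : mode (r • a) n = r • mode a n :=
  congrFun (map_smul (VertexOperator.ncoeff (R := ℂ) (V := V)) r a) n

theorem ext_mode {a b : QO V} (h : ∀ n, mode a n = mode b n) : a = b := by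
  apply HVertexOperator.coeff_inj (Γ := ℤ) (R := ℂ) (V := V) (W := V)
  funext k
  have hk : HVertexOperator.coeff (Γ := ℤ) (R := ℂ) (V := V) (W := V) a (-(-k - 1) - 1) =
      HVertexOperator.coeff (Γ := ℤ) (R := ℂ) (V := V) (W := V) b (-(-k - 1) - 1) := h (-k - 1)
  rwa [show -(-k - 1) - 1 = k by ring] at hk

/-- The identity field: `1(-1) = id`, all other modes vanish. -/
def one : QO V :=
  ofModes (fun n => if n = -1 then 1 else 0) (fun _ => ⟨0, fun n hn => by
    rw [if_neg (by omega)]; rfl⟩)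

/-- The formal derivative `∂a = da/dz`, with modes `(∂a)(n) = -n a(n-1)`. -/
def deriv (a : QO V) : QO V :=
  ofModes (fun n => (-(n : ℂ)) • mode a (n - 1)) (fun v => by
    obtain ⟨N, hN⟩ := exists_mode_eq_zero a v
    exact ⟨N + 1, fun n hn => by simp [hN (n - 1) (by omega)]⟩)

/-- The even component of an operator on the super vector space `(V, σ)`. -/
def evenPart (σ A : Module.End ℂ V) : Module.End ℂ V := (1 / 2 : ℂ) • (A + σ * A * σ)

/-- The odd component of an operator on the super vector space `(V, σ)`. -/
def oddPart (σ A : Module.End ℂ V) : Module.End ℂ V := (1 / 2 : ℂ) • (A - σ * A * σ)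

/-- `(-1) ^ (|A||B|) B A`, extended bilinearly from homogeneous `A` and `B`. -/
def superSwap (σ A B : Module.End ℂ V) : Module.End ℂ V :=
  evenPart σ B * evenPart σ A + evenPart σ B * oddPart σ A + oddPart σ B * evenPart σ A
    - oddPart σ B * oddPart σ A

/-- The `j`-th term of the `m`-th Fourier mode of `a ∘ₙ b`, applied to `v`. -/
def circTerm (σ : Module.End ℂ V) (n : ℤ) (a b : QO V) (m : ℤ) (v : V) (j : ℕ) : V :=
  ((-1 : ℂ) ^ j * ((Ring.choose n j : ℤ) : ℂ)) •
    (mode a (n - j) (mode b (m + j) v)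
      - ((-1 : ℂ) ^ n) • superSwap σ (mode a j) (mode b (m + n - j)) v)

theorem circTerm_eq_zero (σ : Module.End ℂ V) (n : ℤ) (a : QO V) (v : V) :
    ∃ J : ℕ, ∀ (b : QO V) (m : ℤ) (j : ℕ), J ≤ j →
      mode b (m + j) v = 0 → circTerm σ n a b m v j = 0 := by
  obtain ⟨N, hN⟩ := exists_mode_eq_zero a v
  obtain ⟨N', hN'⟩ := exists_mode_eq_zero a (σ v)
  refine ⟨(max N N').toNat, fun b m j hj hb => ?_⟩
  have h1 : mode a j v = 0 := hN _ (by omega)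
  have h2 : mode a j (σ v) = 0 := hN' _ (by omega)
  simp [circTerm, superSwap, evenPart, oddPart, h1, h2, hb]

theorem circTerm_finite (σ : Module.End ℂ V) (n : ℤ) (a b : QO V) (m : ℤ) (v : V) :
    (Function.support (circTerm σ n a b m v)).Finite := by
  obtain ⟨J, hJ⟩ := circTerm_eq_zero σ n a v
  obtain ⟨M, hM⟩ := exists_mode_eq_zero b v
  refine (Set.finite_lt_nat (max J (M - m).toNat)).subset fun j hj => ?_
  by_contra hlt
  simp only [Set.mem_ofPred_eq, not_lt] at hlt
  exact hj (hJ b m j (by omega) (hM _ (by omega)))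

theorem circTerm_eventually (σ : Module.End ℂ V) (n : ℤ) (a b : QO V) (v : V) :
    ∃ N : ℤ, ∀ m, N ≤ m → ∀ j, circTerm σ n a b m v j = 0 := by
  obtain ⟨J, hJ⟩ := circTerm_eq_zero σ n a v
  obtain ⟨M, hM⟩ := exists_mode_eq_zero b v
  have key : ∀ w : V, ∃ N : ℤ, ∀ k, N ≤ k →
      evenPart σ (mode b k) w = 0 ∧ oddPart σ (mode b k) w = 0 := by
    intro w
    obtain ⟨N, hN⟩ := exists_mode_eq_zero b w
    obtain ⟨N', hN'⟩ := exists_mode_eq_zero b (σ w)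
    refine ⟨max N N', fun k hk => ?_⟩
    simp [evenPart, oddPart, hN k (by omega), hN' k (by omega)]
  choose P hP using fun j : ℕ => key (evenPart σ (mode a j) v)
  choose Q hQ using fun j : ℕ => key (oddPart σ (mode a j) v)
  obtain ⟨B, hB⟩ := ((Finset.range J).image (fun j : ℕ => max (P j) (Q j))).bddAbove
  refine ⟨max M (B - n + J), fun m hm j => ?_⟩
  by_cases hj : J ≤ j
  · exact hJ b m j hj (hM _ (by omega))
  · push Not at hj
    have hb : max (P j) (Q j) ≤ B :=
      hB (by simpa using ⟨j, hj, rfl⟩)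
    have h0 : mode b (m + j) v = 0 := hM _ (by omega)
    have h1 := hP j (m + n - j) (by omega)
    have h2 := hQ j (m + n - j) (by omega)
    simp [circTerm, superSwap, h0, h1.1, h1.2, h2.1, h2.2]

theorem circTerm_add (σ : Module.End ℂ V) (n : ℤ) (a b : QO V) (m : ℤ) (v w : V) :
    circTerm σ n a b m (v + w) = circTerm σ n a b m v + circTerm σ n a b m w := by
  funext j
  simp only [circTerm, map_add, Pi.add_apply, smul_add, smul_sub]
  abel

theorem circTerm_smul (σ : Module.End ℂ V) (n : ℤ) (a b : QO V) (m : ℤ) (r : ℂ)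
    (v : V) : circTerm σ n a b m (r • v) = r • circTerm σ n a b m v := by
  funext j
  simp only [circTerm, map_smul, Pi.smul_apply, smul_comm _ r, ← smul_sub]

theorem superSwap_add (σ A B B' : Module.End ℂ V) :
    superSwap σ A (B + B') = superSwap σ A B + superSwap σ A B' := by
  simp only [superSwap, evenPart, oddPart, mul_add, add_mul, smul_add, smul_sub, mul_sub, sub_mul]
  abel

theorem superSwap_smul (σ A B : Module.End ℂ V) (r : ℂ) :
    superSwap σ A (r • B) = r • superSwap σ A B := by
  simp only [superSwap, evenPart, oddPart, mul_smul_comm, smul_mul_assoc, ← smul_add, ← smul_sub,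
    smul_comm _ r]

theorem circTerm_add_right (σ : Module.End ℂ V) (n : ℤ) (a b b' : QO V) (m : ℤ)
    (v : V) : circTerm σ n a (b + b') m v = circTerm σ n a b m v + circTerm σ n a b' m v := by
  funext j
  simp only [circTerm, mode_add, map_add, Pi.add_apply, LinearMap.add_apply, superSwap_add, smul_add, smul_sub]
  abel

theorem circTerm_smul_right (σ : Module.End ℂ V) (n : ℤ) (a b : QO V) (m : ℤ) (r : ℂ)
    (v : V) : circTerm σ n a (r • b) m v = r • circTerm σ n a b m v := by
  funext j
  simp only [circTerm, mode_smul, map_smul, Pi.smul_apply, LinearMap.smul_apply, superSwap_smul,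
    smul_comm _ r, ← smul_sub]

/-- The circle product `a ∘ₙ b`, with
`(a ∘ₙ b)(w) = Res_z a(z) b(w) ι_{|z|>|w|} (z-w)^n - (-1)^{|a||b|} Res_z b(w) a(z) ι_{|w|>|z|} (z-w)^n`.
Expanding `(z-w)^n` in the two regions, its `m`-th Fourier mode is
`∑_{j ≥ 0} (-1)^j (n choose j) (a(n-j) b(m+j) - (-1)^n (-1)^{|a||b|} b(m+n-j) a(j))`,
a sum with finitely many nonzero terms on each vector. -/
def circ (σ : Module.End ℂ V) (n : ℤ) (a b : QO V) : QO V :=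
  ofModes
    (fun m =>
      { toFun := fun v => ∑ᶠ j : ℕ, circTerm σ n a b m v j
        map_add' := fun v w => by
          rw [circTerm_add]
          exact finsum_add_distrib (circTerm_finite σ n a b m v) (circTerm_finite σ n a b m w)
        map_smul' := fun r v => by
          rw [circTerm_smul]
          exact (smul_finsum' r (circTerm_finite σ n a b m v)).symm })
    (fun v => by
      obtain ⟨N, hN⟩ := circTerm_eventually σ n a b v
      refine ⟨N, fun m hm => ?_⟩
      simp [hN m hm])

theorem mode_circ (σ : Module.End ℂ V) (n : ℤ) (a b : QO V) (m : ℤ) (v : V) :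
    mode (circ σ n a b) m v = ∑ᶠ j : ℕ, circTerm σ n a b m v j := by
  rw [circ, mode_ofModes]
  rfl

/-- The operator `b ↦ a ∘ₙ b`. -/
def circLin (σ : Module.End ℂ V) (n : ℤ) (a : QO V) :
    QO V →ₗ[ℂ] QO V where
  toFun := circ σ n a
  map_add' b b' := by
    refine ext_mode fun m => LinearMap.ext fun v => ?_
    rw [mode_add, LinearMap.add_apply, mode_circ, mode_circ, mode_circ, circTerm_add_right]
    exact finsum_add_distrib (circTerm_finite σ n a b m v) (circTerm_finite σ n a b' m v)
  map_smul' r b := by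
    refine ext_mode fun m => LinearMap.ext fun v => ?_
    rw [RingHom.id_apply, mode_smul, LinearMap.smul_apply, mode_circ, mode_circ,
      circTerm_smul_right]
    exact (smul_finsum' r (circTerm_finite σ n a b m v)).symm

/-- The Wick product `:ab: = a ∘₋₁ b`. -/
def wick (σ : Module.End ℂ V) (a b : QO V) : QO V := circ σ (-1) a b

/-- The subalgebra generated by a set `S` of fields: the smallest linear subspace that contains `S`
and `1` and is closed under all circle products. -/
def generated (σ : Module.End ℂ V) (S : Set (QO V)) :
    Submodule ℂ (QO V) :=
  sInf {A | one ∈ A ∧ S ⊆ A ∧ ∀ a ∈ A, ∀ b ∈ A, ∀ n : ℤ, circ σ n a b ∈ A}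

end Fields

/-! ### The `bcβγ` system attached to a vector space with basis indexed by `I`

It is realised by fields on its Fock space: polynomials in even variables `β_k`, `γ_k`
tensored with the exterior algebra on odd variables `b_k`, `c_k`, for `k ≥ 0` and each basis
vector.  The variable `a_k` is the state `a(-k-1)|0⟩`. -/

section Fock

variable {I : Type}

/-- Index set of the variables: `inl (ξ, k)` is `β^ξ_k` (or `b^ξ_k`), and `inr (ξ, k)` is
`γ^{ξ'}_k` (or `c^{ξ'}_k`), where `ξ'` is the dual basis vector. -/
abbrev Var (I : Type) : Type := (I × ℕ) ⊕ (I × ℕ)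

/-- The bosonic Fock space. -/
abbrev Bos (I : Type) : Type := MvPolynomial (Var I) ℂ

/-- The fermionic Fock space. -/
abbrev Fer (I : Type) : Type := ExteriorAlgebra ℂ (Var I →₀ ℂ)

/-- The Fock space of the `bcβγ` system. -/
def Fock (I : Type) : Type := Bos I ⊗[ℂ] Fer I

instance : AddCommGroup (Fock I) := inferInstanceAs (AddCommGroup (Bos I ⊗[ℂ] Fer I))

instance : Module ℂ (Fock I) := inferInstanceAs (Module ℂ (Bos I ⊗[ℂ] Fer I))

/-- The identification of the Fock space with the tensor product. -/
def Fock.equiv (I : Type) : Fock I ≃ₗ[ℂ] Bos I ⊗[ℂ] Fer I := LinearEquiv.refl ℂ _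

/-- The operator `A ⊗ id` on the Fock space. -/
def bosOp (A : Module.End ℂ (Bos I)) : Module.End ℂ (Fock I) :=
  (Fock.equiv I).symm.conj (LinearMap.rTensor (Fer I) A)

/-- The operator `id ⊗ B` on the Fock space. -/
def ferOp (B : Module.End ℂ (Fer I)) : Module.End ℂ (Fock I) :=
  (Fock.equiv I).symm.conj (LinearMap.lTensor (Bos I) B)

/-- The parity automorphism of the Fock space. -/
def parity (I : Type) : Module.End ℂ (Fock I) :=
  ferOp
    (CliffordAlgebra.involute (Q := (0 : QuadraticForm ℂ (Var I →₀ ℂ)))).toLinearMap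

/-- Multiplication by an even variable. -/
def bosMul (i : Var I) : Module.End ℂ (Fock I) :=
  bosOp (LinearMap.mulLeft ℂ (MvPolynomial.X i : Bos I))

/-- Differentiation with respect to an even variable. -/
def bosDer (i : Var I) : Module.End ℂ (Fock I) :=
  bosOp (MvPolynomial.pderiv i : Derivation ℂ (Bos I) (Bos I)).toLinearMap

/-- Left multiplication by an odd variable. -/
def ferMul (i : Var I) : Module.End ℂ (Fock I) :=
  ferOp (LinearMap.mulLeft ℂ (ExteriorAlgebra.ι ℂ (Finsupp.single i (1 : ℂ))))

/-- Left differentiation (contraction) with respect to an odd variable. -/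
def ferDer (i : Var I) : Module.End ℂ (Fock I) :=
  ferOp
    (CliffordAlgebra.contractLeft (Q := (0 : QuadraticForm ℂ (Var I →₀ ℂ)))
      (Finsupp.lapply i : (Var I →₀ ℂ) →ₗ[ℂ] ℂ))

theorem exists_bosDer_eq_zero (f : ℕ → Var I) (hf : Function.Injective f) (v : Fock I) :
    ∃ N : ℕ, ∀ k, N ≤ k → bosDer (f k) v = 0 := by
  obtain ⟨v, rfl⟩ := (Fock.equiv I).symm.surjective v
  induction v using TensorProduct.induction_on with
  | zero => exact ⟨0, fun k _ => by simp⟩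
  | add v w hv hw =>
    obtain ⟨N, hN⟩ := hv
    obtain ⟨M, hM⟩ := hw
    exact ⟨max N M, fun k hk => by
      rw [map_add, map_add, hN k (by omega), hM k (by omega), add_zero]⟩
  | tmul p e =>
    have hfin : (f ⁻¹' (p.vars : Set (Var I))).Finite :=
      p.vars.finite_toSet.preimage hf.injOn
    obtain ⟨B, hB⟩ := hfin.bddAbove
    refine ⟨B + 1, fun k hk => ?_⟩
    have : f k ∉ p.vars := fun h => by
      have : k ≤ B := hB h
      omega
    simp [bosDer, bosOp, MvPolynomial.pderiv_eq_zero_of_notMem_vars this]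

theorem exists_ferDer_eq_zero (f : ℕ → Var I) (hf : Function.Injective f) (v : Fock I) :
    ∃ N : ℕ, ∀ k, N ≤ k → ferDer (f k) v = 0 := by
  have key : ∀ e : Fer I, ∃ N : ℕ, ∀ k, N ≤ k →
      CliffordAlgebra.contractLeft (Q := (0 : QuadraticForm ℂ (Var I →₀ ℂ)))
        (Finsupp.lapply (f k) : (Var I →₀ ℂ) →ₗ[ℂ] ℂ) e = 0 := by
    intro e
    induction e using CliffordAlgebra.left_induction with
    | algebraMap r => exact ⟨0, fun k _ => CliffordAlgebra.contractLeft_algebraMap _ _ _⟩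
    | add v w hv hw =>
      obtain ⟨N, hN⟩ := hv
      obtain ⟨M, hM⟩ := hw
      exact ⟨max N M, fun k hk => by rw [map_add, hN k (by omega), hM k (by omega), add_zero]⟩
    | ι_mul e m he =>
      obtain ⟨N, hN⟩ := he
      have hfin : (f ⁻¹' (m.support : Set (Var I))).Finite :=
        m.support.finite_toSet.preimage hf.injOn
      obtain ⟨B, hB⟩ := hfin.bddAbove
      refine ⟨max N (B + 1), fun k hk => ?_⟩
      have hm : m (f k) = 0 := by
        by_contra h
        have : k ≤ B := hB (by simpa using h)
        omega
      rw [CliffordAlgebra.contractLeft_ι_mul, hN k (by omega)]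
      simp [hm]
  obtain ⟨v, rfl⟩ := (Fock.equiv I).symm.surjective v
  induction v using TensorProduct.induction_on with
  | zero => exact ⟨0, fun k _ => by simp⟩
  | add v w hv hw =>
    obtain ⟨N, hN⟩ := hv
    obtain ⟨M, hM⟩ := hw
    exact ⟨max N M, fun k hk => by
      rw [map_add, map_add, hN k (by omega), hM k (by omega), add_zero]⟩
  | tmul p e =>
    obtain ⟨N, hN⟩ := key e
    exact ⟨N, fun k hk => by simp [ferDer, ferOp, hN k hk]⟩

/-- The modes of `β^ξ`: `β(-k-1)` is multiplication by `β_k`, `β(k) = ∂/∂γ_k`. -/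
def betaMode (i : I) : ℤ → Module.End ℂ (Fock I)
  | Int.ofNat k => bosDer (Sum.inr (i, k))
  | Int.negSucc k => bosMul (Sum.inl (i, k))

/-- The modes of `γ^{ξ'}`: `γ(-k-1)` is multiplication by `γ_k`, `γ(k) = -∂/∂β_k`. -/
def gammaMode (i : I) : ℤ → Module.End ℂ (Fock I)
  | Int.ofNat k => -bosDer (Sum.inl (i, k))
  | Int.negSucc k => bosMul (Sum.inr (i, k))

/-- The modes of `b^ξ`: `b(-k-1)` is multiplication by `b_k`, `b(k) = ∂/∂c_k`. -/
def bMode (i : I) : ℤ → Module.End ℂ (Fock I)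
  | Int.ofNat k => ferDer (Sum.inr (i, k))
  | Int.negSucc k => ferMul (Sum.inl (i, k))

/-- The modes of `c^{ξ'}`: `c(-k-1)` is multiplication by `c_k`, `c(k) = ∂/∂b_k`. -/
def cMode (i : I) : ℤ → Module.End ℂ (Fock I)
  | Int.ofNat k => ferDer (Sum.inl (i, k))
  | Int.negSucc k => ferMul (Sum.inr (i, k))

theorem exists_mode_bound {V : Type} [AddCommGroup V] [Module ℂ V] (f : ℤ → Module.End ℂ V) (v : V)
    (h : ∃ N : ℕ, ∀ k : ℕ, N ≤ k → f (Int.ofNat k) v = 0) :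
    ∃ N : ℤ, ∀ n, N ≤ n → f n v = 0 := by
  obtain ⟨N, hN⟩ := h
  refine ⟨N, fun n hn => ?_⟩
  obtain ⟨k, rfl⟩ := Int.eq_ofNat_of_zero_le (show 0 ≤ n by omega)
  exact hN k (by omega)

/-- The field `β^ξ(z)`. -/
def beta (i : I) : QO (Fock I) :=
  ofModes (betaMode i) fun v => exists_mode_bound _ v
    (exists_bosDer_eq_zero (fun k => Sum.inr (i, k)) (fun _ _ h => by simpa using h) v)

/-- The field `γ^{ξ'}(z)`. -/
def gamma (i : I) : QO (Fock I) :=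
  ofModes (gammaMode i) fun v => exists_mode_bound _ v (by
    obtain ⟨N, hN⟩ :=
      exists_bosDer_eq_zero (fun k => Sum.inl (i, k)) (fun _ _ h => by simpa using h) v
    exact ⟨N, fun k hk => by simp [gammaMode, hN k hk]⟩)

/-- The field `b^ξ(z)`. -/
def b (i : I) : QO (Fock I) :=
  ofModes (bMode i) fun v => exists_mode_bound _ v
    (exists_ferDer_eq_zero (fun k => Sum.inr (i, k)) (fun _ _ h => by simpa using h) v)

/-- The field `c^{ξ'}(z)`. -/
def c (i : I) : QO (Fock I) :=
  ofModes (cMode i) fun v => exists_mode_bound _ v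
    (exists_ferDer_eq_zero (fun k => Sum.inl (i, k)) (fun _ _ h => by simpa using h) v)

end Fock

/-! ### The semi-infinite Weil algebra of `sl₂` -/

/-- Labels of the standard root basis `x, y, h` of `sl₂`. -/
inductive Root : Type
  | x
  | y
  | h
  deriving DecidableEq

instance : Fintype Root := ⟨{.x, .y, .h}, fun r => by cases r <;> simp⟩

/-- Structure constants of `sl₂`: `[ξ, η] = ∑ ζ, bracket ξ η ζ • ζ` on the basis `x, y, h`, with
`[x, y] = h`, `[h, x] = 2x`, `[h, y] = -2y`. -/
def bracket : Root → Root → Root → ℂ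
  | .x, .y, .h => 1
  | .y, .x, .h => -1
  | .h, .x, .x => 2
  | .x, .h, .x => -2
  | .h, .y, .y => -2
  | .y, .h, .y => 2
  | _, _, _ => 0

/-- Fields on the Fock space of the `bcβγ` system of `sl₂`. -/
abbrev WField : Type := QO (Fock Root)

/-- The circle product of fields on the Fock space. -/
abbrev circW (n : ℤ) (u v : WField) : WField := circ (parity Root) n u v

/-- The Wick product of fields on the Fock space. -/
abbrev wickW (u v : WField) : WField := wick (parity Root) u v

/-- `Θ_W^ξ = ∑ :b^{[ξ,ξᵢ]} c^{ξᵢ'}: - ∑ :β^{[ξ,ξᵢ]} γ^{ξᵢ'}:`. -/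
def Theta (ξ : Root) : WField :=
  ∑ i : Root, ∑ j : Root, bracket ξ i j • (wickW (b j) (c i) - wickW (beta j) (gamma i))

/-- `v^h = :β^h γ^{h'}: + :β^x γ^{x'}: + :β^y γ^{y'}:`. -/
def vh : WField :=
  wickW (beta .h) (gamma .h) + wickW (beta .x) (gamma .x) + wickW (beta .y) (gamma .y)

/-- `v^x = ½ (:γ^{h'} γ^{h'}: + :γ^{x'} γ^{y'}:)`. -/
def vx : WField :=
  (1 / 2 : ℂ) • (wickW (gamma .h) (gamma .h) + wickW (gamma .x) (gamma .y))

/-- `v^y = -½ (:β^h β^h: + 4 :β^x β^y:)`. -/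
def vy : WField :=
  (-1 / 2 : ℂ) • (wickW (beta .h) (beta .h) + (4 : ℂ) • wickW (beta .x) (beta .y))

/-- `K = :γ^{h'} b^h: + :γ^{x'} b^x: + :γ^{y'} b^y:`. -/
def K : WField :=
  wickW (gamma .h) (b .h) + wickW (gamma .x) (b .x) + wickW (gamma .y) (b .y)

/-- `Q^{βb} = :β^h b^h: + 2 :β^x b^y: + 2 :β^y b^x:`. -/
def Q : WField :=
  wickW (beta .h) (b .h) + (2 : ℂ) • wickW (beta .x) (b .y) + (2 : ℂ) • wickW (beta .y) (b .x)

/-- `F = -(:b^x c^{x'}: + :b^y c^{y'}: + :b^h c^{h'}:)`. -/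
def F : WField :=
  -(wickW (b .x) (c .x) + wickW (b .y) (c .y) + wickW (b .h) (c .h))

/-- The subspace of fields of `b`-number `k`: the `k`-eigenspace of `-F(0)`, where `F(0)` acts
by `u ↦ F ∘₀ u`. -/
def bNumber (k : ℕ) : Submodule ℂ WField :=
  Module.End.eigenspace (-circLin (parity Root) 0 F) (k : ℂ)

/-- The algebra `𝒟` generated by `v^x, v^y, v^h, K, Q^{βb}`. -/
def D : Submodule ℂ WField := generated (parity Root) {vx, vy, vh, K, Q}

/-- The part `𝒟^{(k)}` of `b`-number `k`. -/
def Dgr (k : ℕ) : Submodule ℂ WField := D ⊓ bNumber k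

/-- The chiral Koszul differential `K(0)`, acting by `u ↦ K ∘₀ u`. -/
def K0 : WField →ₗ[ℂ] WField := circLin (parity Root) 0 K

/-- Cocycles of `(𝒟^{(*)}, K(0))`. -/
def cocycles (k : ℕ) : Submodule ℂ WField := Dgr k ⊓ LinearMap.ker K0

/-- Coboundaries of `(𝒟^{(*)}, K(0))`. -/
def coboundaries : ℕ → Submodule ℂ WField
  | 0 => ⊥
  | k + 1 => (Dgr k).map K0

/-- The cohomology `H^{(k)}(𝒟, K(0))`: cocycles modulo coboundaries. -/
abbrev Cohomology (k : ℕ) : Type :=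
  cocycles k ⧸ (coboundaries k).submoduleOf (cocycles k)

/-- The algebra `⟨γ⟩` generated by `γ^{x'}, γ^{y'}, γ^{h'}`. -/
def gammaAlg : Submodule ℂ WField := generated (parity Root) (Set.range gamma)

/-- The invariants `⟨γ⟩^{sl₂[t]}`, where `ξ tⁿ` acts by `Θ_W^ξ ∘ₙ` for `n ≥ 0`. -/
def gammaInv : Submodule ℂ WField :=
  gammaAlg ⊓ ⨅ (ξ : Root) (n : ℕ), LinearMap.ker (circLin (parity Root) n (Theta ξ))

end WeilVA

end

/-! The five generators are quadratic in the free fields and their operator products close. The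
fields v^x, v^y, v^h form the affine Lie algebra of sl₂ at level -3/2, the odd fields K and Q form a
doublet under it, and all products among K and Q are regular (`singularPart_even_even`,
`singularPart_even_odd`, `singularPart_K_odd`, `singularPart_Q_Q`). The zero mode K(0) sends -v^h to
K and v^y to Q, and kills v^x, K and Q. On generators it is therefore a Koszul differential on the
pairs (-v^h, K) and (v^y, Q), with v^x as the only closed variable left over.

In the free supercommutative algebra on the creation modes of these fields, the Euler homotopy shows
that every closed element is a boundary plus a polynomial in the modes of v^x (`exists_koszul`). The
algebra 𝒟 is not supercommutative, but creation modes supercommute up to single modes, so the graded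
space of the filtration by word length is a quotient of that free algebra. It is the whole free
algebra because the leading symbols are independent: at a suitable point of the jet space of βγb
they take arbitrary values, with free odd values for K and Q, as soon as the first mode of v^y is
nonzero (`exists_superPoint`, `currentOps_separated`). Descending induction on word length lifts the
Koszul statement from the graded space to 𝒟 (`KoszulOps.Rel.exists_primitive`). The modes of v^x
have b-number 0, so cohomology vanishes in positive b-number, and in b-number 0 it consists of the
polynomials in the ∂^k v^x.

To argue with vectors instead of fields, all fields are placed in one space of mutually local,
translation covariant fields, closed under circle products by Dong's lemma. There a field is
determined by its state (`fock_state_injOn`), and the states of a generated algebra are the orbit of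
the vacuum (`LocalSpace.map_state_generated`).

The states of ⟨γ⟩ form the polynomial ring in x_k, y_k, h_k, the Wick product is polynomial
multiplication, and ξtⁿ acts by a coadjoint derivation. Its invariants are the polynomials in the
coefficients q_k of ½(h(t)² + x(t)y(t)) (`exists_aeval_casimir`): after inverting y₀ one may use q_k
in place of x_k as a coordinate, and then the actions of x and h exclude every variable except the
q_k. Since q_k is the state of ∂^k v^x up to the factor k!, these are the same polynomials that
compute the cohomology in b-number 0. -/

noncomputable section

namespace WeilVA

section Calculus

variable {V : Type} [AddCommGroup V] [Module ℂ V]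

/-! ### Modes and elementary operations on fields -/

/-- The `n`-th Fourier mode as a linear function of the field. -/
def modeLin (n : ℤ) : QO V →ₗ[ℂ] Module.End ℂ V where
  toFun a := mode a n
  map_add' a b := mode_add a b n
  map_smul' r a := mode_smul r a n

theorem mode_zero (n : ℤ) : mode (0 : QO V) n = 0 := map_zero (modeLin n)

theorem mode_neg (a : QO V) (n : ℤ) : mode (-a) n = -mode a n := map_neg (modeLin n) a

theorem mode_sub (a b : QO V) (n : ℤ) : mode (a - b) n = mode a n - mode b n :=
  map_sub (modeLin n) a b

theorem mode_sum {ι : Type*} (s : Finset ι) (f : ι → QO V) (n : ℤ) :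
    mode (∑ i ∈ s, f i) n = ∑ i ∈ s, mode (f i) n := map_sum (modeLin n) f s

theorem mode_one (n : ℤ) : mode (one : QO V) n = if n = -1 then 1 else 0 := by
  rw [one, mode_ofModes]

theorem mode_deriv (a : QO V) (n : ℤ) : mode (deriv a) n = (-(n : ℂ)) • mode a (n - 1) := by
  rw [deriv, mode_ofModes]

/-- Multiplication of a field by `z ^ k`. -/
def zpowMul (k : ℤ) : QO V →ₗ[ℂ] QO V where
  toFun a := ofModes (fun n => mode a (n + k)) (fun v => by
    obtain ⟨N, hN⟩ := exists_mode_eq_zero a v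
    exact ⟨N - k, fun n hn => hN _ (by omega)⟩)
  map_add' a b := ext_mode fun n => by simp only [mode_add, mode_ofModes]
  map_smul' r a := ext_mode fun n => by simp only [mode_smul, mode_ofModes, RingHom.id_apply]

theorem mode_zpowMul (k : ℤ) (a : QO V) (n : ℤ) : mode (zpowMul k a) n = mode a (n + k) :=
  mode_ofModes _ _ n

theorem zpowMul_zpowMul (k l : ℤ) (a : QO V) : zpowMul k (zpowMul l a) = zpowMul (k + l) a :=
  ext_mode fun n => by rw [mode_zpowMul, mode_zpowMul, mode_zpowMul, add_assoc]

theorem zpowMul_zero (a : QO V) : zpowMul 0 a = a :=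
  ext_mode fun n => by rw [mode_zpowMul, add_zero]

/-- The field with modes `A a(n) - ε a(n) A`. -/
def sbr (ε : ℂ) (A : Module.End ℂ V) : QO V →ₗ[ℂ] QO V where
  toFun a := ofModes (fun n => A * mode a n - ε • (mode a n * A)) (fun v => by
    obtain ⟨N, hN⟩ := exists_mode_eq_zero a v
    obtain ⟨N', hN'⟩ := exists_mode_eq_zero a (A v)
    exact ⟨max N N', fun n hn => by simp [hN n (by omega), hN' n (by omega)]⟩)
  map_add' a b := ext_mode fun n => by
    simp only [mode_add, mode_ofModes, mul_add, add_mul, smul_add]; abel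
  map_smul' r a := ext_mode fun n => by
    simp only [mode_smul, mode_ofModes, RingHom.id_apply, mul_smul_comm, smul_mul_assoc, smul_sub,
      smul_comm r]

theorem mode_sbr (ε : ℂ) (A : Module.End ℂ V) (a : QO V) (n : ℤ) :
    mode (sbr ε A a) n = A * mode a n - ε • (mode a n * A) := mode_ofModes _ _ n

/-! ### Circle products with an explicit sign -/

/-- The signed binomial coefficient `(-1)^j (n choose j)`. -/
def circCoeff (n : ℤ) (j : ℕ) : ℂ := (-1) ^ j * ((Ring.choose n j : ℤ) : ℂ)

theorem circCoeff_zero (n : ℤ) : circCoeff n 0 = 1 := by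
  simp [circCoeff]

theorem circCoeff_succ_succ (n : ℤ) (j : ℕ) :
    circCoeff (n + 1) (j + 1) = circCoeff n (j + 1) - circCoeff n j := by
  simp only [circCoeff, Ring.choose_succ_succ]
  push_cast
  ring

theorem circCoeff_neg_one (j : ℕ) : circCoeff (-1) j = 1 := by
  induction j with
  | zero => exact circCoeff_zero _
  | succ j ih =>
    have h := circCoeff_succ_succ (-1) j
    have h0 : circCoeff (-1 + 1) (j + 1) = 0 := by
      simp [circCoeff, Ring.choose_zero_succ]
    rw [h0, ih] at h
    linear_combination -h

theorem circCoeff_zero_succ (j : ℕ) : circCoeff 0 (j + 1) = 0 := by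
  simp [circCoeff, Ring.choose_zero_succ]

/-- The ratio of consecutive binomial coefficients. It makes the sums in `deriv_circE` telescope. -/
theorem circCoeff_succ_mul (n : ℤ) (j : ℕ) :
    circCoeff n (j + 1) * (j + 1) = -((n : ℂ) - j) * circCoeff n j := by
  have h2 : ((j + 1 : ℕ) : ℤ) * Ring.choose n (j + 1) = Ring.choose n j * (n - j) := by
    have := Ring.choose_smul_choose n (n := j + 1) (k := j) (by omega)
    simpa [Ring.choose_one_right] using this
  have h3 : ((j + 1 : ℕ) : ℂ) * ((Ring.choose n (j + 1) : ℤ) : ℂ) =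
      ((Ring.choose n j : ℤ) : ℂ) * ((n : ℂ) - j) := by exact_mod_cast congrArg (Int.cast (R := ℂ)) h2
  simp only [circCoeff]
  push_cast at h3
  linear_combination (-1) ^ (j + 1) * h3

/-- The `j`-th term of the `m`-th mode of the circle product with exchange sign `ε`. -/
def signedTerm (ε : ℂ) (n : ℤ) (a b : QO V) (m : ℤ) (v : V) (j : ℕ) : V :=
  circCoeff n j • (mode a (n - j) (mode b (m + j) v)
    - ((-1 : ℂ) ^ n * ε) • mode b (m + n - j) (mode a j v))

theorem signedTerm_eq_zero (ε : ℂ) (n : ℤ) (a b : QO V) (m : ℤ) (v : V) :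
    ∃ J : ℕ, ∀ j, J ≤ j → signedTerm ε n a b m v j = 0 := by
  obtain ⟨N, hN⟩ := exists_mode_eq_zero a v
  obtain ⟨M, hM⟩ := exists_mode_eq_zero b v
  exact ⟨(max N (M - m)).toNat, fun j hj => by
    simp [signedTerm, hN j (by omega), hM (m + j) (by omega)]⟩

theorem signedTerm_finite (ε : ℂ) (n : ℤ) (a b : QO V) (m : ℤ) (v : V) :
    (signedTerm ε n a b m v).HasFiniteSupport := by
  obtain ⟨J, hJ⟩ := signedTerm_eq_zero ε n a b m v
  refine (Set.finite_lt_nat J).subset fun j hj => ?_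
  by_contra hlt
  exact hj (hJ j (not_lt.mp hlt))

theorem signedTerm_eventually (ε : ℂ) (n : ℤ) (a b : QO V) (v : V) :
    ∃ N : ℤ, ∀ m, N ≤ m → ∀ j, signedTerm ε n a b m v j = 0 := by
  obtain ⟨J, hJ⟩ := exists_mode_eq_zero a v
  obtain ⟨M, hM⟩ := exists_mode_eq_zero b v
  choose P hP using fun j : ℕ => exists_mode_eq_zero b (mode a j v)
  obtain ⟨B, hB⟩ := ((Finset.range J.toNat).image P).bddAbove
  refine ⟨max M (B - n + J.toNat), fun m hm j => ?_⟩
  rw [signedTerm, hM (m + j) (by omega)]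
  by_cases hj : J.toNat ≤ j
  · simp [hJ j (by omega)]
  · have hb : P j ≤ B := hB (by simpa using ⟨j, by omega, rfl⟩)
    simp [hP j (m + n - j) (by omega)]

/-- The circle product with exchange sign `ε`. -/
def circE (ε : ℂ) (n : ℤ) (a b : QO V) : QO V :=
  ofModes
    (fun m =>
      { toFun := fun v => ∑ᶠ j : ℕ, signedTerm ε n a b m v j
        map_add' := fun v w => by
          rw [← finsum_add_distrib (signedTerm_finite ε n a b m v) (signedTerm_finite ε n a b m w)]
          refine finsum_congr fun j => ?_
          simp only [signedTerm, map_add, smul_add, smul_sub]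
          abel
        map_smul' := fun r v => by
          rw [RingHom.id_apply, smul_finsum' r (signedTerm_finite ε n a b m v)]
          refine finsum_congr fun j => ?_
          simp only [signedTerm, map_smul, smul_comm _ r, ← smul_sub] })
    (fun v => by
      obtain ⟨N, hN⟩ := signedTerm_eventually ε n a b v
      exact ⟨N, fun m hm => by simp [hN m hm]⟩)

theorem mode_circE (ε : ℂ) (n : ℤ) (a b : QO V) (m : ℤ) (v : V) :
    mode (circE ε n a b) m v = ∑ᶠ j : ℕ, signedTerm ε n a b m v j := by
  rw [circE, mode_ofModes]
  rfl

open Filter in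
theorem mode_circE_eventually (ε : ℂ) (n : ℤ) (a b : QO V) (m : ℤ) (v : V) :
    ∀ᶠ J : ℕ in atTop, mode (circE ε n a b) m v = ∑ j ∈ Finset.range J, signedTerm ε n a b m v j := by
  obtain ⟨J, hJ⟩ := signedTerm_eq_zero ε n a b m v
  filter_upwards [eventually_ge_atTop J] with J' hJ'
  rw [mode_circE, finsum_eq_sum_of_support_subset]
  intro j hj
  by_contra hlt
  simp only [Finset.coe_range, Set.mem_Iio, not_lt] at hlt
  exact hj (hJ j (by omega))

theorem circE_add_left (ε : ℂ) (n : ℤ) (a a' b : QO V) :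
    circE ε n (a + a') b = circE ε n a b + circE ε n a' b := by
  refine ext_mode fun m => LinearMap.ext fun v => ?_
  rw [mode_add, LinearMap.add_apply, mode_circE, mode_circE, mode_circE,
    ← finsum_add_distrib (signedTerm_finite ..) (signedTerm_finite ..)]
  refine finsum_congr fun j => ?_
  simp only [signedTerm, mode_add, LinearMap.add_apply, map_add, smul_add, smul_sub]
  abel

theorem circE_add_right (ε : ℂ) (n : ℤ) (a b b' : QO V) :
    circE ε n a (b + b') = circE ε n a b + circE ε n a b' := by
  refine ext_mode fun m => LinearMap.ext fun v => ?_
  rw [mode_add, LinearMap.add_apply, mode_circE, mode_circE, mode_circE,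
    ← finsum_add_distrib (signedTerm_finite ..) (signedTerm_finite ..)]
  refine finsum_congr fun j => ?_
  simp only [signedTerm, mode_add, LinearMap.add_apply, map_add, smul_add, smul_sub]
  abel

theorem circE_smul_left (ε : ℂ) (n : ℤ) (r : ℂ) (a b : QO V) :
    circE ε n (r • a) b = r • circE ε n a b := by
  refine ext_mode fun m => LinearMap.ext fun v => ?_
  rw [mode_smul, LinearMap.smul_apply, mode_circE, mode_circE,
    smul_finsum' r (signedTerm_finite ..)]
  refine finsum_congr fun j => ?_
  simp only [signedTerm, mode_smul, LinearMap.smul_apply, map_smul, smul_comm _ r, ← smul_sub]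

theorem circE_smul_right (ε : ℂ) (n : ℤ) (r : ℂ) (a b : QO V) :
    circE ε n a (r • b) = r • circE ε n a b := by
  refine ext_mode fun m => LinearMap.ext fun v => ?_
  rw [mode_smul, LinearMap.smul_apply, mode_circE, mode_circE,
    smul_finsum' r (signedTerm_finite ..)]
  refine finsum_congr fun j => ?_
  simp only [signedTerm, mode_smul, LinearMap.smul_apply, map_smul, smul_comm _ r, ← smul_sub]

/-- The circle product with exchange sign `ε` as a bilinear map. -/
def circBilin (ε : ℂ) (n : ℤ) : QO V →ₗ[ℂ] QO V →ₗ[ℂ] QO V :=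
  LinearMap.mk₂ ℂ (circE ε n) (circE_add_left ε n) (circE_smul_left ε n) (circE_add_right ε n)
    (circE_smul_right ε n)

theorem circBilin_apply (ε : ℂ) (n : ℤ) (a b : QO V) : circBilin ε n a b = circE ε n a b := rfl

theorem circE_zpowMul_right (ε : ℂ) (n k : ℤ) (a b : QO V) :
    circE ε n a (zpowMul k b) = zpowMul k (circE ε n a b) := by
  refine ext_mode fun m => LinearMap.ext fun v => ?_
  rw [mode_zpowMul, mode_circE, mode_circE]
  refine finsum_congr fun j => ?_
  simp only [signedTerm, mode_zpowMul]
  congr 4 <;> ring_nf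

/-- Summation by parts against Pascal's rule; the last summand is the boundary term of the truncated
sum. -/
theorem sum_circCoeff_succ (n : ℤ) (h : ℕ → V) (J : ℕ) :
    ∑ j ∈ Finset.range (J + 1), circCoeff (n + 1) j • h j =
      ∑ j ∈ Finset.range J, circCoeff n j • (h j - h (j + 1)) + circCoeff n J • h J := by
  induction J with
  | zero => simp [circCoeff_zero]
  | succ J ih =>
    rw [Finset.sum_range_succ, ih, Finset.sum_range_succ _ J, circCoeff_succ_succ]
    module

theorem neg_one_zpow_succ (n : ℤ) : (-1 : ℂ) ^ (n + 1) = -(-1) ^ n := by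
  rw [zpow_add_one₀ (by norm_num)]; ring

-- Write z = w + (z - w) under the residue. The factor w comes out of the product and the factor z -
-- w raises the exponent n. Dong's lemma rests on this identity.
open Filter in
theorem circE_zMul_left (ε : ℂ) (n : ℤ) (a b : QO V) :
    circE ε n (zpowMul 1 a) b = zpowMul 1 (circE ε n a b) + circE ε (n + 1) a b := by
  refine ext_mode fun m => LinearMap.ext fun v => ?_
  rw [mode_add, mode_zpowMul, LinearMap.add_apply]
  obtain ⟨N, hN⟩ := exists_mode_eq_zero a v
  obtain ⟨M, hM⟩ := exists_mode_eq_zero b v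
  obtain ⟨J, h1, h2, h3, hJ⟩ := ((mode_circE_eventually ε n (zpowMul 1 a) b m v).and
    ((mode_circE_eventually ε n a b (m + 1) v).and
      (((tendsto_add_atTop_nat 1).eventually (mode_circE_eventually ε (n + 1) a b m v)).and
        (eventually_ge_atTop (max N (M - m)).toNat)))).exists
  have ha : mode a J v = 0 := hN _ (by omega)
  have hb : mode b (m + J) v = 0 := hM _ (by omega)
  set e := (-1 : ℂ) ^ n * ε with he
  have h3' : ∑ j ∈ Finset.range (J + 1), signedTerm ε (n + 1) a b m v j =
      ∑ j ∈ Finset.range (J + 1), circCoeff (n + 1) j •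
        (mode a (n + 1 - j) (mode b (m + j) v) + e • mode b (m + n + 1 - j) (mode a j v)) := by
    refine Finset.sum_congr rfl fun j _ => ?_
    simp only [signedTerm, neg_one_zpow_succ, he]
    rw [show m + (n + 1) - j = m + n + 1 - j by ring]
    module
  rw [h1, h2, h3, h3', sum_circCoeff_succ, ha, hb]
  simp only [map_zero, smul_zero, add_zero]
  rw [← Finset.sum_add_distrib]
  refine Finset.sum_congr rfl fun j _ => ?_
  simp only [signedTerm, mode_zpowMul, ← he]
  rw [show n - (j : ℤ) + 1 = n + 1 - j by ring, show m + 1 + (j : ℤ) = m + (j + 1) by ring,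
    show m + 1 + n - (j : ℤ) = m + n + 1 - j by ring]
  push_cast
  rw [show n + 1 - ((j : ℤ) + 1) = n - j by ring, show m + n + 1 - ((j : ℤ) + 1) = m + n - j by ring]
  module

-- The kernel (z - w)^n is annihilated by ∂_z + ∂_w, and a residue annihilates total z-derivatives.
open Filter in
theorem deriv_circE (ε : ℂ) (n : ℤ) (a b : QO V) :
    deriv (circE ε n a b) = circE ε n (deriv a) b + circE ε n a (deriv b) := by
  refine ext_mode fun m => LinearMap.ext fun v => ?_
  rw [mode_add, mode_deriv, LinearMap.add_apply, LinearMap.smul_apply]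
  obtain ⟨N, hN⟩ := exists_mode_eq_zero a v
  obtain ⟨M, hM⟩ := exists_mode_eq_zero b v
  obtain ⟨J, h1, h2, h3, hJ⟩ := ((mode_circE_eventually ε n a b (m - 1) v).and
    ((mode_circE_eventually ε n (deriv a) b m v).and
      ((mode_circE_eventually ε n a (deriv b) m v).and
        (eventually_ge_atTop (max (N + 1) (M - m + 1)).toNat)))).exists
  have ha : mode a (J - 1) v = 0 := hN _ (by omega)
  have hb : mode b (m + J - 1) v = 0 := hM _ (by omega)
  set e := (-1 : ℂ) ^ n * ε with he
  -- The two sides differ termwise by differences of `f` and `g`. Both sequences vanish at 0 because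
  -- of the factor j, and at J because J lies beyond the truncation bounds of `a` and `b`.
  set f : ℕ → V := fun j => (circCoeff n j * j) • mode a (n - j) (mode b (m + j - 1) v) with hf
  set g : ℕ → V := fun j => (circCoeff n j * j) • mode b (m + n - j) (mode a (j - 1) v) with hg
  have hfs := Finset.sum_range_sub f J
  have hgs := Finset.sum_range_sub g J
  have hf0 : f J - f 0 = 0 := by simp [hf, hb]
  have hg0 : g J - g 0 = 0 := by simp [hg, ha]
  rw [hf0] at hfs
  rw [hg0] at hgs
  rw [h1, h2, h3, ← sub_eq_zero, ← Finset.sum_add_distrib, Finset.smul_sum,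
    ← Finset.sum_sub_distrib,
    show (0 : V) = -(∑ j ∈ Finset.range J, (f (j + 1) - f j)) +
      e • ∑ j ∈ Finset.range J, (g (j + 1) - g j) by rw [hfs, hgs]; simp,
    Finset.smul_sum, ← Finset.sum_neg_distrib, ← Finset.sum_add_distrib]
  refine Finset.sum_congr rfl fun j _ => ?_
  simp only [signedTerm, mode_deriv, ← he, hf, hg, LinearMap.smul_apply, map_smul]
  push_cast
  rw [circCoeff_succ_mul, show m - 1 + (j : ℤ) = m + j - 1 by ring,
    show m - 1 + n - (j : ℤ) = m + n - (j + 1) by ring,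
    show n - ((j : ℤ) + 1) = n - j - 1 by ring, show m + ((j : ℤ) + 1) - 1 = m + j by ring,
    show m + n - (j : ℤ) - 1 = m + n - (j + 1) by ring, show (j : ℤ) + 1 - 1 = j by ring]
  module

-- A super bracket with a fixed operator A is a derivation of every circle product. Here δ and δ'
-- are the exchange signs of A with a and with b. Bracketing a with A turns its exchange sign with b
-- from ε into εδ', and bracketing b turns it into εδ.
open Filter in
theorem sbr_circE (δ δ' ε : ℂ) (hδ : δ * δ = 1) (n : ℤ) (A : Module.End ℂ V) (a b : QO V) :
    sbr (δ * δ') A (circE ε n a b) =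
      circE (ε * δ') n (sbr δ A a) b + δ • circE (ε * δ) n a (sbr δ' A b) := by
  refine ext_mode fun m => LinearMap.ext fun v => ?_
  simp only [mode_add, mode_sbr, mode_smul, LinearMap.add_apply, LinearMap.sub_apply,
    LinearMap.smul_apply, Module.End.mul_apply]
  obtain ⟨J, h1, h2, h3, h4⟩ := ((mode_circE_eventually ε n a b m v).and
    ((mode_circE_eventually ε n a b m (A v)).and
      ((mode_circE_eventually (ε * δ') n (sbr δ A a) b m v).and
        (mode_circE_eventually (ε * δ) n a (sbr δ' A b) m v)))).exists
  rw [h1, h2, h3, h4, map_sum, Finset.smul_sum, Finset.smul_sum, ← Finset.sum_sub_distrib,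
    ← Finset.sum_add_distrib]
  refine Finset.sum_congr rfl fun j _ => ?_
  simp only [signedTerm, mode_sbr, LinearMap.sub_apply, LinearMap.smul_apply, Module.End.mul_apply,
    map_sub, map_smul]
  linear_combination (norm := module)
    (circCoeff n j * ((-1 : ℂ) ^ n * ε)) • (hδ • A (mode b (m + n - j) (mode a j v))) -
      (circCoeff n j * ((-1 : ℂ) ^ n * ε) * δ') • (hδ • mode b (m + n - j) (A (mode a j v)))

/-! ### Locality -/

/-- The operator `(w ↦ shift) - z` on sequences of fields. -/
def seqDiff : Module.End ℂ (ℤ → QO V) where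
  toFun A m := A (m + 1) - zpowMul 1 (A m)
  map_add' A B := by funext m; simp only [Pi.add_apply, map_add]; abel
  map_smul' r A := by funext m; simp only [Pi.smul_apply, map_smul, smul_sub, RingHom.id_apply]

theorem seqDiff_apply (A : ℤ → QO V) (m : ℤ) :
    seqDiff A m = A (m + 1) - zpowMul 1 (A m) := rfl

theorem seqDiff_pow_eq_zero_of_le {A : ℤ → QO V} {M N : ℕ} (h : M ≤ N)
    (hA : (seqDiff ^ M) A = 0) : (seqDiff ^ N) A = 0 := by
  obtain ⟨k, rfl⟩ := Nat.exists_eq_add_of_le' h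
  rw [pow_add, Module.End.mul_apply, hA, map_zero]

/-- The sequence of brackets of the modes of `a` with the field `b`. -/
def bracketSeq (ε : ℂ) (a b : QO V) : ℤ → QO V := fun m => sbr ε (mode a m) b

/-- Locality of two fields with exchange sign `ε`. -/
def Loc (ε : ℂ) (a b : QO V) : Prop := ∃ N : ℕ, (seqDiff ^ N) (bracketSeq ε a b) = 0

theorem mode_bracketSeq (ε : ℂ) (a b : QO V) (m n : ℤ) :
    mode (bracketSeq ε a b m) n = mode a m * mode b n - ε • (mode b n * mode a m) :=
  mode_sbr ..

theorem mode_seqDiff (A : ℤ → QO V) (m n : ℤ) :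
    mode (seqDiff A m) n = mode (A (m + 1)) n - mode (A m) (n + 1) := by
  rw [seqDiff_apply, mode_sub, mode_zpowMul]

theorem Loc.symm {ε : ℂ} (hε : ε * ε = 1) {a b : QO V} (h : Loc ε a b) : Loc ε b a := by
  obtain ⟨N, hN⟩ := h
  -- Exchanging the two variables reverses z - w once for each power, and reversing the bracket
  -- contributes the remaining factor -ε.
  have key : ∀ (k : ℕ) (m n : ℤ), mode ((seqDiff ^ k) (bracketSeq ε b a) n) m =
      ((-1) ^ (k + 1) * ε) • mode ((seqDiff ^ k) (bracketSeq ε a b) m) n := by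
    intro k
    induction k with
    | zero =>
      intro m n
      simp only [pow_zero, Module.End.one_apply, mode_bracketSeq, smul_sub, smul_smul]
      linear_combination (norm := module) -hε • (mode b n * mode a m)
    | succ k ih =>
      intro m n
      rw [pow_succ', Module.End.mul_apply, Module.End.mul_apply, mode_seqDiff, mode_seqDiff, ih, ih]
      module
  refine ⟨N, funext fun n => ext_mode fun m => ?_⟩
  rw [key, hN]
  simp [mode_zero]

theorem Loc.add {ε : ℂ} {a b b' : QO V} (h : Loc ε a b) (h' : Loc ε a b') : Loc ε a (b + b') := by
  obtain ⟨N, hN⟩ := h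
  obtain ⟨N', hN'⟩ := h'
  refine ⟨max N N', ?_⟩
  have : bracketSeq ε a (b + b') = bracketSeq ε a b + bracketSeq ε a b' := by
    funext m; exact map_add _ _ _
  rw [this, map_add, seqDiff_pow_eq_zero_of_le (le_max_left _ _) hN,
    seqDiff_pow_eq_zero_of_le (le_max_right _ _) hN', add_zero]

theorem Loc.smul {ε : ℂ} {a b : QO V} (h : Loc ε a b) (r : ℂ) : Loc ε a (r • b) := by
  obtain ⟨N, hN⟩ := h
  refine ⟨N, ?_⟩
  have : bracketSeq ε a (r • b) = r • bracketSeq ε a b := by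
    funext m; exact map_smul _ _ _
  rw [this, map_smul, hN, smul_zero]

theorem circE_zero (ε : ℂ) (a b : QO V) : circE ε 0 a b = bracketSeq ε a b 0 := by
  refine ext_mode fun m => LinearMap.ext fun v => ?_
  rw [mode_circE, finsum_eq_single _ 0, mode_bracketSeq]
  · simp [signedTerm, circCoeff_zero]
  · intro j hj
    obtain ⟨j, rfl⟩ := Nat.exists_eq_succ_of_ne_zero hj
    simp [signedTerm, circCoeff_zero_succ]

/-- For k ≥ 0 the kernel (z - w)^k is a polynomial, so both expansions agree and the product is the
residue of the bracket multiplied by (z - w)^k. Locality then makes the products of large index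
vanish. -/
theorem circE_natCast (ε : ℂ) (k : ℕ) (a b : QO V) :
    circE ε k a b = (seqDiff ^ k) (bracketSeq ε a b) 0 := by
  induction k generalizing a with
  | zero => simpa using circE_zero ε a b
  | succ k ih =>
    have h := circE_zMul_left ε k a b
    have h2 : seqDiff (bracketSeq ε a b) =
        bracketSeq ε (zpowMul 1 a) b - fun m => zpowMul 1 (bracketSeq ε a b m) := by
      funext m
      rw [seqDiff_apply, Pi.sub_apply]
      simp only [bracketSeq, mode_zpowMul]
    have h3 : ∀ (j : ℕ) (A : ℤ → QO V) (m : ℤ),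
        (seqDiff ^ j) (fun m => zpowMul 1 (A m)) m = zpowMul 1 ((seqDiff ^ j) A m) := by
      intro j
      induction j with
      | zero => intro A m; rfl
      | succ j ihj =>
        intro A m
        rw [pow_succ', Module.End.mul_apply, Module.End.mul_apply, seqDiff_apply, seqDiff_apply,
          ihj, ihj, map_sub]
    rw [pow_succ, Module.End.mul_apply, h2, map_sub, Pi.sub_apply, h3, ← ih, ← ih]
    push_cast
    rw [h, add_sub_cancel_left]

theorem Loc.exists_circE_eq_zero {ε : ℂ} {a b : QO V} (h : Loc ε a b) :
    ∃ N : ℕ, ∀ k : ℤ, N ≤ k → circE ε k a b = 0 := by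
  obtain ⟨N, hN⟩ := h
  refine ⟨N, fun k hk => ?_⟩
  obtain ⟨k, rfl⟩ := Int.eq_ofNat_of_zero_le (show 0 ≤ k by omega)
  have := circE_natCast ε k a b
  rw [seqDiff_pow_eq_zero_of_le (by omega) hN] at this
  exact this

/-- Dong's lemma. -/
theorem Loc.circE {δ δ' ε : ℂ} (hδ : δ * δ = 1) {φ a b : QO V} (ha : Loc δ φ a)
    (hb : Loc δ' φ b) (hab : Loc ε a b) (n : ℤ) : Loc (δ * δ') φ (circE ε n a b) := by
  obtain ⟨Na, hNa⟩ := ha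
  obtain ⟨Nb, hNb⟩ := hb
  obtain ⟨N, hN⟩ := hab.exists_circE_eq_zero
  set A := bracketSeq δ φ a with hA
  set B := bracketSeq δ' φ b with hB
  -- Let u, z, w be the variables of φ, a, b, so that `seqDiff` on the bracket with the product
  -- multiplies by u - w. The derivation rule splits this bracket into a part `C` from bracketing a
  -- and a part `R` from bracketing b. Multiplication by u - w passes through `R`. On `C` it is
  -- split as (u - z) + (z - w), whose first term acts on the inner sequence while the second raises
  -- k.
  let C : ℤ → (ℤ → QO V) → ℤ → QO V := fun k X m => WeilVA.circE (ε * δ') k (X m) b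
  let R : ℤ → (ℤ → QO V) → ℤ → QO V := fun k X m => WeilVA.circE (ε * δ) k a (X m)
  have hC : ∀ k X, seqDiff (C k X) = C k (seqDiff X) + C (k + 1) X := by
    intro k X
    funext m
    have h := circE_zMul_left (ε * δ') k (X m) b
    have h2 := map_sub ((circBilin (ε * δ') k).flip b) (X (m + 1)) (zpowMul 1 (X m))
    simp only [LinearMap.flip_apply, circBilin_apply] at h2
    simp only [C, Pi.add_apply, seqDiff_apply]
    rw [h2, h]
    abel
  have hR : ∀ (j : ℕ) k X, (seqDiff ^ j) (R k X) = R k ((seqDiff ^ j) X) := by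
    intro j
    induction j with
    | zero => intro k X; rfl
    | succ j ih =>
      intro k X
      rw [pow_succ', Module.End.mul_apply, Module.End.mul_apply, ih]
      funext m
      have h2 := map_sub (circBilin (ε * δ) k a) ((seqDiff ^ j) X (m + 1))
        (zpowMul 1 ((seqDiff ^ j) X m))
      simp only [circBilin_apply] at h2
      simp only [R, seqDiff_apply]
      rw [h2, circE_zpowMul_right]
  have hR0 : ∀ k, (seqDiff ^ Nb) (R k B) = 0 := by
    intro k
    rw [hR, hNb]
    funext m
    exact map_zero (circBilin (ε * δ) k a)
  have hder : ∀ k, bracketSeq (δ * δ') φ (WeilVA.circE ε k a b) = C k A + δ • R k B := by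
    intro k
    funext m
    exact sbr_circE δ δ' ε hδ k (mode φ m) a b
  -- For k ≥ N the product of a and b vanishes, so the two parts of its bracket cancel and `C k A`
  -- is killed by the same power of u - w as `R k B`.
  have h0 : ∀ k : ℤ, N ≤ k → ∀ i : ℕ, (seqDiff ^ Nb) (C k ((seqDiff ^ i) A)) = 0 := by
    intro k hk i
    induction i generalizing k with
    | zero =>
      have h := hder k
      rw [hN k hk] at h
      have hz : bracketSeq (δ * δ') φ (0 : QO V) = 0 := by funext m; exact map_zero _
      rw [hz] at h
      have h' : C k A = -(δ • R k B) := eq_neg_of_add_eq_zero_left h.symm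
      rw [pow_zero, Module.End.one_apply, h', map_neg, map_smul, hR0, smul_zero, neg_zero]
    | succ i ih =>
      have h := hC k ((seqDiff ^ i) A)
      rw [pow_succ' seqDiff i, Module.End.mul_apply, ← sub_eq_iff_eq_add.mpr h, map_sub,
        ih (k + 1) (by omega), sub_zero, ← Module.End.mul_apply, ← pow_succ, pow_succ',
        Module.End.mul_apply, ih k hk, map_zero]
  -- Each factor u - w either raises k or raises i. The recursion ends when k reaches N or i reaches
  -- Na, as in the binomial expansion of a large power of (u - z) + (z - w).
  have h1 : ∀ r s : ℕ, ∀ (k : ℤ) (i : ℕ), N ≤ k + r → Na ≤ i + s →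
      ∃ M : ℕ, (seqDiff ^ M) (C k ((seqDiff ^ i) A)) = 0 := by
    intro r
    induction r with
    | zero => intro s k i hk _; exact ⟨Nb, h0 k (by simpa using hk) i⟩
    | succ r ihr =>
      intro s
      induction s with
      | zero =>
        intro k i _ hi
        refine ⟨0, ?_⟩
        rw [seqDiff_pow_eq_zero_of_le (by simpa using hi) hNa]
        funext m
        exact map_zero ((circBilin (ε * δ') k).flip b)
      | succ s ihs =>
        intro k i hk hi
        obtain ⟨M, hM⟩ := ihs k (i + 1) hk (by omega)
        obtain ⟨M', hM'⟩ := ihr (s + 1) (k + 1) i (by push_cast at hk; omega) hi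
        refine ⟨max M M' + 1, ?_⟩
        rw [pow_succ, Module.End.mul_apply, hC, map_add,
          seqDiff_pow_eq_zero_of_le (le_max_right _ _) hM', add_zero, ← Module.End.mul_apply seqDiff,
          ← pow_succ' seqDiff i]
        exact seqDiff_pow_eq_zero_of_le (le_max_left _ _) hM
  obtain ⟨M, hM⟩ := h1 (N - n).toNat Na n 0 (by omega) (by omega)
  refine ⟨max M Nb, ?_⟩
  rw [hder, map_add, map_smul, seqDiff_pow_eq_zero_of_le (le_max_right _ _) (hR0 n), smul_zero,
    add_zero]
  exact seqDiff_pow_eq_zero_of_le (le_max_left _ _) hM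

/-- Newton's interpolation formula for sequences of fields. -/
theorem seq_eq_sum_of_seqDiff_pow {N : ℕ} {A : ℤ → QO V} (hA : (seqDiff ^ N) A = 0) (m : ℤ) :
    A m = ∑ j ∈ Finset.range N,
      ((Ring.choose m j : ℤ) : ℂ) • zpowMul (m - j) ((seqDiff ^ j) A 0) := by
  induction N generalizing A m with
  | zero => simpa using congrFun hA m
  | succ N ih =>
    set R : ℤ → QO V := fun m => ∑ j ∈ Finset.range (N + 1),
      ((Ring.choose m j : ℤ) : ℂ) • zpowMul (m - j) ((seqDiff ^ j) A 0) with hR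
    have hd : seqDiff R = seqDiff A := by
      funext m
      rw [ih (A := seqDiff A) (by rwa [pow_succ] at hA) m, seqDiff_apply, hR]
      simp only
      rw [map_sum, ← Finset.sum_sub_distrib, Finset.sum_range_succ']
      have h0 : ((Ring.choose (m + 1) 0 : ℤ) : ℂ) • zpowMul (m + 1 - ((0 : ℕ) : ℤ))
          ((seqDiff ^ 0) A 0) - zpowMul 1 (((Ring.choose m 0 : ℤ) : ℂ) •
            zpowMul (m - ((0 : ℕ) : ℤ)) ((seqDiff ^ 0) A 0)) = 0 := by
        rw [map_smul, zpowMul_zpowMul, Ring.choose_zero_right, Ring.choose_zero_right, sub_eq_zero]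
        congr 2
        push_cast
        ring_nf
      rw [h0, add_zero]
      refine Finset.sum_congr rfl fun j _ => ?_
      rw [map_smul, zpowMul_zpowMul, Ring.choose_succ_succ, ← Module.End.mul_apply, ← pow_succ,
        show m + 1 - ((j + 1 : ℕ) : ℤ) = m - j by push_cast; ring,
        show 1 + (m - ((j + 1 : ℕ) : ℤ)) = m - j by push_cast; ring]
      push_cast
      module
    have h0 : R 0 = A 0 := by
      rw [hR]
      simp only
      rw [Finset.sum_range_succ', Finset.sum_eq_zero]
      · simp [zpowMul_zero]
      · intro j _
        simp [Ring.choose_zero_succ]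
    -- Two sequences with equal differences are compared from their values at 0, in both directions
    -- because multiplication by z is invertible.
    have hstep : ∀ m, R (m + 1) - A (m + 1) = zpowMul 1 (R m - A m) := by
      intro m
      have := congrFun hd m
      rw [seqDiff_apply, seqDiff_apply] at this
      rw [map_sub, sub_eq_sub_iff_add_eq_add]
      rw [sub_eq_sub_iff_add_eq_add] at this
      rw [this, add_comm]
    have hall : ∀ m, R m - A m = 0 := by
      intro m
      induction m using Int.induction_on with
      | zero => rw [h0, sub_self]
      | succ m ihm => rw [hstep, ihm, map_zero]
      | pred m ihm =>
        have := hstep (-(m : ℤ) - 1)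
        rw [show -(m : ℤ) - 1 + 1 = -m by ring, ihm] at this
        rw [← zpowMul_zero (R (-(m : ℤ) - 1) - A (-(m : ℤ) - 1)), show (0 : ℤ) = -1 + 1 by rfl,
          ← zpowMul_zpowMul, ← this, map_zero]
    exact (sub_eq_zero.mp (hall m)).symm

/-- The commutator formula. -/
theorem Loc.commutator {ε : ℂ} {a b : QO V} (h : Loc ε a b) :
    ∃ N : ℕ, (∀ k : ℤ, N ≤ k → WeilVA.circE ε k a b = 0) ∧ ∀ m n : ℤ,
      mode a m * mode b n = ε • (mode b n * mode a m) + ∑ j ∈ Finset.range N,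
        ((Ring.choose m j : ℤ) : ℂ) • mode (WeilVA.circE ε j a b) (m + n - j) := by
  obtain ⟨N, hN⟩ := h
  refine ⟨N, fun k hk => ?_, fun m n => ?_⟩
  · obtain ⟨k, rfl⟩ := Int.eq_ofNat_of_zero_le (show 0 ≤ k by omega)
    have := circE_natCast ε k a b
    rw [seqDiff_pow_eq_zero_of_le (by omega) hN] at this
    exact this
  · have h1 := congrArg (fun x => mode x n) (seq_eq_sum_of_seqDiff_pow hN m)
    simp only [mode_bracketSeq, mode_sum, mode_smul, mode_zpowMul] at h1
    rw [sub_eq_iff_eq_add] at h1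
    rw [h1, add_comm]
    congr 1
    refine Finset.sum_congr rfl fun j _ => ?_
    rw [circE_natCast, show n + (m - (j : ℤ)) = m + n - j by ring]

/-- On families that vanish for all large m, multiplication by z - w is injective: if it gives 0, a
coefficient may be moved along a diagonal until m is in the vanishing range. Iteration treats (z -
w)^N. -/
theorem seq_mode_eq_zero {N : ℕ} {A : ℤ → QO V} (hA : (seqDiff ^ N) A = 0) {v : V} {M : ℤ}
    (hM : ∀ m, M ≤ m → ∀ n, mode (A m) n v = 0) (m n : ℤ) : mode (A m) n v = 0 := by
  induction N generalizing A m n with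
  | zero =>
    have : A m = 0 := congrFun hA m
    simp [this, mode_zero]
  | succ N ih =>
    have hd : ∀ m n, mode (seqDiff A m) n v = 0 := fun m n =>
      ih (A := seqDiff A) (by rwa [pow_succ] at hA) (fun m hm n => by
        rw [mode_seqDiff, LinearMap.sub_apply, hM _ (by omega), hM _ hm, sub_zero]) m n
    have hs : ∀ (k : ℕ) (m n : ℤ), mode (A m) n v = mode (A (m + k)) (n - k) v := by
      intro k
      induction k with
      | zero => intro m n; simp
      | succ k ihk =>
        intro m n
        have h2 := hd (m + k) (n - k - 1)
        rw [mode_seqDiff, LinearMap.sub_apply, sub_eq_zero, sub_add_cancel] at h2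
        rw [ihk, ← h2]
        push_cast
        rw [show m + (k : ℤ) + 1 = m + (k + 1) by ring, show n - (k : ℤ) - 1 = n - (k + 1) by ring]
    rw [hs (M - m).toNat]
    exact hM _ (by omega) _

/-- If a field kills `v` then it kills the images of `v` under the modes of a mutually local
field. -/
theorem Loc.mode_mode_eq_zero {ε : ℂ} (hε : ε * ε = 1) {φ a : QO V} (h : Loc ε φ a) {v : V}
    (hv : ∀ n, mode a n v = 0) (m n : ℤ) : mode a n (mode φ m v) = 0 := by
  obtain ⟨N, hN⟩ := h
  obtain ⟨M, hM⟩ := exists_mode_eq_zero φ v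
  have := seq_mode_eq_zero hN (v := v) (M := M) (fun m hm n => by
    simp [mode_bracketSeq, hv, hM m hm]) m n
  simp only [mode_bracketSeq, LinearMap.sub_apply, Module.End.mul_apply, hv, map_zero, zero_sub,
    neg_eq_zero, LinearMap.smul_apply] at this
  have hε0 : ε ≠ 0 := by rintro rfl; simp at hε
  exact (smul_eq_zero.mp this).resolve_left hε0

end Calculus

section LocalFields

variable {V : Type} [AddCommGroup V] [Module ℂ V]

/-! ### Translation covariant local fields and the state-field correspondence -/

/-- The Koszul sign `(-1) ^ (p q)`. -/
def koszul (p q : Bool) : ℂ := if p && q then -1 else 1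

/-- The sign `(-1) ^ p`. -/
def psign (p : Bool) : ℂ := if p then -1 else 1

theorem koszul_mul_self (p q : Bool) : koszul p q * koszul p q = 1 := by
  cases p <;> cases q <;> simp [koszul]

theorem koszul_comm (p q : Bool) : koszul p q = koszul q p := by
  cases p <;> cases q <;> rfl

theorem koszul_xor (p q r : Bool) : koszul p (xor q r) = koszul p q * koszul p r := by
  cases p <;> cases q <;> cases r <;> simp [koszul]

theorem psign_xor (p q : Bool) : psign (xor p q) = psign p * psign q := by
  cases p <;> cases q <;> simp [psign]

/-- A vacuum vector, a parity operator and a translation operator. -/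
structure Vacuum (V : Type) [AddCommGroup V] [Module ℂ V] where
  σ : Module.End ℂ V
  Ω : V
  T : Module.End ℂ V
  σ_mul_σ : σ * σ = 1
  σ_Ω : σ Ω = Ω
  T_Ω : T Ω = 0

/-- The field `a` is homogeneous of parity `p`. -/
def IsHom (σ : Module.End ℂ V) (p : Bool) (a : QO V) : Prop :=
  ∀ n, σ * mode a n = psign p • (mode a n * σ)

/-- Homogeneous, translation covariant fields that create a state from the vacuum. -/
structure Vacuum.Good (X : Vacuum V) (p : Bool) (a : QO V) : Prop where
  hom : IsHom X.σ p a
  creative : ∀ n, 0 ≤ n → mode a n X.Ω = 0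
  translation : sbr 1 X.T a = deriv a

theorem superSwap_of_hom {σ A B : Module.End ℂ V} (hσ : σ * σ = 1) {p q : Bool}
    (hA : σ * A = psign p • (A * σ)) (hB : σ * B = psign q • (B * σ)) :
    superSwap σ A B = koszul p q • (B * A) := by
  have h : ∀ {A : Module.End ℂ V} {p : Bool}, σ * A = psign p • (A * σ) →
      σ * A * σ = psign p • A := by
    intro A p hA
    rw [hA, smul_mul_assoc, mul_assoc, hσ, mul_one]
  have e : ∀ {A : Module.End ℂ V} {p : Bool}, σ * A = psign p • (A * σ) →
      evenPart σ A = (if p then (0 : ℂ) else 1) • A := by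
    intro A p hA
    rw [evenPart, h hA]
    cases p <;> simp only [psign, if_true, if_false, Bool.false_eq_true] <;> module
  have o : ∀ {A : Module.End ℂ V} {p : Bool}, σ * A = psign p • (A * σ) →
      oddPart σ A = (if p then (1 : ℂ) else 0) • A := by
    intro A p hA
    rw [oddPart, h hA]
    cases p <;> simp only [psign, if_true, if_false, Bool.false_eq_true] <;> module
  rw [superSwap, e hA, e hB, o hA, o hB]
  cases p <;> cases q <;> simp [koszul]

/-- For homogeneous fields the parity components of the definition collapse to one scalar sign, and
the calculus of `circE`, which never mentions parity, becomes available. -/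
theorem circ_eq_circE {σ : Module.End ℂ V} (hσ : σ * σ = 1) {p q : Bool} {a b : QO V}
    (ha : IsHom σ p a) (hb : IsHom σ q b) (n : ℤ) : circ σ n a b = circE (koszul p q) n a b := by
  refine ext_mode fun m => LinearMap.ext fun v => ?_
  rw [mode_circ, mode_circE]
  refine finsum_congr fun j => ?_
  rw [circTerm, signedTerm, superSwap_of_hom hσ (ha _) (hb _), circCoeff, LinearMap.smul_apply,
    smul_smul, Module.End.mul_apply]

theorem IsHom.apply {σ : Module.End ℂ V} {p : Bool} {a : QO V} (h : IsHom σ p a) (n : ℤ) (v : V) :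
    σ (mode a n v) = psign p • mode a n (σ v) := by
  simpa using LinearMap.congr_fun (h n) v

theorem IsHom.circE {σ : Module.End ℂ V} {p q : Bool} {a b : QO V} (ha : IsHom σ p a)
    (hb : IsHom σ q b) (ε : ℂ) (n : ℤ) : IsHom σ (xor p q) (circE ε n a b) := by
  intro m
  refine LinearMap.ext fun v => ?_
  rw [Module.End.mul_apply, LinearMap.smul_apply, Module.End.mul_apply]
  obtain ⟨J, h1, h2⟩ := ((mode_circE_eventually ε n a b m v).and
    (mode_circE_eventually ε n a b m (σ v))).exists
  rw [h1, h2, map_sum, Finset.smul_sum]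
  refine Finset.sum_congr rfl fun j _ => ?_
  simp only [signedTerm, map_smul, map_sub, ha.apply, hb.apply, psign_xor]
  module

/-- The state `a(-1) Ω` of a field. -/
def Vacuum.state (X : Vacuum V) : QO V →ₗ[ℂ] V :=
  (LinearMap.applyₗ X.Ω).comp (modeLin (-1))

theorem Vacuum.state_apply (X : Vacuum V) (a : QO V) : X.state a = mode a (-1) X.Ω := rfl

theorem Vacuum.state_one (X : Vacuum V) : X.state one = X.Ω := by
  rw [X.state_apply, mode_one]; simp

theorem mode_circE_vacuum {Ω : V} {a : QO V} (ha : ∀ n, 0 ≤ n → mode a n Ω = 0) (ε : ℂ)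
    (n m : ℤ) (b : QO V) : mode (circE ε n a b) m Ω =
      ∑ᶠ j : ℕ, circCoeff n j • mode a (n - j) (mode b (m + j) Ω) := by
  rw [mode_circE]
  refine finsum_congr fun j => ?_
  rw [signedTerm, ha j (by omega)]
  simp

/-- Only the first half of the j = 0 term survives: nonnegative modes of a kill the vacuum, and so
does b(-1 + j) for j > 0. -/
theorem state_circE (X : Vacuum V) {a b : QO V} (ha : ∀ n, 0 ≤ n → mode a n X.Ω = 0)
    (hb : ∀ n, 0 ≤ n → mode b n X.Ω = 0) (ε : ℂ) (n : ℤ) :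
    X.state (circE ε n a b) = mode a n (X.state b) := by
  rw [X.state_apply, mode_circE_vacuum ha, finsum_eq_single _ 0]
  · simp [circCoeff_zero, X.state_apply]
  · intro j hj
    rw [hb (-1 + j) (by omega)]
    simp

/-- Translation covariance says that the bracket with T equals ∂. Both are derivations of circle
products, so the property is inherited. -/
theorem Vacuum.Good.circE {X : Vacuum V} {p q : Bool} {a b : QO V} (ha : X.Good p a)
    (hb : X.Good q b) (ε : ℂ) (n : ℤ) : X.Good (xor p q) (circE ε n a b) where
  hom := ha.hom.circE hb.hom ε n
  creative m hm := by
    rw [mode_circE_vacuum ha.creative]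
    refine finsum_eq_zero_of_forall_eq_zero fun j => ?_
    rw [hb.creative _ (by omega)]
    simp
  translation := by
    have := sbr_circE 1 1 ε (one_mul 1) n X.T a b
    rw [one_mul, mul_one, one_smul, ha.translation, hb.translation] at this
    rw [this, deriv_circE]

theorem deriv_add (a b : QO V) : deriv (a + b) = deriv a + deriv b :=
  ext_mode fun n => by simp only [mode_deriv, mode_add, smul_add]

theorem deriv_smul (r : ℂ) (a : QO V) : deriv (r • a) = r • deriv a :=
  ext_mode fun n => by simp only [mode_deriv, mode_smul, smul_comm r]

theorem Vacuum.Good.add {X : Vacuum V} {p : Bool} {a b : QO V} (ha : X.Good p a)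
    (hb : X.Good p b) : X.Good p (a + b) where
  hom n := by rw [mode_add, mul_add, add_mul, smul_add, ha.hom, hb.hom]
  creative n hn := by rw [mode_add, LinearMap.add_apply, ha.creative n hn, hb.creative n hn, add_zero]
  translation := by rw [map_add, ha.translation, hb.translation, deriv_add]

theorem Vacuum.Good.smul {X : Vacuum V} {p : Bool} {a : QO V} (ha : X.Good p a) (r : ℂ) :
    X.Good p (r • a) where
  hom n := by rw [mode_smul, mul_smul_comm, smul_mul_assoc, ha.hom, smul_comm]
  creative n hn := by rw [mode_smul, LinearMap.smul_apply, ha.creative n hn, smul_zero]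
  translation := by rw [map_smul, ha.translation, deriv_smul]

theorem Vacuum.good_one (X : Vacuum V) : X.Good false one where
  hom n := by rw [mode_one]; split_ifs <;> simp [psign]
  creative n hn := by rw [mode_one, if_neg (by omega)]; rfl
  translation := ext_mode fun n => by
    rw [mode_sbr, mode_deriv, mode_one, mode_one]
    by_cases h : n - 1 = -1
    · have : n = 0 := by omega
      subst this; simp
    · rw [if_neg h]; split_ifs <;> simp

theorem loc_one (a : QO V) : Loc 1 a one := by
  refine ⟨0, funext fun m => ext_mode fun n => ?_⟩
  rw [pow_zero, Module.End.one_apply, mode_bracketSeq, mode_one, Pi.zero_apply, mode_zero]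
  split_ifs <;> simp

/-- Translation covariance determines the action of a field on the vacuum from its state. -/
theorem Vacuum.Good.mode_vacuum_eq_zero {X : Vacuum V} {p : Bool} {a : QO V} (ha : X.Good p a)
    (h : X.state a = 0) (n : ℤ) : mode a n X.Ω = 0 := by
  rcases le_or_gt 0 n with hn | hn
  · exact ha.creative n hn
  obtain ⟨k, rfl⟩ : ∃ k : ℕ, n = -1 - k := ⟨(-1 - n).toNat, by omega⟩
  clear hn
  induction k with
  | zero => simpa [X.state_apply] using h
  | succ k ih =>
    have ht := LinearMap.congr_fun (congrArg (fun x => mode x (-1 - (k : ℤ))) ha.translation) X.Ω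
    simp only [mode_sbr, mode_deriv, LinearMap.sub_apply, LinearMap.smul_apply,
      Module.End.mul_apply, ih, X.T_Ω, map_zero, smul_zero, sub_zero] at ht
    have hk : -((-1 - (k : ℤ) : ℤ) : ℂ) ≠ 0 := by
      have : (-((-1 - (k : ℤ) : ℤ) : ℂ)) = ((k + 1 : ℕ) : ℂ) := by push_cast; ring
      rw [this]
      exact Nat.cast_ne_zero.mpr (by omega)
    have := (smul_eq_zero.mp ht.symm).resolve_left hk
    rwa [show -1 - ((k + 1 : ℕ) : ℤ) = -1 - (k : ℤ) - 1 by push_cast; ring]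

/-- A space of mutually local fields, closed under circle products. -/
structure LocalSpace (X : Vacuum V) where
  carrier : Bool → Submodule ℂ (QO V)
  good : ∀ {p a}, a ∈ carrier p → X.Good p a
  loc : ∀ {p q a b}, a ∈ carrier p → b ∈ carrier q → Loc (koszul p q) a b
  one_mem : one ∈ carrier false
  circE_mem : ∀ {p q a b}, a ∈ carrier p → b ∈ carrier q → ∀ n,
    circE (koszul p q) n a b ∈ carrier (xor p q)

/-- A set of mutually local fields is contained in a maximal one, which is closed under
linear combinations and circle products. -/
theorem exists_maximal_local (X : Vacuum V) (S : Set (Bool × QO V)) (hS : ∀ x ∈ S, X.Good x.1 x.2)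
    (hloc : ∀ x ∈ S, ∀ y ∈ S, Loc (koszul x.1 y.1) x.2 y.2) :
    ∃ W : Bool → Set (QO V), (∀ x ∈ S, x.2 ∈ W x.1) ∧
      (∀ p, ∀ a ∈ W p, X.Good p a) ∧
      (∀ p q, ∀ a ∈ W p, ∀ b ∈ W q, Loc (koszul p q) a b) ∧ one ∈ W false ∧
      (∀ p q n, ∀ a ∈ W p, ∀ b ∈ W q, circE (koszul p q) n a b ∈ W (xor p q)) ∧
      (∀ p, (0 : QO V) ∈ W p) ∧ (∀ p a b, a ∈ W p → b ∈ W p → a + b ∈ W p) ∧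
      (∀ p a (r : ℂ), a ∈ W p → r • a ∈ W p) := by
  obtain ⟨C, hSC, hC⟩ := zorn_subset_nonempty
    {C : Set (Bool × QO V) | (∀ x ∈ C, X.Good x.1 x.2) ∧
      ∀ x ∈ C, ∀ y ∈ C, Loc (koszul x.1 y.1) x.2 y.2} (by
    intro c hc hchain _
    refine ⟨⋃₀ c, ⟨?_, ?_⟩, fun s hs => Set.subset_sUnion_of_mem hs⟩
    · rintro x ⟨s, hs, hx⟩
      exact (hc hs).1 x hx
    · rintro x ⟨s, hs, hx⟩ y ⟨t, ht, hy⟩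
      rcases hchain.total hs ht with h | h
      · exact (hc ht).2 x (h hx) y hy
      · exact (hc hs).2 x hx y (h hy)) S ⟨hS, hloc⟩
  obtain ⟨⟨hgood, hl⟩, hmax⟩ := hC
  -- By maximality, a field belongs to C once locality to C forces locality to it. The criterion is
  -- quantified over test fields φ outside C so that it can also be applied to the new field itself,
  -- which has to be local to itself.
  have ins : ∀ (p : Bool) (z : QO V), X.Good p z →
      (∀ (r : Bool) (φ : QO V), (∀ x ∈ C, Loc (koszul r x.1) φ x.2) → Loc (koszul r p) φ z) →
      (p, z) ∈ C := by
    intro p z hz h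
    have h1 : ∀ x ∈ C, Loc (koszul x.1 p) x.2 z := fun x hx => h x.1 x.2 (hl x hx)
    have h2 : ∀ x ∈ C, Loc (koszul p x.1) z x.2 := fun x hx => by
      rw [koszul_comm]; exact (h1 x hx).symm (koszul_mul_self _ _)
    refine hmax (y := insert (p, z) C) ⟨?_, ?_⟩ (Set.subset_insert _ _) (Set.mem_insert _ _)
    · rintro x (rfl | hx)
      · exact hz
      · exact hgood x hx
    · rintro x (rfl | hx) y (rfl | hy)
      · exact h p z h2
      · exact h2 y hy
      · exact h1 x hx
      · exact hl x hx y hy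
  have hone : (false, one) ∈ C := ins false one X.good_one fun r φ _ => by
    have : koszul r false = 1 := by cases r <;> rfl
    rw [this]; exact loc_one φ
  have hadd : ∀ p a b, (p, a) ∈ C → (p, b) ∈ C → (p, a + b) ∈ C := fun p a b ha hb =>
    ins p (a + b) ((hgood (p, a) ha).add (hgood (p, b) hb)) fun _ _ h =>
      Loc.add (h (p, a) ha) (h (p, b) hb)
  have hsmul : ∀ p a (r : ℂ), (p, a) ∈ C → (p, r • a) ∈ C := fun p a r ha =>
    ins p _ ((hgood _ ha).smul r) fun r' φ h => (h _ ha).smul r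
  have hcirc : ∀ p q a b n, (p, a) ∈ C → (q, b) ∈ C →
      (xor p q, circE (koszul p q) n a b) ∈ C := fun p q a b n ha hb =>
    ins _ _ ((hgood _ ha).circE (hgood _ hb) _ n) fun r φ h => by
      rw [koszul_xor]
      exact Loc.circE (koszul_mul_self _ _) (h _ ha) (h _ hb) (hl _ ha _ hb) n
  have hzero : ∀ p, (p, (0 : QO V)) ∈ C := by
    intro p
    refine ins p 0 ?_ fun r φ _ => ⟨0, funext fun m => map_zero (sbr (koszul r p) (mode φ m))⟩
    have h0 := (X.good_one).smul 0
    rw [zero_smul] at h0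
    exact ⟨fun n => by rw [mode_zero]; simp, h0.creative, h0.translation⟩
  have e : ∀ p a, a ∈ {a | (p, a) ∈ C} ↔ (p, a) ∈ C := fun p a => Iff.rfl
  refine ⟨fun p => {a | (p, a) ∈ C}, ?_, ?_, ?_, ?_, ?_, ?_, ?_, ?_⟩
  · intro x hx; exact (e _ _).mpr (hSC hx)
  · intro p a h; exact hgood (p, a) ((e _ _).mp h)
  · intro p q a ha b hb; exact hl (p, a) ((e _ _).mp ha) (q, b) ((e _ _).mp hb)
  · exact (e _ _).mpr hone
  · intro p q n a ha b hb; exact (e _ _).mpr (hcirc p q a b n ((e _ _).mp ha) ((e _ _).mp hb))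
  · intro p; exact (e _ _).mpr (hzero p)
  · intro p a b ha hb; exact (e _ _).mpr (hadd p a b ((e _ _).mp ha) ((e _ _).mp hb))
  · intro p a r ha; exact (e _ _).mpr (hsmul p a r ((e _ _).mp ha))

/-- A set of mutually local fields is contained in a local space. -/
theorem exists_localSpace (X : Vacuum V) (S : Set (Bool × QO V)) (hS : ∀ x ∈ S, X.Good x.1 x.2)
    (hloc : ∀ x ∈ S, ∀ y ∈ S, Loc (koszul x.1 y.1) x.2 y.2) :
    ∃ W : LocalSpace X, ∀ x ∈ S, x.2 ∈ W.carrier x.1 := by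
  obtain ⟨C, hS, hg, hl, h1, hc, h0, ha, hs⟩ := exists_maximal_local X S hS hloc
  exact ⟨{
    carrier := fun p =>
      { carrier := C p
        add_mem' := fun {a b} => ha p a b
        zero_mem' := h0 p
        smul_mem' := fun r a => hs p a r }
    good := fun {p a} => hg p a
    loc := fun {p q a b} h => hl p q a h b
    one_mem := h1
    circE_mem := fun {p q a b} ha hb n => hc p q n a ha b hb }, hS⟩

namespace LocalSpace

variable {X : Vacuum V} (W : LocalSpace X)

/-- All fields of a local space. -/
def total : Submodule ℂ (QO V) := W.carrier false ⊔ W.carrier true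

theorem le_total (p : Bool) : W.carrier p ≤ W.total := by
  cases p
  · exact le_sup_left
  · exact le_sup_right

variable {W}

theorem circ_eq {p q : Bool} {a b : QO V} (ha : a ∈ W.carrier p) (hb : b ∈ W.carrier q) (n : ℤ) :
    circ X.σ n a b = circE (koszul p q) n a b :=
  circ_eq_circE X.σ_mul_σ (W.good ha).hom (W.good hb).hom n

theorem circ_mem {p q : Bool} {a b : QO V} (ha : a ∈ W.carrier p) (hb : b ∈ W.carrier q) (n : ℤ) :
    circ X.σ n a b ∈ W.carrier (xor p q) := by
  rw [circ_eq ha hb]; exact W.circE_mem ha hb n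

theorem state_circ {p q : Bool} {a b : QO V} (ha : a ∈ W.carrier p) (hb : b ∈ W.carrier q)
    (n : ℤ) : X.state (circ X.σ n a b) = mode a n (X.state b) := by
  rw [circ_eq ha hb]; exact state_circE X (W.good ha).creative (W.good hb).creative _ n

end LocalSpace

/-- The smallest subspace that contains the vacuum and is stable under all modes of the fields
in `S`. -/
def Vacuum.orbit (X : Vacuum V) (S : Set (QO V)) : Submodule ℂ V :=
  sInf {A | X.Ω ∈ A ∧ ∀ s ∈ S, ∀ n, ∀ v ∈ A, mode s n v ∈ A}

theorem Vacuum.vacuum_mem_orbit (X : Vacuum V) (S : Set (QO V)) : X.Ω ∈ X.orbit S :=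
  Submodule.mem_sInf.mpr fun _ hA => hA.1

theorem Vacuum.mode_mem_orbit (X : Vacuum V) {S : Set (QO V)} {s : QO V} (hs : s ∈ S) (n : ℤ)
    {v : V} (hv : v ∈ X.orbit S) : mode s n v ∈ X.orbit S :=
  Submodule.mem_sInf.mpr fun A hA => hA.2 s hs n v (Submodule.mem_sInf.mp hv A hA)

theorem Vacuum.orbit_le (X : Vacuum V) {S : Set (QO V)} {A : Submodule ℂ V} (h1 : X.Ω ∈ A)
    (h2 : ∀ s ∈ S, ∀ n, ∀ v ∈ A, mode s n v ∈ A) : X.orbit S ≤ A := sInf_le ⟨h1, h2⟩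

section Generated

variable (σ : Module.End ℂ V) (S : Set (QO V))

theorem one_mem_generated : one ∈ generated σ S := Submodule.mem_sInf.mpr fun _ hA => hA.1

theorem subset_generated {s : QO V} (hs : s ∈ S) : s ∈ generated σ S :=
  Submodule.mem_sInf.mpr fun _ hA => hA.2.1 hs

theorem circ_mem_generated {a b : QO V} (ha : a ∈ generated σ S) (hb : b ∈ generated σ S) (n : ℤ) :
    circ σ n a b ∈ generated σ S :=
  Submodule.mem_sInf.mpr fun A hA => hA.2.2 a (Submodule.mem_sInf.mp ha A hA) b
    (Submodule.mem_sInf.mp hb A hA) n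

theorem generated_le {A : Submodule ℂ (QO V)} (h1 : one ∈ A) (h2 : S ⊆ A)
    (h3 : ∀ a ∈ A, ∀ b ∈ A, ∀ n : ℤ, circ σ n a b ∈ A) : generated σ S ≤ A := sInf_le ⟨h1, h2, h3⟩

end Generated

/-- The modes of a circle product preserve a parity stable subspace preserved by the modes of both
factors. -/
theorem mode_circ_mem {σ : Module.End ℂ V} {A : Submodule ℂ V} (hσ : ∀ v ∈ A, σ v ∈ A) {a b : QO V}
    (ha : ∀ n, ∀ v ∈ A, mode a n v ∈ A) (hb : ∀ n, ∀ v ∈ A, mode b n v ∈ A) (n m : ℤ) {v : V}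
    (hv : v ∈ A) : mode (circ σ n a b) m v ∈ A := by
  have he : ∀ {B : Module.End ℂ V}, (∀ v ∈ A, B v ∈ A) → ∀ v ∈ A, evenPart σ B v ∈ A :=
    fun hB v hv => A.smul_mem _ (A.add_mem (hB v hv) (hσ _ (hB _ (hσ v hv))))
  have ho : ∀ {B : Module.End ℂ V}, (∀ v ∈ A, B v ∈ A) → ∀ v ∈ A, oddPart σ B v ∈ A :=
    fun hB v hv => A.smul_mem _ (A.sub_mem (hB v hv) (hσ _ (hB _ (hσ v hv))))
  rw [mode_circ]
  refine finsum_induction (· ∈ A) A.zero_mem (fun _ _ => A.add_mem) fun j => ?_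
  refine A.smul_mem _ (A.sub_mem (ha _ _ (hb _ _ hv)) (A.smul_mem _ ?_))
  simp only [superSwap, LinearMap.sub_apply, LinearMap.add_apply, Module.End.mul_apply]
  exact A.sub_mem (A.add_mem (A.add_mem (he (hb _) _ (he (ha _) _ hv)) (he (hb _) _ (ho (ha _) _ hv)))
    (ho (hb _) _ (he (ha _) _ hv))) (ho (hb _) _ (ho (ha _) _ hv))

namespace LocalSpace

variable {X : Vacuum V} {W : LocalSpace X}

theorem generated_le_total {S : Set (QO V)} (hS : S ⊆ W.total) : generated X.σ S ≤ W.total := by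
  refine generated_le _ _ (W.le_total _ W.one_mem) hS fun a ha b hb n => ?_
  obtain ⟨a0, ha0, a1, ha1, rfl⟩ := Submodule.mem_sup.mp ha
  have hadd : ∀ (a a' b : QO V), a ∈ W.carrier false → a' ∈ W.carrier true → b ∈ W.total →
      circ X.σ n (a + a') b = circ X.σ n a b + circ X.σ n a' b := by
    intro a a' b _ _ _
    refine ext_mode fun m => LinearMap.ext fun v => ?_
    rw [mode_add, LinearMap.add_apply, mode_circ, mode_circ, mode_circ,
      ← finsum_add_distrib (circTerm_finite X.σ n a b m v) (circTerm_finite X.σ n a' b m v)]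
    refine finsum_congr fun j => ?_
    simp only [circTerm, mode_add, LinearMap.add_apply, superSwap, evenPart, oddPart, mul_add,
      add_mul, LinearMap.sub_apply, LinearMap.smul_apply, smul_mul_assoc, mul_smul_comm, mul_sub,
      sub_mul]
    module
  rw [hadd _ _ _ ha0 ha1 hb]
  obtain ⟨b0, hb0, b1, hb1, rfl⟩ := Submodule.mem_sup.mp hb
  have e : ∀ a, circ X.σ n a (b0 + b1) = circ X.σ n a b0 + circ X.σ n a b1 := fun a =>
    map_add (circLin X.σ n a) b0 b1
  rw [e, e]
  exact W.total.add_mem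
    (W.total.add_mem (W.le_total _ (circ_mem ha0 hb0 n)) (W.le_total _ (circ_mem ha0 hb1 n)))
    (W.total.add_mem (W.le_total _ (circ_mem ha1 hb0 n)) (W.le_total _ (circ_mem ha1 hb1 n)))

theorem state_circ_total {p : Bool} {a b : QO V} (ha : a ∈ W.carrier p) (hb : b ∈ W.total)
    (n : ℤ) : X.state (circ X.σ n a b) = mode a n (X.state b) := by
  obtain ⟨b0, hb0, b1, hb1, rfl⟩ := Submodule.mem_sup.mp hb
  have e : circ X.σ n a (b0 + b1) = circ X.σ n a b0 + circ X.σ n a b1 :=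
    map_add (circLin X.σ n a) b0 b1
  rw [e, map_add, map_add, map_add, state_circ ha hb0, state_circ ha hb1]

theorem circ_mem_total {p : Bool} {a b : QO V} (ha : a ∈ W.carrier p) (hb : b ∈ W.total)
    (n : ℤ) : circ X.σ n a b ∈ W.total := by
  obtain ⟨b0, hb0, b1, hb1, rfl⟩ := Submodule.mem_sup.mp hb
  have e : circ X.σ n a (b0 + b1) = circ X.σ n a b0 + circ X.σ n a b1 :=
    map_add (circLin X.σ n a) b0 b1
  rw [e]
  exact W.total.add_mem (W.le_total _ (circ_mem ha hb0 n)) (W.le_total _ (circ_mem ha hb1 n))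

/-- The fields whose modes preserve the orbit contain the generators and are closed under circle
products, which gives one inclusion. For the other, a generator s satisfies: the state of s ∘ₙ a is
s(n) applied to the state of a. -/
theorem map_state_generated {S : Set (QO V)} (hS : ∀ s ∈ S, ∃ p, s ∈ W.carrier p) :
    (generated X.σ S).map X.state = X.orbit S := by
  have hσ : ∀ v ∈ X.orbit S, X.σ v ∈ X.orbit S := by
    have : X.orbit S ≤ (X.orbit S).comap X.σ := by
      refine X.orbit_le ?_ fun s hs n v hv => ?_
      · rw [Submodule.mem_comap, X.σ_Ω]; exact X.vacuum_mem_orbit S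
      · obtain ⟨p, hp⟩ := hS s hs
        rw [Submodule.mem_comap, (W.good hp).hom.apply]
        exact Submodule.smul_mem _ _ (X.mode_mem_orbit hs n hv)
    exact this
  apply le_antisymm
  · let A : Submodule ℂ (QO V) :=
      { carrier := {a | ∀ n, ∀ v ∈ X.orbit S, mode a n v ∈ X.orbit S}
        add_mem' := fun ha hb n v hv => by
          rw [mode_add]; exact Submodule.add_mem _ (ha n v hv) (hb n v hv)
        zero_mem' := fun n v _ => by rw [mode_zero]; exact Submodule.zero_mem _
        smul_mem' := fun r a ha n v hv => by
          rw [mode_smul]; exact Submodule.smul_mem _ _ (ha n v hv) }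
    have hA : generated X.σ S ≤ A := by
      refine generated_le _ _ (fun n v hv => ?_) (fun s hs n v hv => X.mode_mem_orbit hs n hv)
        fun a ha b hb n m v hv => mode_circ_mem hσ ha hb n m hv
      rw [mode_one]
      split_ifs
      · exact hv
      · exact Submodule.zero_mem _
    rintro _ ⟨a, ha, rfl⟩
    exact hA ha (-1) _ (X.vacuum_mem_orbit S)
  · refine X.orbit_le ⟨one, one_mem_generated _ _, X.state_one⟩ ?_
    rintro s hs n _ ⟨a, ha, rfl⟩
    obtain ⟨p, hp⟩ := hS s hs
    have hat := generated_le_total (W := W) (S := S)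
      (fun s hs => let ⟨p, hp⟩ := hS s hs; W.le_total p hp) ha
    exact ⟨circ X.σ n s a, circ_mem_generated _ _ (subset_generated _ _ hs) ha n,
      state_circ_total hp hat n⟩

/-- Goddard uniqueness: if the vacuum is cyclic for a local space, a field in it is determined by
its state. -/
theorem state_injOn {S : Set (QO V)} (hS : ∀ s ∈ S, ∃ p, s ∈ W.carrier p)
    (hcyc : X.orbit S = ⊤) : Set.InjOn X.state (W.total : Set (QO V)) := by
  have key : ∀ p, ∀ a ∈ W.carrier p, X.state a = 0 → a = 0 := by
    intro p a ha h
    -- The vectors killed by all modes of a contain the vacuum by translation covariance, and by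
    -- locality they are stable under the generating fields. Cyclicity of the vacuum makes this
    -- subspace everything.
    let A : Submodule ℂ V := ⨅ n, LinearMap.ker (mode a n)
    have hA : ∀ v, v ∈ A ↔ ∀ n, mode a n v = 0 := fun v => by simp [A, Submodule.mem_iInf]
    have : X.orbit S ≤ A := by
      refine X.orbit_le ((hA _).mpr ((W.good ha).mode_vacuum_eq_zero h)) fun s hs n v hv => ?_
      obtain ⟨q, hq⟩ := hS s hs
      exact (hA _).mpr fun m =>
        (W.loc hq ha).mode_mode_eq_zero (koszul_mul_self _ _) ((hA _).mp hv) n m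
    rw [hcyc] at this
    refine ext_mode fun n => LinearMap.ext fun v => ?_
    rw [mode_zero]
    exact (hA v).mp (this trivial) n
  -- The states of the even and the odd component lie in different eigenspaces of the parity
  -- operator, so each of them vanishes separately.
  have key2 : ∀ a ∈ W.total, X.state a = 0 → a = 0 := by
    intro a ha h
    obtain ⟨a0, ha0, a1, ha1, rfl⟩ := Submodule.mem_sup.mp ha
    rw [map_add] at h
    have h0 : X.σ (X.state a0) = X.state a0 := by
      rw [X.state_apply, (W.good ha0).hom.apply, X.σ_Ω]; simp [psign]
    have h1 : X.σ (X.state a1) = -X.state a1 := by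
      rw [X.state_apply, (W.good ha1).hom.apply, X.σ_Ω]; simp [psign]
    have h2 := congrArg X.σ h
    rw [map_add, h0, h1, map_zero] at h2
    have e0 : X.state a0 = 0 := by
      have : (2 : ℂ) • X.state a0 = 0 := by
        rw [two_smul]; nth_rewrite 1 [← add_sub_cancel_right (X.state a0) (X.state a1)]
        rw [h, zero_sub, neg_add_eq_sub, ← h2]; abel_nf
      exact (smul_eq_zero.mp this).resolve_left two_ne_zero
    have e1 : X.state a1 = 0 := by simpa [e0] using h
    rw [key _ _ ha0 e0, key _ _ ha1 e1, add_zero]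
  intro a ha b hb h
  exact sub_eq_zero.mp (key2 _ (W.total.sub_mem ha hb) (by rw [map_sub, h, sub_self]))

end LocalSpace

/-- The residue of a(z)(z - w)⁻² is a'(w). This is the reason why subalgebras are closed under ∂. -/
theorem circ_neg_two_one {X : Vacuum V} {p : Bool} {a : QO V} (ha : IsHom X.σ p a) :
    circ X.σ (-2) a one = deriv a := by
  have hk : koszul p false = 1 := by cases p <;> rfl
  have hc : ∀ j : ℕ, circCoeff (-2) j = j + 1 := by
    intro j
    induction j with
    | zero => simp [circCoeff_zero]
    | succ j ih =>
      have := circCoeff_succ_succ (-2) j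
      rw [show (-2 : ℤ) + 1 = -1 by rfl, circCoeff_neg_one, ih] at this
      push_cast
      linear_combination -this
  rw [circ_eq_circE X.σ_mul_σ ha X.good_one.hom, hk]
  refine ext_mode fun m => LinearMap.ext fun v => ?_
  rw [mode_circE, mode_deriv, LinearMap.smul_apply]
  rcases lt_trichotomy m 0 with hm | rfl | hm
  · obtain ⟨k, rfl⟩ : ∃ k : ℕ, m = -1 - k := ⟨(-1 - m).toNat, by omega⟩
    rw [finsum_eq_single _ k]
    · rw [signedTerm, hc, mode_one, mode_one, if_pos (by omega), if_neg (by omega),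
        show -2 - (k : ℤ) = -1 - k - 1 by ring]
      push_cast
      simp only [Module.End.one_apply, LinearMap.zero_apply, smul_zero, sub_zero]
      congr 1
      ring
    · intro j hj
      rw [signedTerm, mode_one, mode_one, if_neg (by omega), if_neg (by omega)]
      simp
  · rw [finsum_eq_zero_of_forall_eq_zero]
    · simp
    · intro j
      rw [signedTerm, mode_one, mode_one, if_neg (by omega), if_neg (by omega)]
      simp
  · obtain ⟨k, rfl⟩ : ∃ k : ℕ, m = k + 1 := ⟨(m - 1).toNat, by omega⟩
    rw [finsum_eq_single _ k]
    · rw [signedTerm, hc, mode_one, mode_one, if_neg (by omega), if_pos (by omega),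
        show (k : ℤ) + 1 - 1 = k by ring]
      simp only [Module.End.one_apply, LinearMap.zero_apply, map_zero, zero_sub]
      push_cast
      norm_num
      module
    · intro j hj
      rw [signedTerm, mode_one, mode_one, if_neg (by omega), if_neg (by omega)]
      simp

end LocalFields

section SuperPolynomial

/-! ### Super polynomial algebras -/

/-- The super polynomial algebra with even variables `σ` and odd variables `τ`. -/
def SP (σ τ : Type) : Type := MvPolynomial σ ℂ ⊗[ℂ] ExteriorAlgebra ℂ (τ →₀ ℂ)

instance (σ τ : Type) : Ring (SP σ τ) :=
  inferInstanceAs (Ring (MvPolynomial σ ℂ ⊗[ℂ] ExteriorAlgebra ℂ (τ →₀ ℂ)))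

instance (σ τ : Type) : Algebra ℂ (SP σ τ) :=
  inferInstanceAs (Algebra ℂ (MvPolynomial σ ℂ ⊗[ℂ] ExteriorAlgebra ℂ (τ →₀ ℂ)))

variable {σ τ : Type}

/-- An odd variable in the exterior algebra. -/
def oddVar (o : τ) : ExteriorAlgebra ℂ (τ →₀ ℂ) := ExteriorAlgebra.ι ℂ (Finsupp.single o 1)

/-- The product of a polynomial in the even variables and an element of the exterior algebra. -/
def SP.tmul : MvPolynomial σ ℂ →ₗ[ℂ] ExteriorAlgebra ℂ (τ →₀ ℂ) →ₗ[ℂ] SP σ τ :=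
  TensorProduct.mk ℂ _ _

theorem SP.tmul_mul_tmul (f f' : MvPolynomial σ ℂ) (e e' : ExteriorAlgebra ℂ (τ →₀ ℂ)) :
    SP.tmul f e * SP.tmul f' e' = SP.tmul (f * f') (e * e') :=
  Algebra.TensorProduct.tmul_mul_tmul f f' e e'

theorem SP.tmul_le {P : Submodule ℂ (SP σ τ)} (h : ∀ f e, SP.tmul f e ∈ P) (p : SP σ τ) :
    p ∈ P :=
  TensorProduct.induction_on (motive := fun p : SP σ τ => p ∈ P) p P.zero_mem h
    fun _ _ hx hy => P.add_mem hx hy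

theorem SP.exists_algHom {A : Type*} [Ring A] [Algebra ℂ A] (f : MvPolynomial σ ℂ →ₐ[ℂ] A)
    (g : ExteriorAlgebra ℂ (τ →₀ ℂ) →ₐ[ℂ] A) (hfg : ∀ p q, Commute (f p) (g q)) :
    ∃ F : SP σ τ →ₐ[ℂ] A, ∀ p q, F (SP.tmul p q) = f p * g q :=
  ⟨Algebra.TensorProduct.lift f g hfg, fun p q => Algebra.TensorProduct.lift_tmul f g hfg p q⟩

/-- An even variable. -/
def SP.ev (i : σ) : SP σ τ := SP.tmul (MvPolynomial.X i) 1

/-- An odd variable. -/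
def SP.od (o : τ) : SP σ τ := SP.tmul 1 (oddVar o)

theorem ι_eq_sum (m : τ →₀ ℂ) :
    ExteriorAlgebra.ι ℂ m = m.sum fun o c => c • oddVar o := by
  conv_lhs => rw [← Finsupp.sum_single m]
  rw [map_finsuppSum]
  refine Finsupp.sum_congr fun o _ => ?_
  rw [oddVar, ← map_smul, Finsupp.smul_single_one]

theorem oddVar_anticomm (o o' : τ) : oddVar o * oddVar o' + oddVar o' * oddVar o = 0 :=
  ExteriorAlgebra.ι_add_mul_swap _ _

theorem exterior_le_of_mem {P : Submodule ℂ (ExteriorAlgebra ℂ (τ →₀ ℂ))} (h1 : 1 ∈ P)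
    (hod : ∀ o, ∀ p ∈ P, oddVar o * p ∈ P) (p : ExteriorAlgebra ℂ (τ →₀ ℂ)) : p ∈ P := by
  induction p using CliffordAlgebra.left_induction with
  | algebraMap r => rw [Algebra.algebraMap_eq_smul_one]; exact P.smul_mem _ h1
  | add p q hp hq => exact P.add_mem hp hq
  | ι_mul p m hp =>
    have : CliffordAlgebra.ι (0 : QuadraticForm ℂ (τ →₀ ℂ)) m = ExteriorAlgebra.ι ℂ m := rfl
    rw [this, ι_eq_sum, Finsupp.sum_mul]
    exact P.sum_mem fun o _ => by
      change (m o • oddVar o) * p ∈ P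
      rw [smul_mul_assoc]; exact P.smul_mem _ (hod o p hp)

theorem SP.mem_of_mem {P : Submodule ℂ (SP σ τ)} (h1 : 1 ∈ P)
    (hev : ∀ i, ∀ p ∈ P, SP.ev i * p ∈ P) (hod : ∀ o, ∀ p ∈ P, SP.od o * p ∈ P)
    (p : SP σ τ) : p ∈ P := by
  have hf : ∀ f : MvPolynomial σ ℂ, SP.tmul f 1 ∈ P := by
    intro f
    induction f using MvPolynomial.induction_on with
    | C r =>
      rw [MvPolynomial.C_eq_smul_one, map_smul]
      exact P.smul_mem _ h1
    | add f g hf hg => rw [map_add]; exact P.add_mem hf hg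
    | mul_X f i hf =>
      have := hev i _ hf
      rwa [SP.ev, SP.tmul_mul_tmul, one_mul, mul_comm] at this
  refine SP.tmul_le (fun f e => ?_) p
  have : e ∈ P.comap (SP.tmul f) := by
    refine exterior_le_of_mem (hf f) (fun o e he => ?_) e
    have := hod o _ he
    rwa [SP.od, SP.tmul_mul_tmul, one_mul] at this
  exact this

theorem SP.ev_comm (i : σ) (p : SP σ τ) : SP.ev i * p = p * SP.ev i := by
  have : p ∈ LinearMap.ker (LinearMap.mulLeft ℂ (SP.ev i) - LinearMap.mulRight ℂ (SP.ev i)) := by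
    refine SP.tmul_le (fun f e => ?_) p
    rw [LinearMap.mem_ker, LinearMap.sub_apply, LinearMap.mulLeft_apply, LinearMap.mulRight_apply,
      sub_eq_zero, SP.ev, SP.tmul_mul_tmul, SP.tmul_mul_tmul, one_mul, mul_one, mul_comm]
  simpa [sub_eq_zero] using this

theorem SP.od_anticomm (o o' : τ) :
    (SP.od o : SP σ τ) * SP.od o' + SP.od o' * SP.od o = 0 := by
  simp only [SP.od, SP.tmul_mul_tmul, one_mul, ← map_add, oddVar_anticomm, map_zero]

theorem linearCombination_mul_self {A : Type*} [Ring A] [Algebra ℂ A] (k : τ → A)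
    (hk : ∀ o o', k o * k o' + k o' * k o = 0) (m : τ →₀ ℂ) :
    Finsupp.linearCombination ℂ k m * Finsupp.linearCombination ℂ k m = 0 := by
  rw [Finsupp.linearCombination_apply, Finsupp.sum, Finset.sum_mul_sum]
  have h2 : (2 : ℂ) • ∑ i ∈ m.support, ∑ j ∈ m.support, m i • k i * m j • k j = 0 := by
    rw [two_smul]
    nth_rewrite 2 [Finset.sum_comm]
    rw [← Finset.sum_add_distrib]
    refine Finset.sum_eq_zero fun i _ => ?_
    rw [← Finset.sum_add_distrib]
    refine Finset.sum_eq_zero fun j _ => ?_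
    rw [smul_mul_smul_comm, smul_mul_smul_comm, mul_comm (m j), ← smul_add, hk, smul_zero]
  exact (smul_eq_zero.mp h2).resolve_left two_ne_zero

/-- The universal property of the super polynomial algebra. -/
theorem SP.exists_lift {A : Type*} [Ring A] [Algebra ℂ A] (e : σ → A) (k : τ → A)
    (he : ∀ i j, Commute (e i) (e j)) (hk : ∀ o o', k o * k o' + k o' * k o = 0)
    (hek : ∀ i o, Commute (e i) (k o)) :
    ∃ F : SP σ τ →ₐ[ℂ] A, (∀ i, F (SP.ev i) = e i) ∧ ∀ o, F (SP.od o) = k o := by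
  obtain ⟨f, hf⟩ : ∃ f : MvPolynomial σ ℂ →ₐ[ℂ] A, ∀ i, f (MvPolynomial.X i) = e i := by
    -- `aeval` needs a commutative target, so the map is first built into the subalgebra generated
    -- by the commuting elements e i.
    let _ : CommRing (Algebra.adjoin ℂ (Set.range e)) :=
      { (inferInstance : Ring (Algebra.adjoin ℂ (Set.range e))) with
        mul_comm := (Algebra.isMulCommutative_adjoin ℂ (s := Set.range e) (by
          rintro _ ⟨i, rfl⟩ _ ⟨j, rfl⟩
          exact he i j)).is_comm.comm }
    let f0 : MvPolynomial σ ℂ →ₐ[ℂ] Algebra.adjoin ℂ (Set.range e) :=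
      MvPolynomial.aeval fun i => ⟨e i, Algebra.subset_adjoin ⟨i, rfl⟩⟩
    refine ⟨(Algebra.adjoin ℂ (Set.range e)).val.comp f0, fun i => ?_⟩
    simp [f0]
  let g : ExteriorAlgebra ℂ (τ →₀ ℂ) →ₐ[ℂ] A :=
    ExteriorAlgebra.lift ℂ ⟨Finsupp.linearCombination ℂ k, linearCombination_mul_self k hk⟩
  have hg : ∀ o, g (oddVar o) = k o := by
    intro o
    simp [g, oddVar]
  have hfk : ∀ p o, Commute (f p) (k o) := by
    intro p o
    induction p using MvPolynomial.induction_on with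
    | C r => rw [← MvPolynomial.algebraMap_eq, AlgHom.commutes]; exact Algebra.commutes r _
    | add p q hp hq => rw [map_add]; exact hp.add_left hq
    | mul_X p i hp => rw [map_mul, hf]; exact hp.mul_left (hek i o)
  have hfg : ∀ p q, Commute (f p) (g q) := by
    intro p q
    let P : Submodule ℂ (ExteriorAlgebra ℂ (τ →₀ ℂ)) :=
      { carrier := {q | Commute (f p) (g q)}
        add_mem' := fun {a b} ha hb => by
          change Commute _ _; rw [map_add]; exact Commute.add_right ha hb
        zero_mem' := by change Commute _ _; rw [map_zero]; exact Commute.zero_right _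
        smul_mem' := fun r a ha => by
          change Commute _ _; rw [map_smul]; exact Commute.smul_right ha r }
    refine exterior_le_of_mem (P := P) ?_ (fun o q hq => ?_) q
    · change Commute _ _; rw [map_one]; exact Commute.one_right _
    · change Commute _ _; rw [map_mul, hg]; exact (hfk p o).mul_right hq
  obtain ⟨F, hF⟩ := SP.exists_algHom f g hfg
  exact ⟨F, fun i => by rw [SP.ev, hF, hf, map_one, mul_one],
    fun o => by rw [SP.od, hF, hg, map_one, one_mul]⟩

/-- Even and odd derivations of the super polynomial algebra with prescribed values on the
variables. -/
theorem SP.exists_derivation (η : ℂ) (u : σ → SP σ τ) (w : τ → SP σ τ)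
    (hu : ∀ i o, u i * SP.od o = η • (SP.od o * u i))
    (hw : ∀ o o', η • (SP.od o * w o') + w o * SP.od o' + η • (SP.od o' * w o) + w o' * SP.od o = 0)
    (hη : η * η = 1) :
    ∃ D : SP σ τ →ₗ[ℂ] SP σ τ, D 1 = 0 ∧ (∀ i p, D (SP.ev i * p) = SP.ev i * D p + u i * p) ∧
      ∀ o p, D (SP.od o * p) = η • (SP.od o * D p) + w o * p := by
  -- A derivation is the upper right entry of an algebra map into triangular 2 × 2 matrices. The
  -- upper left entry carries the twist η on odd variables. The hypotheses on `u` and `w` are the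
  -- supercommutation relations for the upper right entries.
  let e : σ → Matrix (Fin 2) (Fin 2) (SP σ τ) := fun i => !![SP.ev i, u i; 0, SP.ev i]
  let k : τ → Matrix (Fin 2) (Fin 2) (SP σ τ) := fun o => !![η • SP.od o, w o; 0, SP.od o]
  obtain ⟨F, hFe, hFk⟩ := SP.exists_lift e k
    (fun i j => by
      simp only [e, Commute, SemiconjBy, Matrix.mul_fin_two, mul_zero, add_zero, zero_add, zero_mul]
      rw [SP.ev_comm i (SP.ev j), SP.ev_comm i (u j), ← SP.ev_comm j (u i), add_comm])
    (fun o o' => by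
      have h := SP.od_anticomm (σ := σ) o o'
      simp only [k, Matrix.mul_fin_two, mul_zero, add_zero, zero_add, zero_mul,
        smul_mul_smul_comm, hη, one_smul]
      ext i j
      fin_cases i <;> fin_cases j <;> simp
      · exact h
      · rw [← hw o o']; abel
      · exact h)
    (fun i o => by
      simp only [e, k, Commute, SemiconjBy, Matrix.mul_fin_two, mul_zero, add_zero, zero_add,
        zero_mul, smul_mul_assoc, mul_smul_comm]
      rw [SP.ev_comm i (SP.od o), SP.ev_comm i (w o), hu, add_comm, smul_zero])
  have h22 : ∀ p, F p 1 1 = p ∧ F p 1 0 = 0 := by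
    intro p
    let P : Submodule ℂ (SP σ τ) :=
      { carrier := {p | F p 1 1 = p ∧ F p 1 0 = 0}
        add_mem' := fun {a b} ha hb => by
          change _ ∧ _; rw [map_add, Matrix.add_apply, Matrix.add_apply, ha.1, ha.2, hb.1, hb.2]
          simp
        zero_mem' := by change _ ∧ _; rw [map_zero]; simp
        smul_mem' := fun r a ha => by
          change _ ∧ _; rw [map_smul, Matrix.smul_apply, Matrix.smul_apply, ha.1, ha.2]; simp }
    refine SP.mem_of_mem (P := P) ?_ (fun i p hp => ?_) (fun o p hp => ?_) p
    · change _ ∧ _; rw [map_one]; simp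
    · change _ ∧ _
      rw [map_mul, hFe, Matrix.mul_apply, Matrix.mul_apply, Fin.sum_univ_two, Fin.sum_univ_two,
        hp.1, hp.2]
      simp [e]
    · change _ ∧ _
      rw [map_mul, hFk, Matrix.mul_apply, Matrix.mul_apply, Fin.sum_univ_two, Fin.sum_univ_two,
        hp.1, hp.2]
      simp [k]
  refine ⟨{ toFun := fun p => F p 0 1
            map_add' := fun p q => by rw [map_add, Matrix.add_apply]
            map_smul' := fun r p => by rw [map_smul, Matrix.smul_apply, RingHom.id_apply] },
    ?_, fun i p => ?_, fun o p => ?_⟩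
  · change F 1 0 1 = 0; rw [map_one]; simp
  · change F _ 0 1 = _ * F _ 0 1 + _
    rw [map_mul, hFe, Matrix.mul_apply, Fin.sum_univ_two, (h22 p).1]
    simp [e]
  · change F _ 0 1 = _ • (_ * F _ 0 1) + _
    rw [map_mul, hFk, Matrix.mul_apply, Fin.sum_univ_two, (h22 p).1]
    simp [k]

end SuperPolynomial

section Koszul

/-! ### The Koszul complex -/

variable (O X : Type)

/-- The subspace spanned by the polynomials in the closed even variables. -/
def closedPoly : Submodule ℂ (SP (O ⊕ X) O) :=
  sInf {A | 1 ∈ A ∧ ∀ i : X, ∀ p ∈ A, SP.ev (Sum.inr i) * p ∈ A}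

variable {O X}

/-- The odd derivation h that sends each odd variable back to its even partner is a homotopy: dh +
hd counts the variables that are not closed. Over ℂ a closed element of positive weight can be
divided by its weight, and weight 0 consists of the polynomials in the closed variables. -/
theorem exists_koszul : ∃ d : SP (O ⊕ X) O →ₗ[ℂ] SP (O ⊕ X) O, d 1 = 0 ∧
    (∀ o p, d (SP.ev (Sum.inl o) * p) = SP.ev (Sum.inl o) * d p + SP.od o * p) ∧
    (∀ i p, d (SP.ev (Sum.inr i) * p) = SP.ev (Sum.inr i) * d p) ∧
    (∀ o p, d (SP.od o * p) = -(SP.od o * d p)) ∧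
    ∀ p, d p = 0 → ∃ q, p - d q ∈ closedPoly O X := by
  obtain ⟨d, hd1, hde, hdo⟩ := SP.exists_derivation (σ := O ⊕ X) (τ := O) (-1)
    (Sum.elim (fun o => SP.od o) 0) 0 (by
      rintro (o | i) o'
      · rw [neg_one_smul, Sum.elim_inl]; exact eq_neg_of_add_eq_zero_left (SP.od_anticomm o o')
      · simp) (by simp) (by norm_num)
  obtain ⟨h, hh1, hhe, hho⟩ := SP.exists_derivation (σ := O ⊕ X) (τ := O) (-1)
    0 (fun o => SP.ev (Sum.inl o)) (by simp) (by
      intro o o'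
      rw [SP.ev_comm, SP.ev_comm]
      module) (by norm_num)
  have hdl : ∀ o p, d (SP.ev (Sum.inl o) * p) = SP.ev (Sum.inl o) * d p + SP.od o * p :=
    fun o p => hde _ p
  have hdr : ∀ i p, d (SP.ev (Sum.inr i) * p) = SP.ev (Sum.inr i) * d p :=
    fun i p => by rw [hde]; simp
  have hdo' : ∀ o p, d (SP.od o * p) = -(SP.od o * d p) := fun o p => by rw [hdo]; simp
  have hhe' : ∀ i p, h (SP.ev i * p) = SP.ev i * h p := fun i p => by rw [hhe]; simp
  have hho' : ∀ o p, h (SP.od o * p) = -(SP.od o * h p) + SP.ev (Sum.inl o) * p :=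
    fun o p => by rw [hho]; simp
  refine ⟨d, hd1, hdl, hdr, hdo', ?_⟩
  -- The Euler operator: weight one on each odd variable and on its even partner, weight zero on the
  -- closed variables.
  let N : Module.End ℂ (SP (O ⊕ X) O) := d * h + h * d
  have hN : ∀ p, N p = d (h p) + h (d p) := fun p => rfl
  have hNl : ∀ o p, N (SP.ev (Sum.inl o) * p) = SP.ev (Sum.inl o) * N p + SP.ev (Sum.inl o) * p := by
    intro o p
    simp only [hN, hhe', hdl, hho', map_add, mul_add]
    abel
  have hNr : ∀ i p, N (SP.ev (Sum.inr i) * p) = SP.ev (Sum.inr i) * N p := by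
    intro i p
    simp only [hN, hhe', hdr, mul_add]
  have hNo : ∀ o p, N (SP.od o * p) = SP.od o * N p + SP.od o * p := by
    intro o p
    simp only [hN, hho', hdo', hdl, map_add, map_neg, mul_add]
    abel
  have hdd : ∀ p, d (d p) = 0 := by
    intro p
    have : p ∈ LinearMap.ker (d ∘ₗ d) := by
      refine SP.mem_of_mem (by simp [hd1]) (fun i p hp => ?_) (fun o p hp => ?_) p
      · rw [LinearMap.mem_ker, LinearMap.comp_apply] at hp ⊢
        rcases i with o | i
        · rw [hdl, map_add, hdl, hdo', hp]; simp
        · rw [hdr, hdr, hp]; simp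
      · rw [LinearMap.mem_ker, LinearMap.comp_apply] at hp ⊢
        rw [hdo', map_neg, hdo', hp]; simp
    exact this
  -- every element is a sum of a closed polynomial and eigenvectors of `N` of positive eigenvalue
  let E : ℕ → Submodule ℂ (SP (O ⊕ X) O) := fun n =>
    Module.End.eigenspace N (n : ℂ)
  have hE : ∀ n p, p ∈ E n ↔ N p = (n : ℂ) • p := fun n p => Module.End.mem_eigenspace_iff
  have h1c : (1 : SP (O ⊕ X) O) ∈ closedPoly O X := Submodule.mem_sInf.mpr fun A hA => hA.1
  have hxc : ∀ i, ∀ p ∈ closedPoly O X, SP.ev (Sum.inr i) * p ∈ closedPoly O X := fun i p hp =>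
    Submodule.mem_sInf.mpr fun A hA => hA.2 i p (Submodule.mem_sInf.mp hp A hA)
  have key : ∀ p, p ∈ closedPoly O X ⊔ ⨆ n : ℕ, E (n + 1) := by
    have mulmem : ∀ (a : SP (O ⊕ X) O) (k : ℕ), (∀ n, ∀ q ∈ E (n + 1), a * q ∈ E (n + k + 1)) →
        ∀ q ∈ ⨆ n : ℕ, E (n + 1), a * q ∈ ⨆ n : ℕ, E (n + 1) := by
      intro a k ha q hq
      have : ⨆ n : ℕ, E (n + 1) ≤ (⨆ n : ℕ, E (n + 1)).comap (LinearMap.mulLeft ℂ a) :=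
        iSup_le fun n q hq => Submodule.mem_iSup_of_mem (n + k) (ha n q hq)
      exact this hq
    have hc0 : ∀ p ∈ closedPoly O X, N p = 0 := by
      intro p hp
      have : closedPoly O X ≤ LinearMap.ker N := sInf_le ⟨by
        rw [LinearMap.mem_ker, hN, hh1, hd1, map_zero, map_zero, add_zero], fun i p hp => by
        rw [LinearMap.mem_ker] at hp ⊢; rw [hNr, hp, mul_zero]⟩
      exact this hp
    intro p
    refine SP.mem_of_mem (Submodule.mem_sup_left h1c) (fun i p hp => ?_) (fun o p hp => ?_) p
    · obtain ⟨a, ha, b, hb, rfl⟩ := Submodule.mem_sup.mp hp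
      rw [mul_add]
      rcases i with o | i
      · refine Submodule.mem_sup_right (Submodule.add_mem _ (Submodule.mem_iSup_of_mem 0 ?_)
          (mulmem _ 1 (fun n q hq => ?_) b hb))
        · rw [hE, hNl, hc0 a ha]; simp
        · rw [hE] at hq ⊢
          rw [hNl, hq, mul_smul_comm]
          push_cast
          module
      · refine Submodule.add_mem_sup (hxc i a ha) (mulmem _ 0 (fun n q hq => ?_) b hb)
        rw [hE] at hq ⊢
        rw [hNr, hq, mul_smul_comm]
    · obtain ⟨a, ha, b, hb, rfl⟩ := Submodule.mem_sup.mp hp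
      rw [mul_add]
      refine Submodule.mem_sup_right (Submodule.add_mem _ (Submodule.mem_iSup_of_mem 0 ?_)
          (mulmem _ 1 (fun n q hq => ?_) b hb))
      · rw [hE, hNo, hc0 a ha]; simp
      · rw [hE] at hq ⊢
        rw [hNo, hq, mul_smul_comm]
        push_cast
        module
  have hdc : ∀ p ∈ closedPoly O X, d p = 0 := by
    intro p hp
    have : closedPoly O X ≤ LinearMap.ker d := sInf_le ⟨hd1, fun i p hp => by
      rw [LinearMap.mem_ker] at hp ⊢; rw [hdr, hp, mul_zero]⟩
    exact this hp
  intro p hp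
  obtain ⟨a, ha, b, hb, rfl⟩ := Submodule.mem_sup.mp (key p)
  rw [map_add, hdc a ha, zero_add] at hp
  obtain ⟨f, hf, rfl⟩ := (Submodule.mem_iSup_iff_exists_finsupp _ _).mp hb
  -- Since d commutes with N, the components of a closed element in the distinct eigenspaces are
  -- closed separately.
  have hdf : ∀ n, d (f n) = 0 := by
    have hind : iSupIndep fun n : ℕ => E (n + 1) := by
      have := (Module.End.eigenspaces_iSupIndep N).comp
        (f := fun n : ℕ => ((n + 1 : ℕ) : ℂ)) (fun a b h => by simpa using h)
      exact this
    have hmem : ∀ n, d (f n) ∈ E (n + 1) := by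
      intro n
      have h2 := (hE _ _).mp (hf n)
      have h3 := congrArg d h2
      rw [hE]
      rw [hN, map_add, hdd, zero_add, map_smul] at h3
      rw [hN, hdd, map_zero, add_zero, h3]
    have := (iSupIndep_iff_finsetSum_eq_zero_imp_eq_zero _).mp hind f.support
      (fun n => d (f n)) (fun n _ => hmem n) (by rw [← hp, map_finsuppSum]; rfl)
    intro n
    by_cases hn : n ∈ f.support
    · exact this n hn
    · rw [Finsupp.notMem_support_iff.mp hn, map_zero]
  -- On a closed element of weight n + 1 the operator N reduces to dh, so h divided by n + 1
  -- provides a primitive.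
  refine ⟨f.sum fun n x => ((n + 1 : ℕ) : ℂ)⁻¹ • h x, ?_⟩
  have : d (f.sum fun n x => ((n + 1 : ℕ) : ℂ)⁻¹ • h x) = f.sum fun _ x => x := by
    rw [map_finsuppSum]
    refine Finsupp.sum_congr fun n _ => ?_
    have h2 := (hE _ _).mp (hf n)
    rw [hN, hdf, map_zero, add_zero] at h2
    rw [map_smul, h2, smul_smul, inv_mul_cancel₀ (Nat.cast_ne_zero.mpr (by omega)), one_smul]
  rw [this, add_sub_cancel_right]
  exact ha

end Koszul

section Filtered

/-! ### Filtered Koszul complexes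

A vector space generated from one vector by operators that super commute up to words of lower
length, with a differential that is a Koszul differential on these operators. -/

variable {V : Type} [AddCommGroup V] [Module ℂ V] {O X : Type}

/-- The words of length at most `n` in the operators `op`, applied to `Ω`. -/
def wordSpan {G : Type} (op : G → Module.End ℂ V) (Ω : V) : ℕ → Submodule ℂ V
  | 0 => ℂ ∙ Ω
  | n + 1 => wordSpan op Ω n ⊔ ⨆ g, (wordSpan op Ω n).map (op g)

/-! ### The filtration by word length and its associated graded space. -/

section WordSpan

variable {G : Type} (op : G → Module.End ℂ V) (Ω : V)

theorem vacuum_mem_wordSpan : Ω ∈ wordSpan op Ω 0 := Submodule.mem_span_singleton_self Ω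

theorem wordSpan_le_succ (n : ℕ) : wordSpan op Ω n ≤ wordSpan op Ω (n + 1) := le_sup_left

theorem wordSpan_mono : Monotone (wordSpan op Ω) := monotone_nat_of_le_succ (wordSpan_le_succ op Ω)

theorem op_mem_wordSpan (g : G) {n : ℕ} {v : V} (hv : v ∈ wordSpan op Ω n) :
    op g v ∈ wordSpan op Ω (n + 1) :=
  Submodule.mem_sup_right (Submodule.mem_iSup_of_mem g (Submodule.mem_map_of_mem hv))

theorem span_op_mem_wordSpan {A : Module.End ℂ V} (hA : A ∈ Submodule.span ℂ (Set.range op)) {n : ℕ}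
    {v : V} (hv : v ∈ wordSpan op Ω n) : A v ∈ wordSpan op Ω (n + 1) := by
  have : Submodule.span ℂ (Set.range op) ≤
      (wordSpan op Ω (n + 1)).comap (LinearMap.applyₗ v) := by
    rw [Submodule.span_le]
    rintro _ ⟨g, rfl⟩
    exact op_mem_wordSpan op Ω g hv
  exact this hA

theorem wordSpan_succ_le {P : Submodule ℂ V} {n : ℕ} (h : wordSpan op Ω n ≤ P)
    (hop : ∀ g, ∀ v ∈ wordSpan op Ω n, op g v ∈ P) : wordSpan op Ω (n + 1) ≤ P :=
  sup_le h (iSup_le fun g => Submodule.map_le_iff_le_comap.mpr fun v hv => hop g v hv)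

/-- The previous step of the filtration by word length. -/
def wordSpanPred : ℕ → Submodule ℂ V
  | 0 => ⊥
  | n + 1 => wordSpan op Ω n

/-- The shift of an operator, acting on sequences. -/
def shiftOp (A : Module.End ℂ V) : Module.End ℂ (ℕ →₀ V) :=
  (Finsupp.mapRange.linearMap A) ∘ₗ (Finsupp.lmapDomain V ℂ Nat.succ)

theorem shiftOp_succ (A : Module.End ℂ V) (f : ℕ →₀ V) (n : ℕ) :
    shiftOp A f (n + 1) = A (f n) := by
  simp only [shiftOp, LinearMap.comp_apply, Finsupp.mapRange.linearMap_apply,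
    Finsupp.mapRange_apply, Finsupp.lmapDomain_apply]
  congr 1
  exact Finsupp.mapDomain_apply Nat.succ_injective f n

theorem shiftOp_zero (A : Module.End ℂ V) (f : ℕ →₀ V) : shiftOp A f 0 = 0 := by
  simp only [shiftOp, LinearMap.comp_apply, Finsupp.mapRange.linearMap_apply,
    Finsupp.mapRange_apply, Finsupp.lmapDomain_apply]
  rw [Finsupp.mapDomain_of_notMem_range _ _ (by simp), map_zero]

theorem shiftOp_single (A : Module.End ℂ V) (n : ℕ) (v : V) :
    shiftOp A (Finsupp.single n v) = Finsupp.single (n + 1) (A v) := by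
  simp [shiftOp, Finsupp.mapDomain_single]

/-- Sequences with `n`-th term in the `n`-th step of the filtration. -/
def rees : Submodule ℂ (ℕ →₀ V) where
  carrier := {f | ∀ n, f n ∈ wordSpan op Ω n}
  add_mem' ha hb n := Submodule.add_mem _ (ha n) (hb n)
  zero_mem' _ := Submodule.zero_mem _
  smul_mem' r _ ha n := Submodule.smul_mem _ r (ha n)

/-- Sequences with `n`-th term in the previous step of the filtration. -/
def reesPred : Submodule ℂ (ℕ →₀ V) where
  carrier := {f | ∀ n, f n ∈ wordSpanPred op Ω n}
  add_mem' ha hb n := Submodule.add_mem _ (ha n) (hb n)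
  zero_mem' _ := Submodule.zero_mem _
  smul_mem' r _ ha n := Submodule.smul_mem _ r (ha n)

/-- The associated graded space of the filtration by word length. -/
abbrev assocGr : Type := rees op Ω ⧸ (reesPred op Ω).comap (rees op Ω).subtype

theorem single_mem_rees {n : ℕ} {v : V} (hv : v ∈ wordSpan op Ω n) :
    Finsupp.single n v ∈ rees op Ω := by
  intro m
  rcases eq_or_ne n m with rfl | h
  · rwa [Finsupp.single_eq_same]
  · rw [Finsupp.single_eq_of_ne h.symm]; exact Submodule.zero_mem _

theorem shiftOp_mem_rees (g : G) {f : ℕ →₀ V} (hf : f ∈ rees op Ω) :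
    shiftOp (op g) f ∈ rees op Ω := by
  rintro (_ | n)
  · rw [shiftOp_zero]; exact Submodule.zero_mem _
  · rw [shiftOp_succ]; exact op_mem_wordSpan op Ω g (hf n)

theorem shiftOp_mem_reesPred (g : G) {f : ℕ →₀ V} (hf : f ∈ reesPred op Ω) :
    shiftOp (op g) f ∈ reesPred op Ω := by
  rintro (_ | n)
  · rw [shiftOp_zero]; exact Submodule.zero_mem _
  · rw [shiftOp_succ]
    cases n with
    | zero =>
      rw [(Submodule.mem_bot ℂ).mp (hf 0), map_zero]; exact Submodule.zero_mem _
    | succ n => exact op_mem_wordSpan op Ω g (hf (n + 1))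

/-- An operator on sequences that preserves both filtrations acts on the associated graded
space. -/
def grOp (A : Module.End ℂ (ℕ →₀ V)) (h1 : ∀ f ∈ rees op Ω, A f ∈ rees op Ω)
    (h2 : ∀ f ∈ reesPred op Ω, A f ∈ reesPred op Ω) : Module.End ℂ (assocGr op Ω) :=
  Submodule.mapQ _ _ (A.restrict h1) fun f hf => h2 f.1 hf

/-- The class of a sequence in the associated graded space. -/
def grMk (f : ℕ →₀ V) (hf : f ∈ rees op Ω) : assocGr op Ω := Submodule.Quotient.mk ⟨f, hf⟩

theorem grOp_mk (A : Module.End ℂ (ℕ →₀ V)) (h1) (h2) (f : ℕ →₀ V) (hf : f ∈ rees op Ω) :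
    grOp op Ω A h1 h2 (grMk op Ω f hf) = grMk op Ω (A f) (h1 f hf) := rfl

theorem grMk_eq_iff {f f' : ℕ →₀ V} (hf : f ∈ rees op Ω) (hf' : f' ∈ rees op Ω) :
    grMk op Ω f hf = grMk op Ω f' hf' ↔ f - f' ∈ reesPred op Ω := by
  rw [grMk, grMk, Submodule.Quotient.eq]; rfl

theorem exists_grMk (x : assocGr op Ω) : ∃ f hf, grMk op Ω f hf = x := by
  obtain ⟨⟨f, hf⟩, rfl⟩ := Submodule.Quotient.mk_surjective _ x
  exact ⟨f, hf, rfl⟩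

theorem grMk_congr {f f' : ℕ →₀ V} (hf : f ∈ rees op Ω) (hf' : f' ∈ rees op Ω) (h : f = f') :
    grMk op Ω f hf = grMk op Ω f' hf' := by subst h; rfl

theorem grMk_add {f f' : ℕ →₀ V} (hf : f ∈ rees op Ω) (hf' : f' ∈ rees op Ω) :
    grMk op Ω (f + f') (Submodule.add_mem _ hf hf') = grMk op Ω f hf + grMk op Ω f' hf' := rfl

theorem grMk_smul (r : ℂ) {f : ℕ →₀ V} (hf : f ∈ rees op Ω) :
    grMk op Ω (r • f) (Submodule.smul_mem _ r hf) = r • grMk op Ω f hf := rfl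

theorem grMk_eq_zero {f : ℕ →₀ V} (hf : f ∈ rees op Ω) (h : f ∈ reesPred op Ω) :
    grMk op Ω f hf = 0 := by
  rw [grMk, Submodule.Quotient.mk_eq_zero]; exact h

end WordSpan

/-- The operators of a filtered Koszul complex. -/
structure KoszulOps (V : Type) [AddCommGroup V] [Module ℂ V] (O X : Type) where
  Ω : V
  ev : O ⊕ X → Module.End ℂ V
  od : O → Module.End ℂ V
  d : Module.End ℂ V

namespace KoszulOps

/-- All generating operators. -/
def op (K : KoszulOps V O X) : (O ⊕ X) ⊕ O → Module.End ℂ V := Sum.elim K.ev K.od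

/-- The relations of a filtered Koszul complex. -/
structure Rel (K : KoszulOps V O X) : Prop where
  comm : ∀ e g, K.ev e * K.op g - K.op g * K.ev e ∈ Submodule.span ℂ (Set.range K.op)
  anticomm : ∀ o o', K.od o * K.od o' + K.od o' * K.od o = 0
  d_Ω : K.d K.Ω = 0
  d_inl : ∀ o, K.d * K.ev (Sum.inl o) = K.ev (Sum.inl o) * K.d + K.od o
  d_inr : ∀ i, K.d * K.ev (Sum.inr i) = K.ev (Sum.inr i) * K.d
  d_od : ∀ o, K.d * K.od o = -(K.od o * K.d)

/-- The generating operators have independent symbols: their symbols can be specialised to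
arbitrary numbers `z` (with one of them nonzero) and to free odd variables. -/
def Separated (K : KoszulOps V O X) (o₀ : O) : Prop :=
  ∀ z : O ⊕ X → ℂ, z (Sum.inl o₀) ≠ 0 → ∃ t : ℕ → V →ₗ[ℂ] ExteriorAlgebra ℂ (O →₀ ℂ),
    t 0 K.Ω = 1 ∧ (∀ n, ∀ v ∈ wordSpan K.op K.Ω n, t (n + 1) v = 0) ∧
    (∀ n e, ∀ v ∈ wordSpan K.op K.Ω n, t (n + 1) (K.ev e v) = z e • t n v) ∧
    ∀ n o, ∀ v ∈ wordSpan K.op K.Ω n, t (n + 1) (K.od o v) = oddVar o * t n v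

/-- The span of the words in the closed even operators. -/
def closedWords (K : KoszulOps V O X) : Submodule ℂ V :=
  sInf {A | K.Ω ∈ A ∧ ∀ i, ∀ v ∈ A, K.ev (Sum.inr i) v ∈ A}

variable {K : KoszulOps V O X}

theorem Ω_mem_closedWords : K.Ω ∈ K.closedWords := Submodule.mem_sInf.mpr fun _ hA => hA.1

theorem ev_mem_closedWords (i : X) {v : V} (hv : v ∈ K.closedWords) :
    K.ev (Sum.inr i) v ∈ K.closedWords :=
  Submodule.mem_sInf.mpr fun A hA => hA.2 i v (Submodule.mem_sInf.mp hv A hA)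

theorem Rel.d_closedWords (hK : K.Rel) {v : V} (hv : v ∈ K.closedWords) : K.d v = 0 := by
  have : K.closedWords ≤ LinearMap.ker K.d := sInf_le ⟨hK.d_Ω, fun i v hv => by
    rw [LinearMap.mem_ker] at hv ⊢
    rw [← Module.End.mul_apply, hK.d_inr, Module.End.mul_apply, hv, map_zero]⟩
  exact this hv

theorem Rel.d_mem (hK : K.Rel) (n : ℕ) :
    ∀ v ∈ wordSpan K.op K.Ω n, K.d v ∈ wordSpan K.op K.Ω n := by
  induction n with
  | zero =>
    intro v hv
    obtain ⟨r, rfl⟩ := Submodule.mem_span_singleton.mp hv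
    rw [map_smul, hK.d_Ω, smul_zero]
    exact Submodule.zero_mem _
  | succ n ih =>
    refine wordSpan_succ_le (P := (wordSpan K.op K.Ω (n + 1)).comap K.d) _ _
      (fun v hv => wordSpan_le_succ _ _ _ (ih v hv)) ?_
    rintro ((o | i) | o) v hv
    · have h : K.d (K.ev (Sum.inl o) v) = K.ev (Sum.inl o) (K.d v) + K.od o v :=
        LinearMap.congr_fun (hK.d_inl o) v
      change K.d (K.ev (Sum.inl o) v) ∈ wordSpan K.op K.Ω (n + 1)
      rw [h]
      exact Submodule.add_mem _ (op_mem_wordSpan K.op K.Ω (Sum.inl (Sum.inl o)) (ih v hv))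
        (op_mem_wordSpan K.op K.Ω (Sum.inr o) hv)
    · have h : K.d (K.ev (Sum.inr i) v) = K.ev (Sum.inr i) (K.d v) :=
        LinearMap.congr_fun (hK.d_inr i) v
      change K.d (K.ev (Sum.inr i) v) ∈ wordSpan K.op K.Ω (n + 1)
      rw [h]
      exact op_mem_wordSpan K.op K.Ω (Sum.inl (Sum.inr i)) (ih v hv)
    · have h : K.d (K.od o v) = -K.od o (K.d v) := LinearMap.congr_fun (hK.d_od o) v
      change K.d (K.od o v) ∈ wordSpan K.op K.Ω (n + 1)
      rw [h]
      exact Submodule.neg_mem _ (op_mem_wordSpan K.op K.Ω (Sum.inr o) (ih v hv))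

/-- The relations constrain d only on words, so its square is shown to vanish there and not on all
of V. -/
theorem Rel.d_d (hK : K.Rel) (n : ℕ) : ∀ v ∈ wordSpan K.op K.Ω n, K.d (K.d v) = 0 := by
  induction n with
  | zero =>
    intro v hv
    obtain ⟨r, rfl⟩ := Submodule.mem_span_singleton.mp hv
    rw [map_smul, hK.d_Ω, smul_zero, map_zero]
  | succ n ih =>
    have hl : ∀ o v, K.d (K.ev (Sum.inl o) v) = K.ev (Sum.inl o) (K.d v) + K.od o v :=
      fun o v => LinearMap.congr_fun (hK.d_inl o) v
    have hr : ∀ i v, K.d (K.ev (Sum.inr i) v) = K.ev (Sum.inr i) (K.d v) :=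
      fun i v => LinearMap.congr_fun (hK.d_inr i) v
    have ho : ∀ o v, K.d (K.od o v) = -K.od o (K.d v) :=
      fun o v => LinearMap.congr_fun (hK.d_od o) v
    refine wordSpan_succ_le (P := LinearMap.ker (K.d * K.d)) _ _ (fun v hv => ih v hv) ?_
    rintro ((o | i) | o) v hv
    · change K.d (K.d (K.ev (Sum.inl o) v)) = 0
      rw [hl, map_add, hl, ho, ih v hv, map_zero, zero_add, add_neg_cancel]
    · change K.d (K.d (K.ev (Sum.inr i) v)) = 0
      rw [hr, hr, ih v hv, map_zero]
    · change K.d (K.d (K.od o v)) = 0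
      rw [ho, map_neg, ho, ih v hv, map_zero, neg_zero, neg_zero]

/-- The action of the super polynomial algebra on the associated graded space. -/
theorem Rel.exists_action (hK : K.Rel) :
    ∃ F : SP (O ⊕ X) O →ₐ[ℂ] Module.End ℂ (assocGr K.op K.Ω),
      (∀ e f hf (hf' : shiftOp (K.ev e) f ∈ rees K.op K.Ω), F (SP.ev e) (grMk K.op K.Ω f hf) =
        grMk K.op K.Ω (shiftOp (K.ev e) f) hf') ∧
      ∀ o f hf (hf' : shiftOp (K.od o) f ∈ rees K.op K.Ω), F (SP.od o) (grMk K.op K.Ω f hf) =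
        grMk K.op K.Ω (shiftOp (K.od o) f) hf' := by
  let S : (O ⊕ X) ⊕ O → Module.End ℂ (assocGr K.op K.Ω) := fun g =>
    grOp K.op K.Ω (shiftOp (K.op g)) (fun _ => shiftOp_mem_rees K.op K.Ω g)
      (fun _ => shiftOp_mem_reesPred K.op K.Ω g)
  have hcomm : ∀ e g, Commute (S (Sum.inl e)) (S g) := by
    intro e g
    refine LinearMap.ext fun x => ?_
    obtain ⟨f, hf, rfl⟩ := exists_grMk K.op K.Ω x
    simp only [Module.End.mul_apply, S, grOp_mk]
    rw [grMk_eq_iff]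
    -- Two shifts leave nothing in positions 0 and 1. In position n + 2 the commutator is a
    -- combination of single operators, so it produces words of length n + 1, which is the previous
    -- step of the filtration.
    rintro (_ | _ | n)
    · simp [shiftOp_zero]
    · simp [shiftOp_succ, shiftOp_zero]
    · rw [Finsupp.sub_apply, shiftOp_succ, shiftOp_succ, shiftOp_succ, shiftOp_succ]
      exact span_op_mem_wordSpan K.op K.Ω (hK.comm e g) (hf n)
  obtain ⟨F, hFe, hFo⟩ := SP.exists_lift (fun e => S (Sum.inl e)) (fun o => S (Sum.inr o))
    (fun i j => hcomm i _) (fun o o' => by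
      refine LinearMap.ext fun x => ?_
      obtain ⟨f, hf, rfl⟩ := exists_grMk K.op K.Ω x
      simp only [LinearMap.add_apply, Module.End.mul_apply, S, grOp_mk]
      rw [← grMk_add, LinearMap.zero_apply]
      refine grMk_eq_zero _ _ _ ?_
      rintro (_ | _ | n)
      · simp [shiftOp_zero]
      · simp [shiftOp_succ, shiftOp_zero]
      · rw [Finsupp.add_apply, shiftOp_succ, shiftOp_succ, shiftOp_succ, shiftOp_succ]
        have h := LinearMap.congr_fun (hK.anticomm o o') (f n)
        simp only [LinearMap.add_apply, Module.End.mul_apply, LinearMap.zero_apply] at h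
        change K.od o (K.od o' (f n)) + K.od o' (K.od o (f n)) ∈ _
        rw [h]
        exact Submodule.zero_mem _) (fun i o => hcomm i _)
  exact ⟨F, fun e f hf hf' => by rw [hFe]; rfl, fun o f hf hf' => by rw [hFo]; rfl⟩

/-- In a basis of the exterior algebra the coordinates of p are polynomials that vanish wherever z
i₀ ≠ 0. Multiplied by the variable i₀ they vanish everywhere, hence are zero because ℂ is infinite.
-/
theorem exterior_eval_injective {σ τ : Type} (i₀ : σ) {p : SP σ τ}
    (h : ∀ z : σ → ℂ, z i₀ ≠ 0 → ∀ F : SP σ τ →ₐ[ℂ] ExteriorAlgebra ℂ (τ →₀ ℂ),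
      (∀ i, F (SP.ev i) = algebraMap ℂ _ (z i)) → (∀ o, F (SP.od o) = oddVar o) → F p = 0) :
    p = 0 := by
  classical
  let B := Module.Free.chooseBasis ℂ (ExteriorAlgebra ℂ (τ →₀ ℂ))
  let E : SP σ τ ≃ₗ[ℂ] (_ →₀ MvPolynomial σ ℂ) := TensorProduct.equivFinsuppOfBasisRight B
  have hE : ∀ f e j, E (SP.tmul f e) j = B.repr e j • f := fun f e j =>
    TensorProduct.equivFinsuppOfBasisRight_apply_tmul_apply B f e j
  have key : ∀ z : σ → ℂ, z i₀ ≠ 0 → ∀ j, MvPolynomial.eval z (E p j) = 0 := by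
    intro z hz j
    let F : SP σ τ →ₐ[ℂ] ExteriorAlgebra ℂ (τ →₀ ℂ) :=
      Algebra.TensorProduct.lift ((Algebra.ofId ℂ _).comp (MvPolynomial.aeval z))
        (AlgHom.id ℂ _) (fun f e => Algebra.commutes (MvPolynomial.aeval z f) e)
    have hF : ∀ f e, F (SP.tmul f e) = MvPolynomial.eval z f • e := fun f e => by
      rw [Algebra.smul_def]
      exact Algebra.TensorProduct.lift_tmul _ _ _ _ _
    have h0 : F p = 0 := h z hz F (fun i => by
        rw [SP.ev, hF, MvPolynomial.eval_X, Algebra.algebraMap_eq_smul_one]) (fun o => by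
        rw [SP.od, hF, map_one, one_smul])
    have h1 : ∀ q, B.repr (F q) j = MvPolynomial.eval z (E q j) := by
      intro q
      let P : Submodule ℂ (SP σ τ) := LinearMap.ker
        ((Finsupp.lapply j) ∘ₗ B.repr.toLinearMap ∘ₗ F.toLinearMap -
          (MvPolynomial.aeval z).toLinearMap ∘ₗ (Finsupp.lapply j) ∘ₗ E.toLinearMap)
      have hP : ∀ q, q ∈ P ↔ B.repr (F q) j = MvPolynomial.eval z (E q j) := fun q => by
        rw [LinearMap.mem_ker, LinearMap.sub_apply, sub_eq_zero]; rfl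
      refine (hP q).mp (SP.tmul_le (fun f e => (hP _).mpr ?_) q)
      rw [hF, hE, map_smul, Finsupp.smul_apply, MvPolynomial.smul_eval, smul_eq_mul,
        mul_comm]
    rw [← h1, h0, map_zero, Finsupp.zero_apply]
  refine E.injective (Finsupp.ext fun j => ?_)
  rw [map_zero, Finsupp.zero_apply]
  have : MvPolynomial.X i₀ * E p j = 0 := by
    refine MvPolynomial.funext fun z => ?_
    rw [map_mul, MvPolynomial.eval_X, map_zero]
    rcases eq_or_ne (z i₀) 0 with h | h
    · rw [h, zero_mul]
    · rw [key z h, mul_zero]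
  exact (mul_eq_zero.mp this).resolve_left (MvPolynomial.X_ne_zero i₀)

/-- A closed element of a separated filtered Koszul complex is a boundary up to a word in the
closed even operators. -/
theorem Rel.exists_primitive (hK : K.Rel) {o₀ : O} (hsep : K.Separated o₀) {n : ℕ} {v : V}
    (hv : v ∈ wordSpan K.op K.Ω n) (hd : K.d v = 0) :
    ∃ w ∈ wordSpan K.op K.Ω n, v - K.d w ∈ K.closedWords := by
  obtain ⟨F, hFe, hFo⟩ := hK.exists_action
  have hse : ∀ e, ∀ f ∈ rees K.op K.Ω, shiftOp (K.ev e) f ∈ rees K.op K.Ω :=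
    fun e f hf => shiftOp_mem_rees K.op K.Ω (Sum.inl e) hf
  have hso : ∀ o, ∀ f ∈ rees K.op K.Ω, shiftOp (K.od o) f ∈ rees K.op K.Ω :=
    fun o f hf => shiftOp_mem_rees K.op K.Ω (Sum.inr o) hf
  set v₀ : assocGr K.op K.Ω := grMk K.op K.Ω (Finsupp.single 0 K.Ω)
    (single_mem_rees K.op K.Ω (vacuum_mem_wordSpan K.op K.Ω)) with hv₀
  -- every homogeneous class comes from the super polynomial algebra
  have hsurj : ∀ n v (hv : v ∈ wordSpan K.op K.Ω n), ∃ p,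
      F p v₀ = grMk K.op K.Ω (Finsupp.single n v) (single_mem_rees K.op K.Ω hv) := by
    intro n
    induction n with
    | zero =>
      intro v hv
      obtain ⟨r, rfl⟩ := Submodule.mem_span_singleton.mp hv
      refine ⟨algebraMap ℂ _ r, ?_⟩
      rw [AlgHom.commutes, Module.algebraMap_end_apply, hv₀, ← grMk_smul]
      simp only [Finsupp.smul_single]
    | succ n ih =>
      let P : Submodule ℂ V :=
        { carrier := {v | ∃ (hv : v ∈ wordSpan K.op K.Ω (n + 1)) (p : _), F p v₀ =
            grMk K.op K.Ω (Finsupp.single (n + 1) v) (single_mem_rees K.op K.Ω hv)}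
          add_mem' := by
            rintro a b ⟨ha, p, hp⟩ ⟨hb, q, hq⟩
            refine ⟨Submodule.add_mem _ ha hb, p + q, ?_⟩
            rw [map_add, LinearMap.add_apply, hp, hq, ← grMk_add]
            simp only [Finsupp.single_add]
          zero_mem' := ⟨Submodule.zero_mem _, 0, by
            rw [map_zero, LinearMap.zero_apply]
            refine (grMk_eq_zero _ _ _ ?_).symm
            rw [Finsupp.single_zero]
            exact Submodule.zero_mem _⟩
          smul_mem' := by
            rintro r a ⟨ha, p, hp⟩
            refine ⟨Submodule.smul_mem _ r ha, r • p, ?_⟩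
            rw [map_smul, LinearMap.smul_apply, hp, ← grMk_smul]
            simp only [Finsupp.smul_single] }
      have hP : wordSpan K.op K.Ω (n + 1) ≤ P := by
        refine wordSpan_succ_le _ _ (fun v hv => ⟨wordSpan_le_succ _ _ _ hv, 0, ?_⟩) ?_
        · rw [map_zero, LinearMap.zero_apply]
          refine (grMk_eq_zero _ _ _ ?_).symm
          intro m
          rcases eq_or_ne m (n + 1) with rfl | h
          · rw [Finsupp.single_eq_same]; exact hv
          · rw [Finsupp.single_eq_of_ne h]; exact Submodule.zero_mem _
        · rintro (e | o) v hv
          · obtain ⟨p, hp⟩ := ih v hv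
            refine ⟨op_mem_wordSpan K.op K.Ω (Sum.inl e) hv, SP.ev e * p, ?_⟩
            rw [map_mul, Module.End.mul_apply, hp, hFe _ _ _ (hse _ _ (single_mem_rees _ _ hv))]
            exact grMk_congr _ _ _ _ (shiftOp_single _ _ _)
          · obtain ⟨p, hp⟩ := ih v hv
            refine ⟨op_mem_wordSpan K.op K.Ω (Sum.inr o) hv, SP.od o * p, ?_⟩
            rw [map_mul, Module.End.mul_apply, hp, hFo _ _ _ (hso _ _ (single_mem_rees _ _ hv))]
            exact grMk_congr _ _ _ _ (shiftOp_single _ _ _)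
      intro v hv
      obtain ⟨_, h⟩ := hP hv
      exact h
  -- Injectivity of the symbol map. The functionals supplied by `Separated` assemble into one map
  -- `T` on the graded space that intertwines the action of p with its evaluation, and `T` sends the
  -- class of the vacuum to 1.
  have hinj : ∀ p, F p v₀ = 0 → p = 0 := by
    intro p hp
    refine exterior_eval_injective (Sum.inl o₀) fun z hz G hGe hGo => ?_
    obtain ⟨t, ht0, htp, hte, hto⟩ := hsep z hz
    let T : assocGr K.op K.Ω →ₗ[ℂ] ExteriorAlgebra ℂ (O →₀ ℂ) :=
      Submodule.liftQ _ ((Finsupp.lsum ℂ t) ∘ₗ (rees K.op K.Ω).subtype) (by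
        rintro ⟨f, hf⟩ hf'
        change (Finsupp.lsum ℂ t) f = 0
        rw [Finsupp.lsum_apply]
        refine Finset.sum_eq_zero fun n _ => ?_
        have hn : f n ∈ wordSpanPred K.op K.Ω n := hf' n
        cases n with
        | zero =>
          change t 0 (f 0) = 0
          rw [(Submodule.mem_bot ℂ).mp hn, map_zero]
        | succ n => exact htp n _ hn)
    have hT : ∀ f hf, T (grMk K.op K.Ω f hf) = f.sum fun n v => t n v := fun f hf => by
      change (Finsupp.lsum ℂ t) f = _
      rw [Finsupp.lsum_apply]
    have hTs : ∀ (A : Module.End ℂ V) (f : ℕ →₀ V),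
        (shiftOp A f).sum (fun n v => t n v) = f.sum fun n v => t (n + 1) (A v) := by
      intro A f
      rw [shiftOp, LinearMap.comp_apply, Finsupp.mapRange.linearMap_apply,
        Finsupp.sum_mapRange_index (by simp), Finsupp.lmapDomain_apply,
        Finsupp.sum_mapDomain_index (by simp) (by simp)]
    have hTF : ∀ q x, T (F q x) = G q * T x := by
      intro q
      let P : Submodule ℂ (SP (O ⊕ X) O) :=
        { carrier := {q | ∀ x, T (F q x) = G q * T x}
          add_mem' := fun {a b} ha hb x => by
            rw [map_add, LinearMap.add_apply, map_add, ha, hb, map_add, add_mul]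
          zero_mem' := fun x => by simp
          smul_mem' := fun r a ha x => by
            rw [map_smul, LinearMap.smul_apply, map_smul, ha, map_smul, smul_mul_assoc] }
      refine SP.mem_of_mem (P := P) (fun x => by simp) (fun i q hq x => ?_) (fun o q hq x => ?_) q
      · rw [map_mul, Module.End.mul_apply, map_mul, mul_assoc, ← hq, hGe]
        obtain ⟨f, hf, hx⟩ := exists_grMk K.op K.Ω (F q x)
        rw [← hx, hFe _ _ _ (hse _ _ hf), hT, hT, hTs, ← Algebra.smul_def, Finsupp.smul_sum]
        exact Finsupp.sum_congr fun n _ => hte n i _ (hf n)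
      · rw [map_mul, Module.End.mul_apply, map_mul, mul_assoc, ← hq, hGo]
        obtain ⟨f, hf, hx⟩ := exists_grMk K.op K.Ω (F q x)
        rw [← hx, hFo _ _ _ (hso _ _ hf), hT, hT, hTs, Finsupp.sum, Finsupp.sum, Finset.mul_sum]
        exact Finset.sum_congr rfl fun n _ => hto n o _ (hf n)
    have h := hTF p v₀
    rwa [hp, map_zero, hv₀, hT, Finsupp.sum_single_index (by simp), ht0, mul_one, eq_comm] at h
  obtain ⟨δ, hδ1, hδl, hδr, hδo, hδ⟩ := exists_koszul (O := O) (X := X)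
  have hdr : ∀ f ∈ rees K.op K.Ω, Finsupp.mapRange.linearMap K.d f ∈ rees K.op K.Ω :=
    fun f hf n => hK.d_mem n _ (hf n)
  let D : Module.End ℂ (assocGr K.op K.Ω) :=
    grOp K.op K.Ω (Finsupp.mapRange.linearMap K.d) hdr
      (fun f hf n => by
        have hn : f n ∈ wordSpanPred K.op K.Ω n := hf n
        cases n with
        | zero =>
          change K.d (f 0) ∈ wordSpanPred K.op K.Ω 0
          rw [(Submodule.mem_bot ℂ).mp hn, map_zero]; exact Submodule.zero_mem _
        | succ n => exact hK.d_mem n _ hn)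
  have hD : ∀ f hf, D (grMk K.op K.Ω f hf) =
      grMk K.op K.Ω (Finsupp.mapRange.linearMap K.d f) (hdr f hf) := fun _ _ => rfl
  have hshift : ∀ (A : Module.End ℂ V) (f : ℕ →₀ V),
      Finsupp.mapRange.linearMap K.d (shiftOp A f) = shiftOp (K.d * A) f := by
    intro A f
    ext (_ | n)
    · simp [shiftOp_zero]
    · rw [Finsupp.mapRange.linearMap_apply, Finsupp.mapRange_apply, shiftOp_succ, shiftOp_succ]
      rfl
  have hshift' : ∀ (A : Module.End ℂ V) (f : ℕ →₀ V),
      shiftOp A (Finsupp.mapRange.linearMap K.d f) = shiftOp (A * K.d) f := by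
    intro A f
    ext (_ | n)
    · simp [shiftOp_zero]
    · rw [shiftOp_succ, shiftOp_succ, Finsupp.mapRange.linearMap_apply, Finsupp.mapRange_apply]
      rfl
  have hadd : ∀ (A B : Module.End ℂ V) (f : ℕ →₀ V), shiftOp (A + B) f = shiftOp A f + shiftOp B f := by
    intro A B f
    ext (_ | n)
    · simp [shiftOp_zero]
    · simp [shiftOp_succ]
  have hneg : ∀ (A : Module.End ℂ V) (f : ℕ →₀ V), shiftOp (-A) f = -shiftOp A f := by
    intro A f
    ext (_ | n)
    · simp [shiftOp_zero]
    · simp [shiftOp_succ]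
  -- On the graded space the given differential becomes the polynomial Koszul differential δ. This
  -- is checked one generator at a time.
  have hDF : ∀ p, D (F p v₀) = F (δ p) v₀ := by
    intro p
    let P : Submodule ℂ (SP (O ⊕ X) O) :=
      LinearMap.ker (D ∘ₗ (LinearMap.applyₗ v₀) ∘ₗ F.toLinearMap -
        (LinearMap.applyₗ v₀) ∘ₗ F.toLinearMap ∘ₗ δ)
    have hP : ∀ p, p ∈ P ↔ D (F p v₀) = F (δ p) v₀ := fun p => by
      rw [LinearMap.mem_ker, LinearMap.sub_apply, sub_eq_zero]; rfl
    refine (hP p).mp (SP.mem_of_mem ((hP _).mpr ?_) (fun i q hq => (hP _).mpr ?_)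
      (fun o q hq => (hP _).mpr ?_) p)
    · rw [hδ1, map_zero, map_one, Module.End.one_apply, LinearMap.zero_apply, hv₀, hD]
      refine grMk_eq_zero _ _ _ ?_
      simp only [Finsupp.mapRange.linearMap_apply, Finsupp.mapRange_single, hK.d_Ω,
        Finsupp.single_zero]
      exact Submodule.zero_mem _
    · have hq' := (hP q).mp hq
      obtain ⟨f, hf, hx⟩ := exists_grMk K.op K.Ω (F q v₀)
      rw [← hx] at hq'
      rcases i with o | i
      · rw [hδl, map_add, LinearMap.add_apply, map_mul, map_mul, map_mul, Module.End.mul_apply,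
          Module.End.mul_apply, Module.End.mul_apply, ← hq', ← hx, hFo _ _ _ (hso _ _ hf), hFe _ _ _ (hse _ _ hf), hD, hD,
          hFe _ _ _ (hse _ _ (hdr _ hf)), ← grMk_add]
        refine grMk_congr _ _ _ _ ?_
        rw [hshift, hK.d_inl, hadd, hshift']
      · rw [hδr, map_mul, map_mul, Module.End.mul_apply, Module.End.mul_apply, ← hq', ← hx,
          hFe _ _ _ (hse _ _ hf), hD, hD, hFe _ _ _ (hse _ _ (hdr _ hf))]
        refine grMk_congr _ _ _ _ ?_
        rw [hshift, hK.d_inr, hshift']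
    · have hq' := (hP q).mp hq
      obtain ⟨f, hf, hx⟩ := exists_grMk K.op K.Ω (F q v₀)
      rw [← hx] at hq'
      rw [hδo, map_neg, LinearMap.neg_apply, map_mul, map_mul, Module.End.mul_apply,
        Module.End.mul_apply, ← hq', ← hx, hFo _ _ _ (hso _ _ hf), hD, hD,
        hFo _ _ _ (hso _ _ (hdr _ hf)), ← neg_one_smul ℂ, ← grMk_smul]
      refine grMk_congr _ _ _ _ ?_
      rw [hshift, hK.d_od, hneg, hshift', neg_one_smul]
  -- A polynomial in the closed variables is represented by actual closed words in V, not only by a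
  -- class, so subtracting it from v leaves a closed vector.
  have hclosed : ∀ p ∈ closedPoly O X, ∃ f hf, F p v₀ = grMk K.op K.Ω f hf ∧
      ∀ n, f n ∈ K.closedWords := by
    let A : Submodule ℂ (SP (O ⊕ X) O) :=
      { carrier := {p | ∃ f hf, F p v₀ = grMk K.op K.Ω f hf ∧ ∀ n, f n ∈ K.closedWords}
        add_mem' := by
          rintro a b ⟨f, hf, h1, h2⟩ ⟨f', hf', h1', h2'⟩
          exact ⟨f + f', Submodule.add_mem _ hf hf', by
            rw [map_add, LinearMap.add_apply, h1, h1', grMk_add],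
            fun n => Submodule.add_mem _ (h2 n) (h2' n)⟩
        zero_mem' := ⟨0, Submodule.zero_mem _, by
          rw [map_zero, LinearMap.zero_apply, grMk_eq_zero _ _ _ (Submodule.zero_mem _)],
          fun n => Submodule.zero_mem _⟩
        smul_mem' := by
          rintro r a ⟨f, hf, h1, h2⟩
          exact ⟨r • f, Submodule.smul_mem _ r hf, by
            rw [map_smul, LinearMap.smul_apply, h1, grMk_smul],
            fun n => Submodule.smul_mem _ r (h2 n)⟩ }
    have : closedPoly O X ≤ A := by
      refine sInf_le ⟨⟨_, _, by rw [map_one, Module.End.one_apply], fun n => ?_⟩, ?_⟩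
      · rcases eq_or_ne n 0 with rfl | h
        · rw [Finsupp.single_eq_same]; exact Ω_mem_closedWords
        · rw [Finsupp.single_eq_of_ne h]; exact Submodule.zero_mem _
      · rintro i p ⟨f, hf, h1, h2⟩
        refine ⟨shiftOp (K.ev (Sum.inr i)) f, hse _ _ hf, by
          rw [map_mul, Module.End.mul_apply, h1, hFe], fun n => ?_⟩
        cases n with
        | zero => rw [shiftOp_zero]; exact Submodule.zero_mem _
        | succ n => rw [shiftOp_succ]; exact ev_mem_closedWords i (h2 n)
    exact fun p hp => this hp
  -- The symbol of v is δ-closed, hence δq plus a polynomial in the closed variables. Subtracting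
  -- representatives of both leaves a closed vector of smaller word length.
  induction n using Nat.strong_induction_on generalizing v with
  | _ n ih =>
  obtain ⟨p, hp⟩ := hsurj n v hv
  have hδp : δ p = 0 := by
    refine hinj _ ?_
    rw [← hDF, hp, hD]
    refine grMk_eq_zero _ _ _ ?_
    simp only [Finsupp.mapRange.linearMap_apply, Finsupp.mapRange_single, hd, Finsupp.single_zero]
    exact Submodule.zero_mem _
  obtain ⟨q, hq⟩ := hδ p hδp
  obtain ⟨f, hf, hfe, hfc⟩ := hclosed _ hq
  obtain ⟨g, hg, hge⟩ := exists_grMk K.op K.Ω (F q v₀)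
  rw [map_sub, LinearMap.sub_apply, ← hDF, ← hge, hp, sub_eq_iff_eq_add, hD, ← grMk_add, grMk_eq_iff] at hfe
  have hn := hfe n
  simp only [Finsupp.sub_apply, Finsupp.add_apply, Finsupp.single_eq_same,
    Finsupp.mapRange.linearMap_apply, Finsupp.mapRange_apply] at hn
  have hd' : K.d (v - (f n + K.d (g n))) = 0 := by
    rw [map_sub, map_add, hd, hK.d_closedWords (hfc n), hK.d_d n _ (hg n)]; simp
  -- In length 0 the previous step of the filtration is ⊥, so nothing remains to be corrected.
  cases n with
  | zero =>
    refine ⟨g 0, hg 0, ?_⟩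
    have h0 := (Submodule.mem_bot ℂ).mp hn
    rw [sub_eq_zero] at h0
    rw [h0, add_sub_cancel_right]
    exact hfc 0
  | succ n =>
    obtain ⟨w, hw, hw'⟩ := ih n (Nat.lt_succ_self n) hn hd'
    refine ⟨w + g (n + 1), Submodule.add_mem _ (wordSpan_le_succ _ _ _ hw) (hg _), ?_⟩
    have := Submodule.add_mem _ hw' (hfc (n + 1))
    rw [map_add]
    convert this using 1
    abel

end KoszulOps

end Filtered

section FreeFields

/-! ### The free fields on the Fock space -/

variable {I : Type}

theorem bosOp_mul (A B : Module.End ℂ (Bos I)) : bosOp A * bosOp B = bosOp (A * B) :=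
  (LinearMap.rTensor_mul (Fer I) A B).symm

theorem ferOp_mul (A B : Module.End ℂ (Fer I)) : ferOp A * ferOp B = ferOp (A * B) :=
  (LinearMap.lTensor_mul (Bos I) A B).symm

theorem bosOp_comm_ferOp (A : Module.End ℂ (Bos I)) (B : Module.End ℂ (Fer I)) :
    bosOp A * ferOp B = ferOp B * bosOp A :=
  (LinearMap.rTensor_comp_lTensor _ A B).trans (LinearMap.lTensor_comp_rTensor _ A B).symm

theorem bosOp_add (A B : Module.End ℂ (Bos I)) : bosOp A + bosOp B = bosOp (A + B) :=
  (LinearMap.rTensor_add (Fer I) A B).symm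

theorem bosOp_smul (r : ℂ) (A : Module.End ℂ (Bos I)) : r • bosOp A = bosOp (r • A) :=
  (LinearMap.rTensor_smul (Fer I) r A).symm

theorem ferOp_add (A B : Module.End ℂ (Fer I)) : ferOp A + ferOp B = ferOp (A + B) :=
  (LinearMap.lTensor_add (Bos I) A B).symm

theorem ferOp_smul (r : ℂ) (A : Module.End ℂ (Fer I)) : r • ferOp A = ferOp (r • A) :=
  (LinearMap.lTensor_smul (Bos I) r A).symm

theorem ferOp_neg (A : Module.End ℂ (Fer I)) : -ferOp A = ferOp (-A) := by
  rw [← neg_one_smul ℂ (ferOp A), ferOp_smul]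
  exact congrArg ferOp (neg_one_smul ℂ A)

theorem bosOp_one : bosOp (1 : Module.End ℂ (Bos I)) = 1 := LinearMap.rTensor_id _ _

theorem ferOp_one : ferOp (1 : Module.End ℂ (Fer I)) = 1 := LinearMap.lTensor_id _ _

/-- Multiplication by a variable of parity `p`. -/
def varMul (p : Bool) (v : Var I) : Module.End ℂ (Fock I) := bif p then ferMul v else bosMul v

/-- Differentiation with respect to a variable of parity `p`. -/
def varDer (p : Bool) (v : Var I) : Module.End ℂ (Fock I) := bif p then ferDer v else bosDer v

theorem ferMul_ferMul (v w : Var I) : ferMul v * ferMul w = -(ferMul w * ferMul v) := by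
  rw [ferMul, ferMul, ferOp_mul, ferOp_mul, ferOp_neg]
  congr 1
  refine LinearMap.ext fun e => ?_
  have h := oddVar_anticomm v w
  rw [oddVar, oddVar, ← eq_neg_iff_add_eq_zero] at h
  simp only [LinearMap.neg_apply, Module.End.mul_apply, LinearMap.mulLeft_apply, ← mul_assoc]
  rw [h, neg_mul]

theorem ferDer_ferDer (v w : Var I) : ferDer v * ferDer w = -(ferDer w * ferDer v) := by
  rw [ferDer, ferDer, ferOp_mul, ferOp_mul, ferOp_neg]
  congr 1
  refine LinearMap.ext fun e => ?_
  rw [LinearMap.neg_apply, Module.End.mul_apply, Module.End.mul_apply]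
  exact CliffordAlgebra.contractLeft_comm _ _ _

theorem bosMul_bosMul (v w : Var I) : bosMul v * bosMul w = bosMul w * bosMul v := by
  rw [bosMul, bosMul, bosOp_mul, bosOp_mul]
  congr 1
  refine LinearMap.ext fun f => ?_
  simp only [Module.End.mul_apply, LinearMap.mulLeft_apply]
  exact mul_left_comm _ _ _

theorem pderiv_pderiv_comm {σ : Type} (v w : σ) (f : MvPolynomial σ ℂ) :
    MvPolynomial.pderiv v (MvPolynomial.pderiv w f) =
      MvPolynomial.pderiv w (MvPolynomial.pderiv v f) := by
  classical
  have h : ⁅MvPolynomial.pderiv (R := ℂ) v, MvPolynomial.pderiv (R := ℂ) w⁆ = 0 := by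
    refine MvPolynomial.derivation_ext fun i => ?_
    rw [Derivation.commutator_apply, MvPolynomial.pderiv_X, MvPolynomial.pderiv_X,
      Pi.single_apply, Pi.single_apply]
    split_ifs <;> simp
  have := DFunLike.congr_fun h f
  rw [Derivation.commutator_apply] at this
  exact sub_eq_zero.mp this

theorem bosDer_bosDer (v w : Var I) : bosDer v * bosDer w = bosDer w * bosDer v := by
  rw [bosDer, bosDer, bosOp_mul, bosOp_mul]
  exact congrArg bosOp (LinearMap.ext fun f => pderiv_pderiv_comm v w f)

theorem bosDer_bosMul [DecidableEq I] (v w : Var I) : bosDer v * bosMul w =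
    bosMul w * bosDer v + (if v = w then 1 else 0 : ℂ) • (1 : Module.End ℂ (Fock I)) := by
  rw [bosDer, bosMul, bosOp_mul, bosOp_mul, ← bosOp_one, bosOp_smul, bosOp_add]
  congr 1
  refine LinearMap.ext fun f => ?_
  simp only [Module.End.mul_apply, LinearMap.mulLeft_apply, LinearMap.add_apply,
    LinearMap.smul_apply, Module.End.one_apply, Derivation.coeFn_coe, Derivation.leibniz,
    MvPolynomial.pderiv_X, smul_eq_mul, Pi.single_apply]
  split_ifs <;> simp_all

theorem ferDer_ferMul [DecidableEq I] (v w : Var I) : ferDer v * ferMul w =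
    -(ferMul w * ferDer v) + (if v = w then 1 else 0 : ℂ) • (1 : Module.End ℂ (Fock I)) := by
  rw [ferDer, ferMul, ferOp_mul, ferOp_mul, ← ferOp_one, ferOp_smul, ferOp_neg, ferOp_add]
  congr 1
  refine LinearMap.ext fun e => ?_
  have h := CliffordAlgebra.contractLeft_ι_mul (Q := (0 : QuadraticForm ℂ (Var I →₀ ℂ)))
    (d := (Finsupp.lapply v : (Var I →₀ ℂ) →ₗ[ℂ] ℂ)) (Finsupp.single w 1) e
  refine h.trans ?_
  rw [sub_eq_neg_add, Finsupp.lapply_apply, Finsupp.single_apply]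
  simp only [@eq_comm _ w v]
  rfl

theorem varMul_varMul (p q : Bool) (v w : Var I) :
    varMul p v * varMul q w = koszul p q • (varMul q w * varMul p v) := by
  cases p <;> cases q <;> simp only [varMul, koszul, cond_true, cond_false, Bool.and_true,
    Bool.and_false, if_true, if_false, one_smul, Bool.false_eq_true, neg_smul]
  · exact bosMul_bosMul v w
  · exact bosOp_comm_ferOp _ _
  · exact (bosOp_comm_ferOp _ _).symm
  · exact ferMul_ferMul v w

theorem varDer_varDer (p q : Bool) (v w : Var I) :
    varDer p v * varDer q w = koszul p q • (varDer q w * varDer p v) := by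
  cases p <;> cases q <;> simp only [varDer, koszul, cond_true, cond_false, Bool.and_true,
    Bool.and_false, if_true, if_false, one_smul, Bool.false_eq_true, neg_smul]
  · exact bosDer_bosDer v w
  · exact bosOp_comm_ferOp _ _
  · exact (bosOp_comm_ferOp _ _).symm
  · exact ferDer_ferDer v w

theorem varDer_varMul [DecidableEq I] (p q : Bool) (v w : Var I) :
    varDer p v * varMul q w = koszul p q • (varMul q w * varDer p v) +
      (if p = q ∧ v = w then 1 else 0 : ℂ) • (1 : Module.End ℂ (Fock I)) := by
  cases p <;> cases q <;> simp only [varMul, varDer, koszul, cond_true, cond_false, Bool.and_true,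
    Bool.and_false, if_true, if_false, one_smul, Bool.false_eq_true, neg_smul, true_and,
    false_and, reduceCtorEq, zero_smul, add_zero]
  · exact bosDer_bosMul v w
  · exact bosOp_comm_ferOp _ _
  · exact (bosOp_comm_ferOp _ _).symm
  · exact ferDer_ferMul v w

theorem parity_mul_parity : parity I * parity I = 1 := by
  rw [parity, ferOp_mul, ← ferOp_one]
  congr 1
  refine LinearMap.ext fun e => ?_
  exact CliffordAlgebra.involute_involute e

theorem parity_varMul (p : Bool) (v : Var I) :
    parity I * varMul p v = psign p • (varMul p v * parity I) := by
  cases p <;> simp only [varMul, psign, cond_true, cond_false, if_true, if_false, one_smul,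
    Bool.false_eq_true, neg_smul, ferMul, bosMul, parity]
  · exact (bosOp_comm_ferOp _ _).symm
  · rw [ferOp_mul, ferOp_mul, ferOp_neg]
    congr 1
    refine LinearMap.ext fun e => ?_
    change CliffordAlgebra.involute (CliffordAlgebra.ι _ _ * e) = _
    rw [map_mul, CliffordAlgebra.involute_ι, neg_mul]
    rfl

theorem involute_contractLeft (d : Module.Dual ℂ (Var I →₀ ℂ)) (e : Fer I) :
    CliffordAlgebra.involute (CliffordAlgebra.contractLeft d e) =
      -CliffordAlgebra.contractLeft d (CliffordAlgebra.involute (e : CliffordAlgebra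
        (0 : QuadraticForm ℂ (Var I →₀ ℂ)))) := by
  induction e using CliffordAlgebra.left_induction with
  | algebraMap r =>
    rw [CliffordAlgebra.contractLeft_algebraMap, AlgHom.commutes,
      CliffordAlgebra.contractLeft_algebraMap, map_zero, neg_zero]
  | add a b ha hb => rw [map_add, map_add, ha, hb, map_add, map_add, neg_add]
  | ι_mul e m he =>
    rw [CliffordAlgebra.contractLeft_ι_mul, map_sub, map_smul, map_mul, he, map_mul,
      CliffordAlgebra.involute_ι, neg_mul, neg_mul, LinearMap.map_neg,
      CliffordAlgebra.contractLeft_ι_mul]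
    simp

theorem parity_varDer (p : Bool) (v : Var I) :
    parity I * varDer p v = psign p • (varDer p v * parity I) := by
  cases p <;> simp only [varDer, psign, cond_true, cond_false, if_true, if_false, one_smul,
    Bool.false_eq_true, neg_smul, ferDer, bosDer, parity]
  · exact (bosOp_comm_ferOp _ _).symm
  · rw [ferOp_mul, ferOp_mul, ferOp_neg]
    congr 1
    exact LinearMap.ext fun e => involute_contractLeft _ e

/-- The vacuum of the Fock space. -/
def fockΩ : Fock I := (Fock.equiv I).symm (1 ⊗ₜ 1)

theorem varDer_fockΩ (p : Bool) (v : Var I) : varDer p v fockΩ = 0 := by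
  cases p
  · change (MvPolynomial.pderiv v (1 : Bos I)) ⊗ₜ[ℂ] (1 : Fer I) = 0
    rw [Derivation.map_one_eq_zero, TensorProduct.zero_tmul]
  · change (1 : Bos I) ⊗ₜ[ℂ] (CliffordAlgebra.contractLeft _ (1 : Fer I)) = 0
    rw [CliffordAlgebra.contractLeft_one, TensorProduct.tmul_zero]

theorem parity_fockΩ : parity I fockΩ = fockΩ := by
  change (1 : Bos I) ⊗ₜ[ℂ] (CliffordAlgebra.involute (1 : Fer I)) = _
  rw [map_one]
  rfl

/-- The Fock space as a super polynomial algebra. -/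
def fockSP (I : Type) : Fock I ≃ₗ[ℂ] SP (Var I) (Var I) := LinearEquiv.refl ℂ _

theorem fockSP_fockΩ : fockSP I fockΩ = 1 := rfl

theorem fockSP_varMul_false (v : Var I) (u : Fock I) :
    fockSP I (varMul false v u) = SP.ev v * fockSP I u := by
  have : fockSP I u ∈ LinearMap.ker ((fockSP I).conj (bosMul v) - LinearMap.mulLeft ℂ (SP.ev v)) :=
    SP.tmul_le (fun f e => by
      rw [LinearMap.mem_ker, LinearMap.sub_apply, sub_eq_zero]
      have h := SP.tmul_mul_tmul (MvPolynomial.X v) f 1 e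
      rw [one_mul] at h
      exact h.symm) _
  exact sub_eq_zero.mp this

theorem fockSP_varMul_true (v : Var I) (u : Fock I) :
    fockSP I (varMul true v u) = SP.od v * fockSP I u := by
  have : fockSP I u ∈ LinearMap.ker ((fockSP I).conj (ferMul v) - LinearMap.mulLeft ℂ (SP.od v)) :=
    SP.tmul_le (fun f e => by
      rw [LinearMap.mem_ker, LinearMap.sub_apply, sub_eq_zero]
      have h := SP.tmul_mul_tmul 1 f (oddVar v) e
      rw [one_mul] at h
      exact h.symm) _
  exact sub_eq_zero.mp this

theorem fock_mem_of_mem {P : Submodule ℂ (Fock I)} (h1 : fockΩ ∈ P)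
    (h : ∀ p v, ∀ u ∈ P, varMul p v u ∈ P) (u : Fock I) : u ∈ P :=
  SP.mem_of_mem (P := P.map (fockSP I).toLinearMap) ⟨_, h1, rfl⟩
    (by
      rintro v _ ⟨u, hu, rfl⟩
      exact ⟨_, h false v u hu, fockSP_varMul_false v u⟩)
    (by
      rintro v _ ⟨u, hu, rfl⟩
      exact ⟨_, h true v u hu, fockSP_varMul_true v u⟩) (fockSP I u) |> fun h => by
  obtain ⟨w, hw, e⟩ := h
  rwa [← (fockSP I).injective e]

/-- The index of a variable: `β` or `b` for `t = false`, `γ` or `c` for `t = true`. -/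
def mkVar (t : Bool) (i : I) (k : ℕ) : Var I := bif t then Sum.inr (i, k) else Sum.inl (i, k)

theorem mkVar_inj {t t' : Bool} {i i' : I} {k k' : ℕ} :
    mkVar t i k = mkVar t' i' k' ↔ t = t' ∧ i = i' ∧ k = k' := by
  cases t <;> cases t' <;> simp [mkVar]

theorem exists_mkVar (v : Var I) : ∃ t i k, v = mkVar t i k := by
  rcases v with ⟨i, k⟩ | ⟨i, k⟩
  · exact ⟨false, i, k, rfl⟩
  · exact ⟨true, i, k, rfl⟩

/-- The free fields: `β, γ` for `p = false`, and `b, c` for `p = true`. -/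
def free : Bool → Bool → I → QO (Fock I)
  | false, false => beta
  | false, true => gamma
  | true, false => b
  | true, true => c

/-- The sign in the singular part of the product of a free field with its partner. -/
def freeSign (p t : Bool) : ℂ := if t && !p then -1 else 1

theorem mode_free_negSucc (p t : Bool) (i : I) (k : ℕ) :
    mode (free p t i) (Int.negSucc k) = varMul p (mkVar t i k) := by
  cases p <;> cases t
  · rw [free, beta, mode_ofModes]; rfl
  · rw [free, gamma, mode_ofModes]; rfl
  · rw [free, b, mode_ofModes]; rfl
  · rw [free, c, mode_ofModes]; rfl

theorem mode_free_natCast (p t : Bool) (i : I) (k : ℕ) :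
    mode (free p t i) (Int.ofNat k) = freeSign p t • varDer p (mkVar (!t) i k) := by
  cases p <;> cases t
  · rw [free, beta, mode_ofModes]; exact (one_smul ℂ (bosDer _)).symm
  · rw [free, gamma, mode_ofModes]; exact (neg_one_smul ℂ (bosDer _)).symm
  · rw [free, b, mode_ofModes]; exact (one_smul ℂ (ferDer _)).symm
  · rw [free, c, mode_ofModes]; exact (one_smul ℂ (ferDer _)).symm

theorem mode_free_creative (p t : Bool) (i : I) {n : ℤ} (hn : 0 ≤ n) :
    mode (free p t i) n fockΩ = 0 := by
  obtain ⟨k, rfl⟩ := Int.eq_ofNat_of_zero_le hn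
  rw [show ((k : ℤ)) = Int.ofNat k from rfl, mode_free_natCast, LinearMap.smul_apply,
    varDer_fockΩ, smul_zero]

theorem isHom_free (p t : Bool) (i : I) : IsHom (parity I) p (free p t i) := by
  rintro (k | k)
  · rw [mode_free_natCast, mul_smul_comm, parity_varDer, smul_mul_assoc, smul_comm]
  · rw [mode_free_negSucc, parity_varMul]

theorem free_mem_of_mem {P : Submodule ℂ (Fock I)} (h1 : fockΩ ∈ P)
    (h : ∀ p t i n, n < 0 → ∀ u ∈ P, mode (free p t i) n u ∈ P) (u : Fock I) : u ∈ P := by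
  refine fock_mem_of_mem h1 (fun p v u hu => ?_) u
  obtain ⟨t, i, k, rfl⟩ := exists_mkVar v
  rw [← mode_free_negSucc]
  exact h p t i _ (Int.negSucc_lt_zero k) u hu

variable [DecidableEq I]

/-- The canonical (anti)commutation relations of the free fields. -/
theorem free_free (p t : Bool) (i : I) (q t' : Bool) (j : I) (m n : ℤ) :
    mode (free p t i) m * mode (free q t' j) n =
      koszul p q • (mode (free q t' j) n * mode (free p t i) m) +
      (if p = q ∧ t' = !t ∧ i = j ∧ m + n = -1 then freeSign p t else 0) •
        (1 : Module.End ℂ (Fock I)) := by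
  have hk := koszul_mul_self p q
  rcases m with k | k <;> rcases n with l | l
  · rw [mode_free_natCast, mode_free_natCast, smul_mul_smul_comm, varDer_varDer,
      if_neg (by rintro ⟨-, -, -, h⟩; simp at h; omega), smul_mul_smul_comm, zero_smul, add_zero,
      smul_comm, mul_comm]
  · have : (p = q ∧ mkVar (!t) i k = mkVar t' j l) ↔
        (p = q ∧ t' = !t ∧ i = j ∧ Int.ofNat k + Int.negSucc l = -1) := by
      rw [mkVar_inj]
      have : k = l ↔ Int.ofNat k + Int.negSucc l = -1 := by
        simp only [Int.ofNat_eq_natCast, Int.negSucc_eq]; omega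
      rw [this, @eq_comm _ (!t)]
    have h := varDer_varMul p q (mkVar (!t) i k) (mkVar t' j l)
    simp only [this] at h
    rw [mode_free_natCast, mode_free_negSucc, smul_mul_assoc, h, mul_smul_comm]
    split_ifs <;> module
  · have : (q = p ∧ mkVar (!t') j l = mkVar t i k) ↔
        (p = q ∧ t' = !t ∧ i = j ∧ Int.negSucc k + Int.ofNat l = -1) := by
      rw [mkVar_inj]
      have : l = k ↔ Int.negSucc k + Int.ofNat l = -1 := by
        simp only [Int.ofNat_eq_natCast, Int.negSucc_eq]; omega
      rw [this, @eq_comm _ q, @eq_comm _ j]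
      have : (!t') = t ↔ t' = !t := by cases t <;> cases t' <;> simp
      rw [this]
    have h := varDer_varMul q p (mkVar (!t') j l) (mkVar t i k)
    simp only [this, koszul_comm q p] at h
    rw [mode_free_natCast, mode_free_negSucc, smul_mul_assoc, h, mul_smul_comm]
    set u := varMul p (mkVar t i k) * varDer q (mkVar (!t') j l)
    have e1 : (koszul p q * koszul p q) • u = u := by rw [hk, one_smul]
    split_ifs with hc
    · obtain ⟨rfl, rfl, -, -⟩ := hc
      -- Consistency of the two poles: reversing a pair changes the sign of the contraction for
      -- bosons and preserves it for fermions.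
      have e2 : koszul p p * freeSign p (!t) + freeSign p t = 0 := by
        cases p <;> cases t <;> simp [koszul, freeSign]
      linear_combination (norm := module)
        (-freeSign p (!t)) • e1 - e2 • (1 : Module.End ℂ (Fock I))
    · linear_combination (norm := module) (-freeSign q t') • e1
  · rw [mode_free_negSucc, mode_free_negSucc, varMul_varMul,
      if_neg (by rintro ⟨-, -, -, h⟩; simp [Int.negSucc_eq] at h; omega), zero_smul, add_zero]

/-- The bracket of two modes depends only on m + n, which is what a simple pole means, so a single
factor z - w annihilates it. -/
theorem loc_free (p t : Bool) (i : I) (q t' : Bool) (j : I) :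
    Loc (koszul p q) (free p t i) (free q t' j) := by
  refine ⟨1, funext fun m => ext_mode fun n => ?_⟩
  rw [pow_one, mode_seqDiff, mode_bracketSeq, mode_bracketSeq, free_free p t i q t' j (m + 1),
    free_free p t i q t' j m, Pi.zero_apply, mode_zero, add_sub_cancel_left, add_sub_cancel_left,
    show m + 1 + n = m + (n + 1) by ring, sub_self]

/-- The translation operator of the Fock space. -/
theorem exists_translation : ∃ T : Module.End ℂ (Fock I), T fockΩ = 0 ∧
    ∀ p t (i : I) n, T * mode (free p t i) n - mode (free p t i) n * T =
      (-(n : ℂ)) • mode (free p t i) (n - 1) := by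
  -- T is the even derivation sending the variable of index k to k + 1 times the variable of index k
  -- + 1.
  let next : Var I → ℂ × Var I := Sum.elim (fun x => ((x.2 : ℂ) + 1, Sum.inl (x.1, x.2 + 1)))
    (fun x => ((x.2 : ℂ) + 1, Sum.inr (x.1, x.2 + 1)))
  obtain ⟨T, hT1, hTe, hTo⟩ := SP.exists_derivation (σ := Var I) (τ := Var I) 1
    (fun v => (next v).1 • SP.ev (next v).2) (fun v => (next v).1 • SP.od (next v).2)
    (fun i o => by
      rw [one_smul, smul_mul_assoc, mul_smul_comm, SP.ev_comm])
    (fun o o' => by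
      have h1 := SP.od_anticomm (σ := Var I) o (next o').2
      have h2 := SP.od_anticomm (σ := Var I) o' (next o).2
      simp only [one_smul, mul_smul_comm, smul_mul_assoc]
      linear_combination (norm := module) (next o').1 • h1 + (next o).1 • h2) (one_mul 1)
  let T' : Module.End ℂ (Fock I) := (fockSP I).symm.conj T
  have hT' : ∀ u, fockSP I (T' u) = T (fockSP I u) := fun u => rfl
  have hneg : ∀ p t (i : I) (k : ℕ) u, T' (mode (free p t i) (Int.negSucc k) u) =
      mode (free p t i) (Int.negSucc k) (T' u) +
        ((k : ℂ) + 1) • mode (free p t i) (Int.negSucc (k + 1)) u := by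
    intro p t i k u
    rw [mode_free_negSucc, mode_free_negSucc]
    refine (fockSP I).injective ?_
    cases p
    · rw [hT', map_add, map_smul, fockSP_varMul_false, fockSP_varMul_false, fockSP_varMul_false,
        hTe, hT', smul_mul_assoc]
      cases t <;> rfl
    · rw [hT', map_add, map_smul, fockSP_varMul_true, fockSP_varMul_true, fockSP_varMul_true,
        hTo, hT', smul_mul_assoc, one_smul]
      cases t <;> rfl
  have hneg' : ∀ p t (i : I) n, n < 0 → T' * mode (free p t i) n =
      mode (free p t i) n * T' + (-(n : ℂ)) • mode (free p t i) (n - 1) := by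
    intro p t i n hn
    obtain ⟨k, rfl⟩ := Int.eq_negSucc_of_lt_zero hn
    refine LinearMap.ext fun u => (hneg p t i k u).trans ?_
    rw [LinearMap.add_apply, LinearMap.smul_apply, Module.End.mul_apply,
      show Int.negSucc (k + 1) = Int.negSucc k - 1 by simp [Int.negSucc_eq]; ring]
    congr 2
    simp [Int.negSucc_eq]
  refine ⟨T', hT1, fun p t i n => ?_⟩
  rcases lt_or_ge n 0 with hn | hn
  · rw [hneg' p t i n hn, add_sub_cancel_left]
  -- The defect of covariance for an annihilation mode. It kills the vacuum and supercommutes with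
  -- all creation modes, hence is zero, because these generate the Fock space from the vacuum.
  let E : Module.End ℂ (Fock I) := T' * mode (free p t i) n - mode (free p t i) n * T' +
    (n : ℂ) • mode (free p t i) (n - 1)
  have hE : E fockΩ = 0 := by
    have h1 : T' fockΩ = 0 := hT1
    simp only [E, LinearMap.add_apply, LinearMap.sub_apply, Module.End.mul_apply,
      LinearMap.smul_apply, mode_free_creative p t i hn, h1, map_zero, sub_zero, zero_add]
    rcases eq_or_ne n 0 with rfl | h0
    · simp
    · rw [mode_free_creative p t i (by omega), smul_zero]
  have hEc : ∀ q t' (j : I) m, m < 0 → E * mode (free q t' j) m =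
      koszul p q • (mode (free q t' j) m * E) := by
    intro q t' j m hm
    have h1 := free_free p t i q t' j n m
    have h2 := free_free p t i q t' j n (m - 1)
    have h3 := free_free p t i q t' j (n - 1) m
    have h4 := hneg' q t' j m hm
    simp only [E, show n + (m - 1) = n + m - 1 by ring, show n - 1 + m = n + m - 1 by ring] at *
    set A := mode (free p t i) n
    set A' := mode (free p t i) (n - 1)
    set B := mode (free q t' j) m
    set B' := mode (free q t' j) (m - 1)
    set δ : ℂ := if p = q ∧ t' = !t ∧ i = j ∧ n + m - 1 = -1 then freeSign p t else 0 with hδ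
    -- The central terms created by T have total coefficient m + n, and they occur only when m + n =
    -- 0.
    have hδ' : ((m : ℂ) + n) * δ = 0 := by
      rw [hδ]
      split_ifs with h
      · have : (m : ℂ) + n = 0 := by
          have : m + n = 0 := by omega
          exact_mod_cast this
        rw [this, zero_mul]
      · rw [mul_zero]
    generalize (if p = q ∧ t' = !t ∧ i = j ∧ n + m = -1 then freeSign p t else 0) = δ₁ at h1
    have e1 : T' * A * B = koszul p q • (T' * B * A) + δ₁ • T' := by
      rw [mul_assoc, h1, mul_add, mul_smul_comm, mul_smul_comm, mul_one, ← mul_assoc]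
    have e2 : A * T' * B = A * B * T' + (-(m : ℂ)) • (A * B') := by
      rw [mul_assoc, h4, mul_add, mul_smul_comm, ← mul_assoc]
    have e3 : A * B * T' = koszul p q • (B * A * T') + δ₁ • T' := by
      rw [h1, add_mul, smul_mul_assoc, smul_mul_assoc, one_mul]
    have e4 : T' * B * A = B * T' * A + (-(m : ℂ)) • (B' * A) := by
      rw [h4, add_mul, smul_mul_assoc]
    simp only [add_mul, sub_mul, mul_add, mul_sub, smul_mul_assoc, mul_smul_comm, ← mul_assoc]
    rw [e1, e2, e3, e4, h2, h3]
    have : ((m : ℂ) + n) • δ • (1 : Module.End ℂ (Fock I)) = 0 := by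
      rw [smul_smul, hδ', zero_smul]
    linear_combination (norm := module) this
  have hE0 : ∀ u, E u = 0 := by
    intro u
    refine free_mem_of_mem (P := LinearMap.ker E) hE (fun q t' j m hm u hu => ?_) u
    rw [LinearMap.mem_ker] at hu ⊢
    rw [← Module.End.mul_apply, hEc q t' j m hm, LinearMap.smul_apply, Module.End.mul_apply, hu,
      map_zero, smul_zero]
  have : E = 0 := LinearMap.ext hE0
  rw [neg_smul, eq_neg_iff_add_eq_zero]
  exact this

/-- The vacuum, parity and translation of the Fock space. -/
def fockVacuum (I : Type) [DecidableEq I] : Vacuum (Fock I) where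
  σ := parity I
  Ω := fockΩ
  T := exists_translation.choose
  σ_mul_σ := parity_mul_parity
  σ_Ω := parity_fockΩ
  T_Ω := exists_translation.choose_spec.1

theorem good_free (p t : Bool) (i : I) : (fockVacuum I).Good p (free p t i) where
  hom := isHom_free p t i
  creative _ hn := mode_free_creative p t i hn
  translation := ext_mode fun n => by
    rw [mode_sbr, one_smul, mode_deriv]
    exact exists_translation.choose_spec.2 p t i n

/-- The set of all free fields. -/
def freeFields (I : Type) : Set (QO (Fock I)) :=
  Set.range fun x : Bool × Bool × I => free x.1 x.2.1 x.2.2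

theorem exists_localSpace_free :
    ∃ W : LocalSpace (fockVacuum I), ∀ p t i, free p t i ∈ W.carrier p := by
  obtain ⟨W, hW⟩ := exists_localSpace (fockVacuum I)
    (Set.range fun x : Bool × Bool × I => (x.1, free x.1 x.2.1 x.2.2))
    (by rintro _ ⟨⟨p, t, i⟩, rfl⟩; exact good_free p t i)
    (by rintro _ ⟨⟨p, t, i⟩, rfl⟩ _ ⟨⟨q, t', j⟩, rfl⟩; exact loc_free p t i q t' j)
  exact ⟨W, fun p t i => hW (p, free p t i) (Set.mem_range_self (p, t, i))⟩

/-- The mutually local fields on the Fock space. -/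
def fockLocal (I : Type) [DecidableEq I] : LocalSpace (fockVacuum I) :=
  exists_localSpace_free.choose

theorem free_mem (p t : Bool) (i : I) : free p t i ∈ (fockLocal I).carrier p :=
  exists_localSpace_free.choose_spec p t i

/-- This turns every identity between fields of the local space into an identity between vectors of
the Fock space. -/
theorem fock_state_injOn :
    Set.InjOn (fockVacuum I).state ((fockLocal I).total : Set (QO (Fock I))) := by
  refine LocalSpace.state_injOn
    (S := freeFields I) ?_ ?_
  · rintro _ ⟨⟨p, t, i⟩, rfl⟩
    exact ⟨p, free_mem p t i⟩
  · refine eq_top_iff.mpr fun u _ => ?_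
    exact free_mem_of_mem ((fockVacuum I).vacuum_mem_orbit (freeFields I))
      (fun p t i n _ u hu => (fockVacuum I).mode_mem_orbit
        (show free p t i ∈ freeFields I from ⟨(p, t, i), rfl⟩) n hu) u

end FreeFields

section Quadratic

/-! ### Quadratic fields -/

/-- When poles have order at most two, only j = 0 and j = 1 remain in the commutator formula. This
covers all the products of currents used here. -/
theorem LocalSpace.commutator_of_circ_eq_zero {V : Type} [AddCommGroup V] [Module ℂ V]
    {X : Vacuum V} {W : LocalSpace X} {p q : Bool} {a b : QO V} (ha : a ∈ W.carrier p)
    (hb : b ∈ W.carrier q) (h : ∀ j : ℕ, circ X.σ (j + 2 : ℕ) a b = 0) (m n : ℤ) :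
    mode a m * mode b n = koszul p q • (mode b n * mode a m) + mode (circ X.σ 0 a b) (m + n) +
      (m : ℂ) • mode (circ X.σ 1 a b) (m + n - 1) := by
  obtain ⟨N, hN, hc⟩ := (W.loc ha hb).commutator
  rw [hc, add_assoc, add_right_inj]
  have h1 : ∀ j ∉ Finset.range N, ((Ring.choose m j : ℤ) : ℂ) •
      mode (circE (koszul p q) j a b) (m + n - j) = 0 := fun j hj => by
    rw [hN j (by simpa using hj), mode_zero, smul_zero]
  have h2 : ∀ j ∉ Finset.range 2, ((Ring.choose m j : ℤ) : ℂ) •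
      mode (circE (koszul p q) j a b) (m + n - j) = 0 := fun j hj => by
    obtain ⟨k, rfl⟩ : ∃ k, j = k + 2 := ⟨j - 2, by simp at hj; omega⟩
    rw [← LocalSpace.circ_eq ha hb, h k, mode_zero, smul_zero]
  rw [← finsum_eq_sum_of_support_subset (s := Finset.range N) _
      (fun j hj => by by_contra hn; exact hj (h1 j hn)),
    finsum_eq_sum_of_support_subset (s := Finset.range 2) _
      (fun j hj => by by_contra hn; exact hj (h2 j hn)),
    Finset.sum_range_succ, Finset.sum_range_one, ← LocalSpace.circ_eq ha hb,
    ← LocalSpace.circ_eq ha hb]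
  simp

variable {I : Type} [DecidableEq I]

/-- The coefficient of the pole in the product of two free fields. -/
def pairing (p t : Bool) (i : I) (q t' : Bool) (j : I) : ℂ :=
  if p = q ∧ t' = !t ∧ i = j then freeSign p t else 0

theorem free_free_apply (p t : Bool) (i : I) (q t' : Bool) (j : I) (m n : ℤ) (v : Fock I) :
    mode (free p t i) m (mode (free q t' j) n v) =
      koszul p q • mode (free q t' j) n (mode (free p t i) m v) +
      (if m + n = -1 then pairing p t i q t' j else 0) • v := by
  have h := LinearMap.congr_fun (free_free p t i q t' j m n) v
  rw [Module.End.mul_apply, LinearMap.add_apply, LinearMap.smul_apply, Module.End.mul_apply,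
    LinearMap.smul_apply, Module.End.one_apply] at h
  rw [h, pairing]
  congr 2
  by_cases h1 : m + n = -1 <;> simp [h1]

/-- The normally ordered product of two free fields. -/
def quad (x y : Bool × Bool × I) : QO (Fock I) :=
  wick (parity I) (free x.1 x.2.1 x.2.2) (free y.1 y.2.1 y.2.2)

theorem quad_mem (x y : Bool × Bool × I) : quad x y ∈ (fockLocal I).carrier (xor x.1 y.1) :=
  LocalSpace.circ_mem (X := fockVacuum I) (free_mem ..) (free_mem ..) _

theorem state_quad (x y : Bool × Bool × I) : (fockVacuum I).state (quad x y) =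
    mode (free x.1 x.2.1 x.2.2) (-1) (mode (free y.1 y.2.1 y.2.2) (-1) fockΩ) :=
  LocalSpace.state_circ (X := fockVacuum I) (free_mem ..) (free_mem ..) _

theorem eq_of_state_eq {a b : QO (Fock I)} (ha : a ∈ (fockLocal I).total)
    (hb : b ∈ (fockLocal I).total) (h : (fockVacuum I).state a = (fockVacuum I).state b) : a = b :=
  fock_state_injOn ha hb h

/-- A free field contracts with one factor of the normally ordered product at a time, giving a
simple pole with a linear residue. The residue is identified by its state. -/
theorem free_mul_quad (p t : Bool) (i : I) (x y : Bool × Bool × I) (m n : ℤ) :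
    mode (free p t i) m * mode (quad x y) n =
      koszul p (xor x.1 y.1) • (mode (quad x y) n * mode (free p t i) m) +
      (pairing p t i x.1 x.2.1 x.2.2 • mode (free y.1 y.2.1 y.2.2) (m + n) +
        (koszul p x.1 * pairing p t i y.1 y.2.1 y.2.2) •
          mode (free x.1 x.2.1 x.2.2) (m + n)) := by
  have hs : ∀ j : ℕ, (fockVacuum I).state (circ (parity I) j (free p t i) (quad x y)) =
      (if j = 0 then (1 : ℂ) else 0) • (pairing p t i x.1 x.2.1 x.2.2 •
        mode (free y.1 y.2.1 y.2.2) (-1) fockΩ +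
        (koszul p x.1 * pairing p t i y.1 y.2.1 y.2.2) •
          mode (free x.1 x.2.1 x.2.2) (-1) fockΩ) := by
    intro j
    have h1 := LocalSpace.state_circ (X := fockVacuum I) (free_mem p t i) (quad_mem x y) j
    refine h1.trans ?_
    have hj : (j : ℤ) + -1 = -1 ↔ j = 0 := by omega
    rw [state_quad, free_free_apply p t i x.1, free_free_apply p t i y.1, mode_free_creative p t i (by omega)]
    simp only [hj]
    split_ifs
    · simp only [map_add, map_smul, map_zero, smul_zero]
      module
    · simp
  have hmem : ∀ j : ℤ, circ (parity I) j (free p t i) (quad x y) ∈ (fockLocal I).total :=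
    fun j => LocalSpace.le_total _ _
      (LocalSpace.circ_mem (X := fockVacuum I) (free_mem p t i) (quad_mem x y) j)
  have h0 : circ (parity I) 0 (free p t i) (quad x y) =
      pairing p t i x.1 x.2.1 x.2.2 • free y.1 y.2.1 y.2.2 +
      (koszul p x.1 * pairing p t i y.1 y.2.1 y.2.2) • free x.1 x.2.1 x.2.2 := by
    refine eq_of_state_eq (hmem 0) (Submodule.add_mem _ (Submodule.smul_mem _ _
      (LocalSpace.le_total _ _ (free_mem ..))) (Submodule.smul_mem _ _
      (LocalSpace.le_total _ _ (free_mem ..)))) ?_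
    have := hs 0
    rw [if_pos rfl, one_smul] at this
    rw [map_add, map_smul, map_smul]
    exact this
  have h1 : ∀ j : ℕ, circ (parity I) (j + 1 : ℕ) (free p t i) (quad x y) = 0 := fun j =>
    eq_of_state_eq (hmem _) (Submodule.zero_mem _) (by
      rw [hs, if_neg (by omega), zero_smul, map_zero])
  have := LocalSpace.commutator_of_circ_eq_zero (X := fockVacuum I) (free_mem p t i)
    (quad_mem x y) (fun j => h1 (j + 1)) m n
  rw [this]
  have e : circ (fockVacuum I).σ 1 (free p t i) (quad x y) = 0 := h1 0
  have e0 : circ (fockVacuum I).σ 0 (free p t i) (quad x y) = _ := h0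
  rw [e, e0, mode_zero, smul_zero, add_zero, mode_add, mode_smul, mode_smul]

/-- The rule for pushing a mode of a quadratic field to the right past a free mode. The adjoint
actions of the currents and the leading symbols are both computed from it. -/
theorem quad_free_apply (p t : Bool) (i : I) (x y : Bool × Bool × I) (m n : ℤ) (v : Fock I) :
    mode (quad x y) m (mode (free p t i) n v) =
      koszul p (xor x.1 y.1) • mode (free p t i) n (mode (quad x y) m v) -
      koszul p (xor x.1 y.1) • (pairing p t i x.1 x.2.1 x.2.2 •
          mode (free y.1 y.2.1 y.2.2) (m + n) v +
        (koszul p x.1 * pairing p t i y.1 y.2.1 y.2.2) •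
          mode (free x.1 x.2.1 x.2.2) (m + n) v) := by
  have h := LinearMap.congr_fun (free_mul_quad p t i x y n m) v
  simp only [Module.End.mul_apply, LinearMap.add_apply, LinearMap.smul_apply] at h
  rw [h, smul_add, smul_smul, koszul_mul_self, one_smul, add_comm n m, add_sub_cancel_right]

end Quadratic

section Currents

/-! ### The generating currents and their commutation relations -/

theorem vh_eq : vh = quad (false, false, .h) (false, true, .h) +
    quad (false, false, .x) (false, true, .x) + quad (false, false, .y) (false, true, .y) := rfl

theorem vx_eq : vx = (1 / 2 : ℂ) • (quad (false, true, .h) (false, true, .h) +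
    quad (false, true, .x) (false, true, .y)) := rfl

theorem vy_eq : vy = (-1 / 2 : ℂ) • (quad (false, false, .h) (false, false, .h) +
    (4 : ℂ) • quad (false, false, .x) (false, false, .y)) := rfl

theorem K_eq : K = quad (false, true, .h) (true, false, .h) +
    quad (false, true, .x) (true, false, .x) + quad (false, true, .y) (true, false, .y) := rfl

theorem Q_eq : Q = quad (false, false, .h) (true, false, .h) +
    (2 : ℂ) • quad (false, false, .x) (true, false, .y) +
    (2 : ℂ) • quad (false, false, .y) (true, false, .x) := rfl

theorem F_eq : F = -(quad (true, false, .x) (true, true, .x) +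
    quad (true, false, .y) (true, true, .y) + quad (true, false, .h) (true, true, .h)) := rfl

theorem Theta_eq (ξ : Root) : Theta ξ = ∑ i : Root, ∑ j : Root, bracket ξ i j •
    (quad (true, false, j) (true, true, i) - quad (false, false, j) (false, true, i)) := rfl

theorem quad_mem_carrier {x y : Bool × Bool × Root} {p : Bool} (h : xor x.1 y.1 = p) :
    quad x y ∈ (fockLocal Root).carrier p := h ▸ quad_mem x y

theorem vh_mem : vh ∈ (fockLocal Root).carrier false := by
  rw [vh_eq]
  exact Submodule.add_mem _ (Submodule.add_mem _ (quad_mem_carrier rfl) (quad_mem_carrier rfl))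
    (quad_mem_carrier rfl)

theorem vx_mem : vx ∈ (fockLocal Root).carrier false := by
  rw [vx_eq]
  exact Submodule.smul_mem _ _ (Submodule.add_mem _ (quad_mem_carrier rfl) (quad_mem_carrier rfl))

theorem vy_mem : vy ∈ (fockLocal Root).carrier false := by
  rw [vy_eq]
  exact Submodule.smul_mem _ _ (Submodule.add_mem _ (quad_mem_carrier rfl)
    (Submodule.smul_mem _ _ (quad_mem_carrier rfl)))

theorem K_mem : K ∈ (fockLocal Root).carrier true := by
  rw [K_eq]
  exact Submodule.add_mem _ (Submodule.add_mem _ (quad_mem_carrier rfl) (quad_mem_carrier rfl))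
    (quad_mem_carrier rfl)

theorem Q_mem : Q ∈ (fockLocal Root).carrier true := by
  rw [Q_eq]
  exact Submodule.add_mem _ (Submodule.add_mem _ (quad_mem_carrier rfl)
    (Submodule.smul_mem _ _ (quad_mem_carrier rfl))) (Submodule.smul_mem _ _ (quad_mem_carrier rfl))

theorem F_mem : F ∈ (fockLocal Root).carrier false := by
  rw [F_eq]
  exact Submodule.neg_mem _ (Submodule.add_mem _ (Submodule.add_mem _ (quad_mem_carrier rfl)
    (quad_mem_carrier rfl)) (quad_mem_carrier rfl))

theorem Theta_mem (ξ : Root) : Theta ξ ∈ (fockLocal Root).carrier false := by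
  rw [Theta_eq]
  exact Submodule.sum_mem _ fun i _ => Submodule.sum_mem _ fun j _ => Submodule.smul_mem _ _
    (Submodule.sub_mem _ (quad_mem_carrier rfl) (quad_mem_carrier rfl))

/-- The adjoint action of `v^h` on the free fields. -/
def adVh (p t : Bool) (i : Root) : WField :=
  if p then 0 else (if t then (1 : ℂ) else -1) • free p t i

/-- The adjoint action of `v^x` on the free fields. -/
def adVx (p t : Bool) (i : Root) : WField :=
  if p || t then 0 else match i with
    | .h => (-1 : ℂ) • free false true .h
    | .x => (-1 / 2 : ℂ) • free false true .y
    | .y => (-1 / 2 : ℂ) • free false true .x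

/-- The adjoint action of `v^y` on the free fields. -/
def adVy (p t : Bool) (i : Root) : WField :=
  if p || !t then 0 else match i with
    | .h => (-1 : ℂ) • free false false .h
    | .x => (-2 : ℂ) • free false false .y
    | .y => (-2 : ℂ) • free false false .x

/-- The adjoint action of `K` on the free fields. -/
def adK (p t : Bool) (i : Root) : WField :=
  if p == t then (if p then (1 : ℂ) else -1) • free (!p) t i else 0

/-- The adjoint action of `Q` on the free fields. -/
def adQ (p t : Bool) (i : Root) : WField :=
  if t then match i with
    | .h => (1 : ℂ) • free (!p) false .h
    | .x => (2 : ℂ) • free (!p) false .y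
    | .y => (2 : ℂ) • free (!p) false .x
  else 0

/-- The adjoint action of `F` on the free fields. -/
def adF (p t : Bool) (i : Root) : WField :=
  if p then (if t then (1 : ℂ) else -1) • free p t i else 0

variable (p t : Bool) (i : Root) (m n : ℤ) (v : Fock Root)

/-- Each current acts on the free fields by a first-order pole, so its action is a table with one
entry for each of the twelve free fields. These rules evaluate currents on states. -/
theorem vh_apply : mode vh m (mode (free p t i) n v) =
    mode (free p t i) n (mode vh m v) + mode (adVh p t i) (m + n) v := by
  cases p <;> cases t <;> cases i <;>
  simp [vh_eq, adVh, mode_add, mode_neg, mode_zero, quad_free_apply, koszul, pairing,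
    freeSign] <;> module

theorem vx_apply : mode vx m (mode (free p t i) n v) =
    mode (free p t i) n (mode vx m v) + mode (adVx p t i) (m + n) v := by
  cases p <;> cases t <;> cases i <;>
  simp [vx_eq, adVx, mode_add, mode_neg, mode_smul, mode_zero, quad_free_apply, koszul, pairing,
    freeSign] <;> module

theorem vy_apply : mode vy m (mode (free p t i) n v) =
    mode (free p t i) n (mode vy m v) + mode (adVy p t i) (m + n) v := by
  cases p <;> cases t <;> cases i <;>
  simp [vy_eq, adVy, mode_add, mode_neg, mode_smul, mode_zero, quad_free_apply, koszul, pairing,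
    freeSign] <;> module

theorem K_apply : mode K m (mode (free p t i) n v) =
    psign p • mode (free p t i) n (mode K m v) + mode (adK p t i) (m + n) v := by
  cases p <;> cases t <;> cases i <;>
  simp [K_eq, adK, mode_add, mode_neg, mode_zero, quad_free_apply, koszul, pairing, freeSign,
    psign] <;> module

theorem Q_apply : mode Q m (mode (free p t i) n v) =
    psign p • mode (free p t i) n (mode Q m v) + mode (adQ p t i) (m + n) v := by
  cases p <;> cases t <;> cases i <;>
  simp [Q_eq, adQ, mode_add, mode_smul, mode_zero, quad_free_apply, koszul, pairing, freeSign,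
    psign] <;> module

theorem F_apply : mode F m (mode (free p t i) n v) =
    mode (free p t i) n (mode F m v) + mode (adF p t i) (m + n) v := by
  cases p <;> cases t <;> cases i <;>
  simp [F_eq, adF, mode_add, mode_neg, mode_zero, quad_free_apply, koszul, pairing,
    freeSign] <;> module

end Currents

/-! ### Operator products of the generating currents. -/

section CurrentAlgebra

/-- The product a ∘ⱼ b has state a(j) applied to the state of b. The finitely many conditions `h0`,
`h1` and the vanishing `h2` therefore determine the whole commutator. -/
theorem current_comm {p q : Bool} {a b r : WField} (ha : a ∈ (fockLocal Root).carrier p)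
    (hb : b ∈ (fockLocal Root).carrier q) (hr : r ∈ (fockLocal Root).total) (s : ℂ)
    (h0 : mode a 0 ((fockVacuum Root).state b) = (fockVacuum Root).state r)
    (h1 : mode a 1 ((fockVacuum Root).state b) = s • fockΩ)
    (h2 : ∀ n, 2 ≤ n → mode a n ((fockVacuum Root).state b) = 0) (m n : ℤ) :
    mode a m * mode b n = koszul p q • (mode b n * mode a m) + mode r (m + n) +
      (m * s) • mode one (m + n - 1) := by
  have hmem : ∀ j : ℤ, circ (fockVacuum Root).σ j a b ∈ (fockLocal Root).total :=
    fun j => LocalSpace.le_total _ _ (LocalSpace.circ_mem ha hb j)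
  have hst : ∀ j : ℤ, (fockVacuum Root).state (circ (fockVacuum Root).σ j a b) =
      mode a j ((fockVacuum Root).state b) := fun j => LocalSpace.state_circ ha hb j
  have e0 : circ (fockVacuum Root).σ 0 a b = r :=
    eq_of_state_eq (hmem 0) hr ((hst 0).trans h0)
  have e1 : circ (fockVacuum Root).σ 1 a b = s • one :=
    eq_of_state_eq (hmem 1) (Submodule.smul_mem _ _
      (LocalSpace.le_total _ _ (fockLocal Root).one_mem)) ((hst 1).trans (h1.trans (by
        rw [map_smul, Vacuum.state_one]; rfl)))
  rw [LocalSpace.commutator_of_circ_eq_zero ha hb (fun j => eq_of_state_eq (hmem _)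
    (Submodule.zero_mem _) ((hst _).trans ((h2 _ (by omega)).trans (map_zero _).symm))), e0, e1,
    mode_smul, smul_smul]

theorem state_vh : (fockVacuum Root).state vh =
    mode (free false false .h) (-1) (mode (free false true .h) (-1) fockΩ) +
    mode (free false false .x) (-1) (mode (free false true .x) (-1) fockΩ) +
    mode (free false false .y) (-1) (mode (free false true .y) (-1) fockΩ) := by
  rw [vh_eq, map_add, map_add, state_quad, state_quad, state_quad]

theorem state_vx : (fockVacuum Root).state vx = (1 / 2 : ℂ) •
    (mode (free false true .h) (-1) (mode (free false true .h) (-1) fockΩ) +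
    mode (free false true .x) (-1) (mode (free false true .y) (-1) fockΩ)) := by
  rw [vx_eq, map_smul, map_add, state_quad, state_quad]

theorem state_vy : (fockVacuum Root).state vy = (-1 / 2 : ℂ) •
    (mode (free false false .h) (-1) (mode (free false false .h) (-1) fockΩ) +
    (4 : ℂ) • mode (free false false .x) (-1) (mode (free false false .y) (-1) fockΩ)) := by
  rw [vy_eq, map_smul, map_add, map_smul, state_quad, state_quad]

theorem state_K : (fockVacuum Root).state K =
    mode (free false true .h) (-1) (mode (free true false .h) (-1) fockΩ) +
    mode (free false true .x) (-1) (mode (free true false .x) (-1) fockΩ) +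
    mode (free false true .y) (-1) (mode (free true false .y) (-1) fockΩ) := by
  rw [K_eq, map_add, map_add, state_quad, state_quad, state_quad]

theorem state_Q : (fockVacuum Root).state Q =
    mode (free false false .h) (-1) (mode (free true false .h) (-1) fockΩ) +
    (2 : ℂ) • mode (free false false .x) (-1) (mode (free true false .y) (-1) fockΩ) +
    (2 : ℂ) • mode (free false false .y) (-1) (mode (free true false .x) (-1) fockΩ) := by
  rw [Q_eq, map_add, map_add, map_smul, map_smul, state_quad, state_quad, state_quad]

section Swap

variable (v : Fock Root)

/-- Modes of index -1 supercommute without contraction. The specialised forms that follow bring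
states to a common normal order. -/
theorem free_swap (p t : Bool) (i : Root) (q t' : Bool) (j : Root) :
    mode (free p t i) (-1) (mode (free q t' j) (-1) v) =
      koszul p q • mode (free q t' j) (-1) (mode (free p t i) (-1) v) := by
  rw [free_free_apply, if_neg (by norm_num), zero_smul, add_zero]

theorem swap_true_false (t : Bool) (i : Root) (t' : Bool) (j : Root) :
    mode (free true t i) (-1) (mode (free false t' j) (-1) v) =
      mode (free false t' j) (-1) (mode (free true t i) (-1) v) :=
  (free_swap v ..).trans (one_smul _ _)

theorem swap_gamma_beta (i j : Root) :
    mode (free false true i) (-1) (mode (free false false j) (-1) v) =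
      mode (free false false j) (-1) (mode (free false true i) (-1) v) :=
  (free_swap v ..).trans (one_smul _ _)

theorem swap_y_x (t : Bool) : mode (free false t .y) (-1) (mode (free false t .x) (-1) v) =
    mode (free false t .x) (-1) (mode (free false t .y) (-1) v) :=
  (free_swap v ..).trans (one_smul _ _)

theorem swap_odd_y_x (t : Bool) : mode (free true t .y) (-1) (mode (free true t .x) (-1) v) =
    -mode (free true t .x) (-1) (mode (free true t .y) (-1) v) :=
  (free_swap v ..).trans (neg_one_smul _ _)

theorem odd_free_sq (t : Bool) (i : Root) :
    mode (free true t i) (-1) (mode (free true t i) (-1) v) = 0 := by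
  have h := free_swap v true t i true t i
  rw [show koszul true true = -1 from rfl, neg_one_smul, eq_neg_iff_add_eq_zero, ← two_smul ℂ] at h
  exact (smul_eq_zero.mp h).resolve_left two_ne_zero

end Swap

theorem free_vacuum (p t : Bool) (i : Root) (q t' : Bool) (j : Root) {n : ℤ} (hn : 0 ≤ n) :
    mode (free p t i) n (mode (free q t' j) (-1) fockΩ) =
      (if n = 0 then pairing p t i q t' j else 0) • fockΩ := by
  rw [free_free_apply, mode_free_creative p t i hn, map_zero, smul_zero, zero_add]
  simp only [add_eq_right]

theorem free_vacuum_zero (p t : Bool) (i : Root) (q t' : Bool) (j : Root) :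
    mode (free p t i) 0 (mode (free q t' j) (-1) fockΩ) = pairing p t i q t' j • fockΩ := by
  rw [free_vacuum _ _ _ _ _ _ le_rfl, if_pos rfl]

theorem free_vacuum_pos (p t : Bool) (i : Root) (q t' : Bool) (j : Root) {n : ℤ} (hn : 1 ≤ n) :
    mode (free p t i) n (mode (free q t' j) (-1) fockΩ) = 0 := by
  rw [free_vacuum _ _ _ _ _ _ (by omega), if_neg (by omega), zero_smul]

theorem creative_of_mem {p : Bool} {a : WField} (ha : a ∈ (fockLocal Root).carrier p) {n : ℤ}
    (hn : 0 ≤ n) : mode a n fockΩ = 0 := ((fockLocal Root).good ha).creative n hn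

/-- The even generating currents. -/
def evenCurrent : Root → WField
  | .x => vx
  | .y => vy
  | .h => vh

/-- The odd generating currents. -/
def oddCurrent : Bool → WField
  | false => K
  | true => Q

theorem evenCurrent_mem (i : Root) : evenCurrent i ∈ (fockLocal Root).carrier false := by
  cases i
  exacts [vx_mem, vy_mem, vh_mem]

theorem oddCurrent_mem (o : Bool) : oddCurrent o ∈ (fockLocal Root).carrier true := by
  cases o
  exacts [K_mem, Q_mem]

/-- The singular part of the product of two fields acting on the vacuum. -/
def SingularPart (a b r : WField) (s : ℂ) : Prop :=
  mode a 0 ((fockVacuum Root).state b) = (fockVacuum Root).state r ∧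
    mode a 1 ((fockVacuum Root).state b) = s • fockΩ ∧
    ∀ n, 2 ≤ n → mode a n ((fockVacuum Root).state b) = 0

/-- The commutator of two even currents. -/
def evenBracket : Root → Root → ℂ × Root
  | .x, .y => (1, .h)
  | .y, .x => (-1, .h)
  | .x, .h => (-2, .x)
  | .h, .x => (2, .x)
  | .y, .h => (2, .y)
  | .h, .y => (-2, .y)
  | _, _ => (0, .h)

/-- The central term in the commutator of two even currents. -/
def evenLevel : Root → Root → ℂ
  | .x, .y => -3 / 2
  | .y, .x => -3 / 2
  | .h, .h => -3
  | _, _ => 0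

/-- The commutator of an even and an odd current. -/
def oddBracket : Root → Bool → ℂ × Bool
  | .x, true => (-1, false)
  | .y, false => (-1, true)
  | .h, false => (1, false)
  | .h, true => (-1, true)
  | _, _ => (0, true)

/-- The supercommutator of `K` and an even current. -/
def koszulBracket : Root → WField
  | .x => 0
  | .y => Q
  | .h => (-1 : ℂ) • K

set_option linter.unusedSimpArgs false
set_option linter.unnecessarySeqFocus false

/-- The current is moved through the two free modes of the state. Index 0 leaves the bracket, index
1 a double contraction, which is the central term, and larger indices nothing. The result is affine
sl₂ at level -3/2; for the pair h, h, each of the three βγ pairs contributes -1. -/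
theorem singularPart_even_even (i j : Root) : SingularPart (evenCurrent i) (evenCurrent j)
    ((evenBracket i j).1 • evenCurrent (evenBracket i j).2) (evenLevel i j) := by
  have hc : ∀ n : ℤ, 0 ≤ n → mode (evenCurrent i) n fockΩ = 0 :=
    fun n hn => creative_of_mem (evenCurrent_mem i) hn
  refine ⟨?_, ?_, fun n hn => ?_⟩
  · have h0 := hc 0 le_rfl
    cases i <;> cases j <;> simp only [evenCurrent, evenBracket] at h0 ⊢ <;>
    simp [state_vx, state_vy, state_vh, vx_apply, vy_apply, vh_apply, adVx, adVy, adVh, h0,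
      mode_smul, mode_neg, mode_zero, swap_gamma_beta, swap_y_x] <;> try module
  · have h0 := hc 1 zero_le_one
    cases i <;> cases j <;> simp only [evenCurrent, evenLevel] at h0 ⊢ <;>
    simp [state_vx, state_vy, state_vh, vx_apply, vy_apply, vh_apply, adVx, adVy, adVh, h0,
      mode_smul, mode_neg, mode_zero, free_vacuum_zero, pairing, freeSign,
      mode_free_creative] <;> try module
  · have h0 := hc n (by omega)
    have h1 : 1 ≤ n + -1 := by omega
    cases i <;> cases j <;> simp only [evenCurrent] at h0 ⊢ <;>
    simp [state_vx, state_vy, state_vh, vx_apply, vy_apply, vh_apply, adVx, adVy, adVh, h0,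
      mode_smul, mode_neg, mode_zero, free_vacuum_pos _ _ _ _ _ _ h1,
      mode_free_creative _ _ _ (zero_le_one.trans h1)]

/-- The pair K, Q is a two-dimensional representation. There is no central term because the state
contains one even and one odd free mode, which do not contract after an even current has acted. -/
theorem singularPart_even_odd (i : Root) (o : Bool) : SingularPart (evenCurrent i) (oddCurrent o)
    ((oddBracket i o).1 • oddCurrent (oddBracket i o).2) 0 := by
  have hc : ∀ n : ℤ, 0 ≤ n → mode (evenCurrent i) n fockΩ = 0 :=
    fun n hn => creative_of_mem (evenCurrent_mem i) hn
  refine ⟨?_, ?_, fun n hn => ?_⟩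
  · have h0 := hc 0 le_rfl
    cases i <;> cases o <;> simp only [evenCurrent, oddCurrent, oddBracket] at h0 ⊢ <;>
    simp [state_K, state_Q, vx_apply, vy_apply, vh_apply, adVx, adVy, adVh, h0,
      mode_smul, mode_neg, mode_zero] <;> try module
  · have h0 := hc 1 zero_le_one
    cases i <;> cases o <;> simp only [evenCurrent, oddCurrent] at h0 ⊢ <;>
    simp [state_K, state_Q, vx_apply, vy_apply, vh_apply, adVx, adVy, adVh, h0,
      mode_smul, mode_neg, mode_zero, free_vacuum_zero, pairing, mode_free_creative]
  · have h0 := hc n (by omega)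
    have h1 : 1 ≤ n + -1 := by omega
    cases i <;> cases o <;> simp only [evenCurrent, oddCurrent] at h0 ⊢ <;>
    simp [state_K, state_Q, vx_apply, vy_apply, vh_apply, adVx, adVy, adVh, h0,
      mode_smul, mode_neg, mode_zero, free_vacuum_pos _ _ _ _ _ _ h1,
      mode_free_creative _ _ _ (zero_le_one.trans h1)]

/-- The index 0 part gives K(0) on the even currents: it pairs -v^h with K and v^y with Q, and it
kills v^x. -/
theorem singularPart_K_even (i : Root) :
    SingularPart K (evenCurrent i) (koszulBracket i) 0 := by
  have hc : ∀ n : ℤ, 0 ≤ n → mode K n fockΩ = 0 := fun n hn => creative_of_mem K_mem hn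
  refine ⟨?_, ?_, fun n hn => ?_⟩
  · have h0 := hc 0 le_rfl
    cases i <;> simp only [evenCurrent, koszulBracket] <;>
    simp [state_vx, state_vy, state_vh, state_K, state_Q, K_apply, adK, h0, psign,
      mode_smul, mode_neg, mode_zero, swap_true_false, swap_gamma_beta] <;> try module
  · have h0 := hc 1 zero_le_one
    cases i <;> simp only [evenCurrent] <;>
    simp [state_vx, state_vy, state_vh, K_apply, adK, h0, psign,
      mode_smul, mode_neg, mode_zero, free_vacuum_zero, pairing, mode_free_creative]
  · have h0 := hc n (by omega)
    have h1 : 1 ≤ n + -1 := by omega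
    cases i <;> simp only [evenCurrent] <;>
    simp [state_vx, state_vy, state_vh, K_apply, adK, h0, psign,
      mode_smul, mode_neg, mode_zero, free_vacuum_pos _ _ _ _ _ _ h1,
      mode_free_creative _ _ _ (zero_le_one.trans h1)]

/-- K kills the factors γ and b of K itself. In Q it turns each β into -b, and the resulting
symmetric expression in the anticommuting b vanishes. -/
theorem singularPart_K_odd (o : Bool) : SingularPart K (oddCurrent o) 0 0 := by
  have hc : ∀ n : ℤ, 0 ≤ n → mode K n fockΩ = 0 := fun n hn => creative_of_mem K_mem hn
  refine ⟨?_, ?_, fun n hn => ?_⟩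
  · have h0 := hc 0 le_rfl
    cases o <;> simp only [oddCurrent] <;>
    simp [state_K, state_Q, K_apply, adK, h0, psign, mode_smul, mode_neg, mode_zero,
      odd_free_sq, swap_odd_y_x]
  · have h0 := hc 1 zero_le_one
    cases o <;> simp only [oddCurrent] <;>
    simp [state_K, state_Q, K_apply, adK, h0, psign, mode_smul, mode_neg, mode_zero,
      free_vacuum_zero, pairing, mode_free_creative]
  · have h0 := hc n (by omega)
    have h1 : 1 ≤ n + -1 := by omega
    cases o <;> simp only [oddCurrent] <;>
    simp [state_K, state_Q, K_apply, adK, h0, psign, mode_smul, mode_neg, mode_zero,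
      free_vacuum_pos _ _ _ _ _ _ h1, mode_free_creative _ _ _ (zero_le_one.trans h1)]

theorem singularPart_Q_Q : SingularPart Q Q 0 0 := by
  have hc : ∀ n : ℤ, 0 ≤ n → mode Q n fockΩ = 0 := fun n hn => creative_of_mem Q_mem hn
  refine ⟨?_, ?_, fun n hn => ?_⟩ <;>
  simp [state_Q, Q_apply, adQ, hc 0 le_rfl, hc 1 zero_le_one, psign, mode_zero]
  simp [hc n (by omega)]

theorem SingularPart.commutator {p q : Bool} {a b r : WField} {s : ℂ} (h : SingularPart a b r s)
    (ha : a ∈ (fockLocal Root).carrier p) (hb : b ∈ (fockLocal Root).carrier q)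
    (hr : r ∈ (fockLocal Root).total) (m n : ℤ) :
    mode a m * mode b n = koszul p q • (mode b n * mode a m) + mode r (m + n) +
      (m * s) • mode one (m + n - 1) :=
  current_comm ha hb hr s h.1 h.2.1 h.2.2 m n

theorem even_even_comm (i j : Root) (m n : ℤ) :
    mode (evenCurrent i) m * mode (evenCurrent j) n =
      mode (evenCurrent j) n * mode (evenCurrent i) m +
        (evenBracket i j).1 • mode (evenCurrent (evenBracket i j).2) (m + n) +
        (m * evenLevel i j) • mode one (m + n - 1) := by
  have h := (singularPart_even_even i j).commutator (evenCurrent_mem i) (evenCurrent_mem j)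
    (LocalSpace.le_total _ _ (Submodule.smul_mem _ _ (evenCurrent_mem _))) m n
  rw [h, mode_smul, show koszul false false = 1 from rfl, one_smul]

theorem even_odd_comm (i : Root) (o : Bool) (m n : ℤ) :
    mode (evenCurrent i) m * mode (oddCurrent o) n =
      mode (oddCurrent o) n * mode (evenCurrent i) m +
        (oddBracket i o).1 • mode (oddCurrent (oddBracket i o).2) (m + n) := by
  have h := (singularPart_even_odd i o).commutator (evenCurrent_mem i) (oddCurrent_mem o)
    (LocalSpace.le_total _ _ (Submodule.smul_mem _ _ (oddCurrent_mem _))) m n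
  rw [h, mode_smul, show koszul false true = 1 from rfl, one_smul, mul_zero, zero_smul, add_zero]

theorem koszulBracket_mem (i : Root) : koszulBracket i ∈ (fockLocal Root).total := by
  cases i
  exacts [Submodule.zero_mem _, LocalSpace.le_total _ _ Q_mem,
    LocalSpace.le_total _ _ (Submodule.smul_mem _ _ K_mem)]

theorem K_even_comm (i : Root) (m n : ℤ) : mode K m * mode (evenCurrent i) n =
    mode (evenCurrent i) n * mode K m + mode (koszulBracket i) (m + n) := by
  have h := (singularPart_K_even i).commutator K_mem (evenCurrent_mem i) (koszulBracket_mem i) m n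
  rw [h, show koszul true false = 1 from rfl, one_smul, mul_zero, zero_smul, add_zero]

theorem odd_odd_comm (o o' : Bool) (m n : ℤ) : mode (oddCurrent o) m * mode (oddCurrent o') n =
    -(mode (oddCurrent o') n * mode (oddCurrent o) m) := by
  have h : ∀ {o o'}, SingularPart (oddCurrent o) (oddCurrent o') 0 0 → ∀ m n,
      mode (oddCurrent o) m * mode (oddCurrent o') n =
        -(mode (oddCurrent o') n * mode (oddCurrent o) m) := by
    intro o o' h m n
    rw [h.commutator (oddCurrent_mem o) (oddCurrent_mem o') (Submodule.zero_mem _), mode_zero,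
      show koszul true true = -1 from rfl, neg_one_smul, mul_zero, zero_smul, add_zero, add_zero]
  cases o
  · exact h (o := false) (singularPart_K_odd o') m n
  -- The relation for Q with K is the one for K with Q read backwards.
  · cases o'
    · rw [h (o := false) (o' := true) (singularPart_K_odd true) n m, neg_neg]
    · exact h (o := true) (o' := true) singularPart_Q_Q m n

end CurrentAlgebra

section Symbols

/-! ### Leading symbols -/

/-- Hensel's lemma for T² - a in the X-adic topology: a square root r of the constant term is a
simple root, because 2r ≠ 0. -/
theorem exists_sqrt_powerSeries {a : PowerSeries ℂ} (ha : PowerSeries.constantCoeff a ≠ 0) :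
    ∃ u : PowerSeries ℂ, u * u = a ∧ PowerSeries.constantCoeff u ≠ 0 := by
  obtain ⟨r, hr⟩ := IsAlgClosed.exists_eq_mul_self (PowerSeries.constantCoeff a)
  have hr0 : r ≠ 0 := fun h => ha (by rw [hr, h, mul_zero])
  have hX : ∀ f : PowerSeries ℂ, f ∈ Ideal.span {(PowerSeries.X : PowerSeries ℂ)} ↔
      PowerSeries.constantCoeff f = 0 := fun f => by
    rw [Ideal.mem_span_singleton, PowerSeries.X_dvd_iff]
  obtain ⟨u, hu, hur⟩ := HenselianRing.is_henselian
    (I := Ideal.span {(PowerSeries.X : PowerSeries ℂ)})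
    (Polynomial.X ^ 2 - Polynomial.C a) (Polynomial.monic_X_pow_sub_C a two_ne_zero)
    (PowerSeries.C r) (by
      rw [hX]
      simp [hr, sq]) (by
      refine IsUnit.map _ ?_
      rw [PowerSeries.isUnit_iff_constantCoeff]
      simp [hr0])
  refine ⟨u, ?_, ?_⟩
  · have : u ^ 2 - a = 0 := by simpa using hu
    rw [← sq]
    exact sub_eq_zero.mp this
  · have := (hX _).mp hur
    rw [map_sub, sub_eq_zero] at this
    rw [this]
    simpa using hr0

/-- Induction on word length for statements P that depend on the length as well as on the vector.
The hypothesis `hle` is needed because a short word also counts as a long one. -/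
theorem wordSpan_exists {V G : Type} [AddCommGroup V] [Module ℂ V] (op : G → Module.End ℂ V) (Ω : V)
    (P : ℕ → V → Prop) (hadd : ∀ n v w, P n v → P n w → P n (v + w))
    (hsmul : ∀ n (r : ℂ) v, P n v → P n (r • v)) (h0 : P 0 Ω)
    (hle : ∀ n, ∀ v ∈ wordSpan op Ω n, P n v → P (n + 1) v)
    (hop : ∀ n g, ∀ v ∈ wordSpan op Ω n, P n v → P (n + 1) (op g v)) (n : ℕ) :
    ∀ v ∈ wordSpan op Ω n, P n v := by
  have hz : ∀ n v, P n v → P n 0 := fun n v h => by simpa using hsmul n 0 v h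
  induction n with
  | zero =>
    intro v hv
    obtain ⟨r, rfl⟩ := Submodule.mem_span_singleton.mp hv
    exact hsmul _ _ _ h0
  | succ n ih =>
    let A : Submodule ℂ V :=
      { carrier := {v | P (n + 1) v}
        add_mem' := fun ha hb => hadd _ _ _ ha hb
        zero_mem' := hle n 0 (Submodule.zero_mem _) (ih 0 (Submodule.zero_mem _))
        smul_mem' := fun r _ ha => hsmul _ r _ ha }
    exact wordSpan_succ_le (P := A) op Ω (fun v hv => hle n v hv (ih v hv))
      (fun g v hv => hop n g v hv (ih v hv))

variable {I : Type}

/-- The states of polynomial degree at most `n`. -/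
def fockFil (I : Type) (n : ℕ) : Submodule ℂ (Fock I) :=
  wordSpan (fun g : Bool × Var I => varMul g.1 g.2) fockΩ n

theorem varMul_mem_fockFil (p : Bool) (v : Var I) {n : ℕ} {u : Fock I} (hu : u ∈ fockFil I n) :
    varMul p v u ∈ fockFil I (n + 1) :=
  op_mem_wordSpan (fun g : Bool × Var I => varMul g.1 g.2) fockΩ (p, v) hu

theorem fockFil_mono : Monotone (fockFil I) := wordSpan_mono _ _

/-- Values of the variables that are compatible with parity. -/
structure SuperPoint (I : Type) (Λ : Type) [Ring Λ] [Algebra ℂ Λ] where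
  val : Bool → Var I → Λ
  comm : ∀ p q v w, val p v * val q w = koszul p q • (val q w * val p v)

variable {Λ : Type} [Ring Λ] [Algebra ℂ Λ]

/-- The graded evaluation at a point. -/
theorem SuperPoint.exists_coeff (c : SuperPoint I Λ) : ∃ t : ℕ → Fock I →ₗ[ℂ] Λ,
    t 0 fockΩ = 1 ∧ (∀ n, t (n + 1) fockΩ = 0) ∧
      ∀ n p v u, t (n + 1) (varMul p v u) = c.val p v * t n u := by
  have hm : ∀ a b : Λ, Polynomial.C a * Polynomial.X * (Polynomial.C b * Polynomial.X) =
      Polynomial.C (a * b) * (Polynomial.X * Polynomial.X) := fun a b => by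
    rw [mul_assoc, ← mul_assoc Polynomial.X, Polynomial.X_mul_C, mul_assoc (Polynomial.C b),
      ← mul_assoc, ← Polynomial.C_mul]
  -- Every variable is sent to its value times the polynomial variable, so the coefficient of degree
  -- n evaluates the part of polynomial degree n.
  obtain ⟨F, hFe, hFo⟩ := SP.exists_lift (σ := Var I) (τ := Var I) (A := Polynomial Λ)
    (fun v => Polynomial.C (c.val false v) * Polynomial.X)
    (fun v => Polynomial.C (c.val true v) * Polynomial.X)
    (fun v w => by
      have h := c.comm false false v w
      rw [show koszul false false = 1 from rfl, one_smul] at h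
      rw [Commute, SemiconjBy, hm, hm, h])
    (fun v w => by
      have h := c.comm true true v w
      rw [show koszul true true = -1 from rfl, neg_one_smul] at h
      rw [hm, hm, h, ← add_mul, ← Polynomial.C_add, neg_add_cancel, Polynomial.C_0, zero_mul])
    (fun v w => by
      have h := c.comm false true v w
      rw [show koszul false true = 1 from rfl, one_smul] at h
      rw [Commute, SemiconjBy, hm, hm, h])
  let co : ℕ → Polynomial Λ →ₗ[ℂ] Λ := fun n => (Polynomial.lcoeff Λ n).restrictScalars ℂ
  have hco : ∀ n f, co n f = f.coeff n := fun _ _ => rfl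
  refine ⟨fun n => co n ∘ₗ F.toLinearMap ∘ₗ (fockSP I).toLinearMap, ?_, fun n => ?_,
    fun n p v u => ?_⟩
  · change co 0 (F (fockSP I fockΩ)) = 1
    rw [fockSP_fockΩ, map_one, hco, Polynomial.coeff_one_zero]
  · change co (n + 1) (F (fockSP I fockΩ)) = 0
    rw [fockSP_fockΩ, map_one, hco, Polynomial.coeff_one, if_neg (Nat.succ_ne_zero n)]
  · change co (n + 1) (F (fockSP I (varMul p v u))) = c.val p v * co n (F (fockSP I u))
    cases p
    · rw [fockSP_varMul_false, map_mul, hFe, hco, hco, mul_assoc, Polynomial.coeff_C_mul,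
        Polynomial.coeff_X_mul]
    · rw [fockSP_varMul_true, map_mul, hFo, hco, hco, mul_assoc, Polynomial.coeff_C_mul,
        Polynomial.coeff_X_mul]

variable {c : SuperPoint I Λ} {T : ℕ → Fock I →ₗ[ℂ] Λ}

/-- The evaluation in degree e sees only the top degree, so terms of smaller degree may be
discarded. -/
theorem coeff_eq_zero_of_mem_fockFil (hT0 : ∀ n, T (n + 1) fockΩ = 0)
    (hT : ∀ n p v u, T (n + 1) (varMul p v u) = c.val p v * T n u) (d : ℕ) :
    ∀ u ∈ fockFil I d, ∀ e, d < e → T e u = 0 := by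
  refine wordSpan_exists (fun g : Bool × Var I => varMul g.1 g.2) fockΩ
    (fun d u => ∀ e, d < e → T e u = 0)
    (fun d v w hv hw e he => by rw [map_add, hv e he, hw e he, add_zero])
    (fun d r v hv e he => by rw [map_smul, hv e he, smul_zero])
    (fun e he => by
      obtain ⟨e, rfl⟩ := Nat.exists_eq_succ_of_ne_zero he.ne'
      exact hT0 e)
    (fun d v _ hv e he => hv e (by omega)) ?_ d
  rintro d ⟨q, w⟩ u hu h e he
  obtain ⟨e, rfl⟩ : ∃ e', e = e' + 1 := ⟨e - 1, by omega⟩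
  change T (e + 1) (varMul q w u) = 0
  rw [hT, h e (by omega), mul_zero]

/-- The leading symbol of a mode of a quadratic field. -/
def quadSymbol (c : SuperPoint I Λ) (x y : Bool × Bool × I) (k : ℕ) : Λ :=
  ∑ j ∈ Finset.range (k + 1), c.val x.1 (mkVar x.2.1 x.2.2 j) * c.val y.1 (mkVar y.2.1 y.2.2 (k - j))

theorem quadSymbol_comm (c : SuperPoint I Λ) (x y : Bool × Bool × I) (k : ℕ) (p : Bool) (v : Var I) :
    c.val p v * quadSymbol c x y k = koszul p (xor x.1 y.1) • (quadSymbol c x y k * c.val p v) := by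
  rw [quadSymbol, Finset.mul_sum, Finset.sum_mul, Finset.smul_sum]
  refine Finset.sum_congr rfl fun j _ => ?_
  rw [← mul_assoc, c.comm p x.1, smul_mul_assoc, mul_assoc, c.comm p y.1, mul_smul_comm, smul_smul,
    koszul_xor, mul_assoc]

variable [DecidableEq I]

theorem free_nonneg_mem_fockFil (p t : Bool) (i : I) {n : ℤ} (hn : 0 ≤ n) (d : ℕ) :
    ∀ u ∈ fockFil I d, mode (free p t i) n u ∈ fockFil I d := by
  refine wordSpan_exists (fun g : Bool × Var I => varMul g.1 g.2) fockΩ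
    (fun d u => mode (free p t i) n u ∈ fockFil I d)
    (fun d v w hv hw => by rw [map_add]; exact Submodule.add_mem _ hv hw)
    (fun d r v hv => by rw [map_smul]; exact Submodule.smul_mem _ r hv)
    (by rw [mode_free_creative p t i hn]; exact Submodule.zero_mem _)
    (fun d v _ hv => fockFil_mono (Nat.le_succ d) hv) ?_ d
  rintro d ⟨q, w⟩ u hu h
  obtain ⟨t', j, k, rfl⟩ := exists_mkVar w
  change mode (free p t i) n (varMul q (mkVar t' j k) u) ∈ _
  rw [← mode_free_negSucc, free_free_apply, mode_free_negSucc]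
  exact Submodule.add_mem _ (Submodule.smul_mem _ _ (varMul_mem_fockFil q _ h))
    (Submodule.smul_mem _ _ (fockFil_mono (Nat.le_succ d) hu))

theorem free_mem_fockFil (p t : Bool) (i : I) (n : ℤ) {d : ℕ} {u : Fock I} (hu : u ∈ fockFil I d) :
    mode (free p t i) n u ∈ fockFil I (d + 1) := by
  rcases n with k | k
  · exact fockFil_mono (Nat.le_succ d) (free_nonneg_mem_fockFil p t i (Int.natCast_nonneg k) d u hu)
  · rw [mode_free_negSucc]
    exact varMul_mem_fockFil p _ hu

theorem mode_quad_vacuum (x y : Bool × Bool × I) (k : ℕ) :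
    mode (quad x y) (Int.negSucc k) fockΩ = ∑ j ∈ Finset.range (k + 1),
      varMul x.1 (mkVar x.2.1 x.2.2 j) (varMul y.1 (mkVar y.2.1 y.2.2 (k - j)) fockΩ) := by
  have h := LocalSpace.circ_eq (X := fockVacuum I) (W := fockLocal I)
    (free_mem x.1 x.2.1 x.2.2) (free_mem y.1 y.2.1 y.2.2) (-1)
  have h' : quad x y = circE (koszul x.1 y.1) (-1) (free x.1 x.2.1 x.2.2) (free y.1 y.2.1 y.2.2) := h
  rw [h', mode_circE_vacuum (fun n hn => mode_free_creative _ _ _ hn),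
    finsum_eq_sum_of_support_subset (s := Finset.range (k + 1))]
  · refine Finset.sum_congr rfl fun j hj => ?_
    have hj' : j ≤ k := by simpa [Nat.lt_succ_iff] using hj
    rw [circCoeff_neg_one, one_smul, ← mode_free_negSucc, ← mode_free_negSucc]
    congr 2
    · simp [Int.negSucc_eq]; ring
    · congr 1
      simp [Int.negSucc_eq, Nat.cast_sub hj']; ring
  · intro j hj
    by_contra hn
    refine hj ?_
    have hn' : k + 1 ≤ j := by simpa using hn
    change _ • _ = _
    rw [mode_free_creative _ _ _ (by rw [Int.negSucc_eq]; omega), map_zero, smul_zero]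

/-- A creation mode of a quadratic field raises the degree by two. Its leading part is
multiplication by the classical quadratic expression, and every contraction lowers the degree below
what the evaluation detects. -/
theorem quad_symbol (hT0 : ∀ n, T (n + 1) fockΩ = 0)
    (hT : ∀ n p v u, T (n + 1) (varMul p v u) = c.val p v * T n u) (x y : Bool × Bool × I) (k : ℕ)
    (d : ℕ) : ∀ u ∈ fockFil I d, mode (quad x y) (Int.negSucc k) u ∈ fockFil I (d + 2) ∧
      T (d + 2) (mode (quad x y) (Int.negSucc k) u) = quadSymbol c x y k * T d u := by
  have hz := coeff_eq_zero_of_mem_fockFil hT0 hT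
  refine wordSpan_exists (fun g : Bool × Var I => varMul g.1 g.2) fockΩ
    (fun d u => mode (quad x y) (Int.negSucc k) u ∈ fockFil I (d + 2) ∧
      T (d + 2) (mode (quad x y) (Int.negSucc k) u) = quadSymbol c x y k * T d u)
    (fun d v w hv hw => by
      rw [map_add, map_add, map_add, mul_add, hv.2, hw.2]
      exact ⟨Submodule.add_mem _ hv.1 hw.1, rfl⟩)
    (fun d r v hv => by
      rw [map_smul, map_smul, map_smul, mul_smul_comm, hv.2]
      exact ⟨Submodule.smul_mem _ r hv.1, rfl⟩) ?_ ?_ ?_ d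
  · rw [mode_quad_vacuum]
    refine ⟨Submodule.sum_mem _ fun j _ => varMul_mem_fockFil _ _ (varMul_mem_fockFil _ _
      (vacuum_mem_wordSpan _ _)), ?_⟩
    rw [map_sum, quadSymbol, Finset.sum_mul]
    refine Finset.sum_congr rfl fun j _ => ?_
    rw [hT, hT, mul_assoc]
  · intro d u hu h
    refine ⟨fockFil_mono (by omega) h.1, ?_⟩
    rw [hz _ _ h.1 _ (by omega), hz _ _ hu _ (by omega), mul_zero]
  · rintro d ⟨q, w⟩ u hu h
    obtain ⟨t', j, l, rfl⟩ := exists_mkVar w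
    -- The contracted terms have degree at most d + 1, so they are invisible in degree d + 3.
    have hx := free_mem_fockFil x.1 x.2.1 x.2.2 (Int.negSucc k + Int.negSucc l) hu
    have hy := free_mem_fockFil y.1 y.2.1 y.2.2 (Int.negSucc k + Int.negSucc l) hu
    change mode (quad x y) (Int.negSucc k) (varMul q (mkVar t' j l) u) ∈ fockFil I (d + 1 + 2) ∧
      T (d + 1 + 2) (mode (quad x y) (Int.negSucc k) (varMul q (mkVar t' j l) u)) =
        quadSymbol c x y k * T (d + 1) (varMul q (mkVar t' j l) u)
    have e := quad_free_apply q t' j x y (Int.negSucc k) (Int.negSucc l) u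
    rw [mode_free_negSucc] at e
    have hr := Submodule.smul_mem _ (koszul q (xor x.1 y.1)) (Submodule.add_mem _
      (Submodule.smul_mem _ (pairing q t' j x.1 x.2.1 x.2.2) hy)
      (Submodule.smul_mem _ (koszul q x.1 * pairing q t' j y.1 y.2.1 y.2.2) hx))
    rw [e]
    refine ⟨Submodule.sub_mem _ (Submodule.smul_mem _ _ (varMul_mem_fockFil _ _ h.1))
      (fockFil_mono (by omega) hr), ?_⟩
    rw [map_sub, hz _ _ hr _ (by omega), sub_zero, map_smul, show d + 1 + 2 = d + 2 + 1 by ring, hT,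
      h.2, hT, ← mul_assoc, quadSymbol_comm, smul_mul_assoc, smul_smul, koszul_mul_self, one_smul,
      mul_assoc]

end Symbols

section KoszulStructure

/-! ### The Koszul complex of currents -/

/-- The creation modes of the currents and the Koszul differential. -/
def currentOps : KoszulOps (Fock Root) (Bool × ℕ) ℕ where
  Ω := fockΩ
  -- The label false stands for the pair (-v^h, K) and true for (v^y, Q). The sign is chosen because
  -- K(0) sends v^h to -K.
  ev := Sum.elim
    (fun o => (if o.1 then (1 : ℂ) else -1) •
      mode (evenCurrent (if o.1 then .y else .h)) (Int.negSucc o.2))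
    (fun k => mode (evenCurrent .x) (Int.negSucc k))
  od o := mode (oddCurrent o.1) (Int.negSucc o.2)
  d := mode K 0

theorem evenCurrent_mem_span_op (i : Root) (k : ℕ) :
    mode (evenCurrent i) (Int.negSucc k) ∈ Submodule.span ℂ (Set.range currentOps.op) := by
  cases i
  · exact Submodule.subset_span ⟨Sum.inl (Sum.inr k), rfl⟩
  · have : currentOps.op (Sum.inl (Sum.inl (true, k))) = mode (evenCurrent .y) (Int.negSucc k) :=
      one_smul ℂ _
    rw [← this]
    exact Submodule.subset_span ⟨_, rfl⟩
  · have : currentOps.op (Sum.inl (Sum.inl (false, k))) =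
      -mode (evenCurrent .h) (Int.negSucc k) := neg_one_smul ℂ _
    rw [← neg_neg (mode (evenCurrent .h) _), ← this]
    exact Submodule.neg_mem _ (Submodule.subset_span ⟨_, rfl⟩)

theorem oddCurrent_mem_span_op (o : Bool) (k : ℕ) :
    mode (oddCurrent o) (Int.negSucc k) ∈ Submodule.span ℂ (Set.range currentOps.op) :=
  Submodule.subset_span ⟨Sum.inr (o, k), rfl⟩

theorem exists_ev_eq (e : (Bool × ℕ) ⊕ ℕ) : ∃ (r : ℂ) (i : Root) (k : ℕ),
    currentOps.ev e = r • mode (evenCurrent i) (Int.negSucc k) := by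
  rcases e with o | k
  · exact ⟨_, _, _, rfl⟩
  · exact ⟨1, .x, k, (one_smul ℂ _).symm⟩

theorem negSucc_add_negSucc (k l : ℕ) : Int.negSucc k + Int.negSucc l = Int.negSucc (k + l + 1) := rfl

/-- Two negative mode indices never add up to 0, so the central term is absent among creation modes
and every bracket of an even generator is a combination of creation modes. The odd modes anticommute
exactly. A bracket with K(0) preserves the mode index, which gives the Koszul relations. -/
theorem currentOps_rel : currentOps.Rel where
  comm e g := by
    obtain ⟨r, i, k, he⟩ := exists_ev_eq e
    have h1 : ∀ j l, mode (evenCurrent i) (Int.negSucc k) * mode (evenCurrent j) (Int.negSucc l) -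
        mode (evenCurrent j) (Int.negSucc l) * mode (evenCurrent i) (Int.negSucc k) ∈
        Submodule.span ℂ (Set.range currentOps.op) := by
      intro j l
      rw [even_even_comm, negSucc_add_negSucc, mode_one, if_neg (by rw [Int.negSucc_eq]; omega),
        smul_zero, add_zero, add_sub_cancel_left]
      exact Submodule.smul_mem _ _ (evenCurrent_mem_span_op _ _)
    rw [he, smul_mul_assoc, mul_smul_comm, ← smul_sub]
    refine Submodule.smul_mem _ _ ?_
    rcases g with e' | o
    · obtain ⟨r', j, l, he'⟩ := exists_ev_eq e'
      change _ * currentOps.ev e' - currentOps.ev e' * _ ∈ _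
      rw [he', smul_mul_assoc, mul_smul_comm, ← smul_sub]
      exact Submodule.smul_mem _ _ (h1 j l)
    · change _ * mode (oddCurrent o.1) (Int.negSucc o.2) - mode (oddCurrent o.1) (Int.negSucc o.2) * _ ∈ _
      rw [even_odd_comm, negSucc_add_negSucc, add_sub_cancel_left]
      exact Submodule.smul_mem _ _ (oddCurrent_mem_span_op _ _)
  anticomm o o' := by
    change mode (oddCurrent o.1) _ * mode (oddCurrent o'.1) _ + mode (oddCurrent o'.1) _ *
      mode (oddCurrent o.1) _ = 0
    rw [odd_odd_comm, neg_add_cancel]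
  d_Ω := creative_of_mem K_mem le_rfl
  d_inl o := by
    obtain ⟨o, k⟩ := o
    cases o
    · change mode K 0 * ((-1 : ℂ) • mode (evenCurrent .h) _) = ((-1 : ℂ) • mode (evenCurrent .h) _) * mode K 0 + mode K _
      rw [mul_smul_comm, K_even_comm, zero_add, koszulBracket, mode_smul, smul_mul_assoc]
      module
    · change mode K 0 * ((1 : ℂ) • mode (evenCurrent .y) _) = ((1 : ℂ) • mode (evenCurrent .y) _) * mode K 0 + mode Q _
      rw [mul_smul_comm, K_even_comm, zero_add, koszulBracket, smul_mul_assoc]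
      module
  d_inr k := by
    change mode K 0 * mode (evenCurrent .x) _ = mode (evenCurrent .x) _ * mode K 0
    rw [K_even_comm, koszulBracket, mode_zero, add_zero]
  d_od o := odd_odd_comm false o.1 0 _

/-- The generators of `𝒟`. -/
theorem D_generators : ({vx, vy, vh, K, Q} : Set WField) =
    Set.range evenCurrent ∪ Set.range oddCurrent := by
  ext u
  constructor
  · rintro (rfl | rfl | rfl | rfl | rfl)
    exacts [Or.inl ⟨.x, rfl⟩, Or.inl ⟨.y, rfl⟩, Or.inl ⟨.h, rfl⟩, Or.inr ⟨false, rfl⟩,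
      Or.inr ⟨true, rfl⟩]
  · rintro (⟨i, rfl⟩ | ⟨o, rfl⟩)
    · cases i <;> simp [evenCurrent]
    · cases o <;> simp [oddCurrent]

/-- The states of `𝒟`. -/
def currentOrbit : Submodule ℂ (Fock Root) := (fockVacuum Root).orbit {vx, vy, vh, K, Q}

/-- Spanning by creation modes: any mode of a current applied to a word is moved to the right until
it reaches the vacuum, and its brackets are modes of currents on shorter words or scalars. No
ordering of the words is needed. -/
theorem mem_currentOrbit_iff {v : Fock Root} :
    v ∈ currentOrbit ↔ ∃ n, v ∈ wordSpan currentOps.op fockΩ n := by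
  have hdir : Directed (· ≤ ·) (wordSpan currentOps.op fockΩ) :=
    (wordSpan_mono currentOps.op fockΩ).directed_le
  set A : Submodule ℂ (Fock Root) := ⨆ n, wordSpan currentOps.op fockΩ n with hA
  have hmem : ∀ v, v ∈ A ↔ ∃ n, v ∈ wordSpan currentOps.op fockΩ n :=
    fun v => Submodule.mem_iSup_of_directed _ hdir
  rw [← hmem]
  have hop : ∀ B ∈ Submodule.span ℂ (Set.range currentOps.op), ∀ w ∈ A, B w ∈ A := by
    intro B hB w hw
    obtain ⟨n, hn⟩ := (hmem w).mp hw
    exact (hmem _).mpr ⟨n + 1, span_op_mem_wordSpan _ _ hB hn⟩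
  -- The statement covers all modes of all currents at once, because the bracket with a new creation
  -- operator is a mode of another current acting on the shorter word.
  have hgen : ∀ n, ∀ w ∈ wordSpan currentOps.op fockΩ n,
      (∀ i m, mode (evenCurrent i) m w ∈ A) ∧ ∀ o m, mode (oddCurrent o) m w ∈ A := by
    have hlow : ∀ n, ∀ w ∈ wordSpan currentOps.op fockΩ n, w ∈ A :=
      fun n w hw => (hmem w).mpr ⟨n, hw⟩
    have hone : ∀ w ∈ A, ∀ (r : ℂ) m, (r • mode one m) w ∈ A := by
      intro w hw r m
      rw [mode_one, LinearMap.smul_apply]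
      refine Submodule.smul_mem _ _ ?_
      split_ifs
      · exact hw
      · exact Submodule.zero_mem _
    refine wordSpan_exists currentOps.op fockΩ
      (fun _ w => (∀ i m, mode (evenCurrent i) m w ∈ A) ∧ ∀ o m, mode (oddCurrent o) m w ∈ A)
      (fun _ v w hv hw => ⟨fun i m => by rw [map_add]; exact A.add_mem (hv.1 i m) (hw.1 i m),
        fun o m => by rw [map_add]; exact A.add_mem (hv.2 o m) (hw.2 o m)⟩)
      (fun _ r v hv => ⟨fun i m => by rw [map_smul]; exact A.smul_mem _ (hv.1 i m),
        fun o m => by rw [map_smul]; exact A.smul_mem _ (hv.2 o m)⟩) ?_ (fun _ _ _ h => h) ?_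
    · have hΩ : fockΩ ∈ A := hlow 0 _ (vacuum_mem_wordSpan _ _)
      refine ⟨fun i m => ?_, fun o m => ?_⟩
      · rcases m with m | m
        · rw [creative_of_mem (evenCurrent_mem i) (n := Int.ofNat m) (Int.natCast_nonneg m)]
          exact A.zero_mem
        · exact hop _ (evenCurrent_mem_span_op i m) _ hΩ
      · rcases m with m | m
        · rw [creative_of_mem (oddCurrent_mem o) (n := Int.ofNat m) (Int.natCast_nonneg m)]
          exact A.zero_mem
        · exact hop _ (oddCurrent_mem_span_op o m) _ hΩ
    · intro n g w hw h
      have hwA := hlow n w hw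
      have hswap : ∀ j l i m, mode (evenCurrent i) m (mode (evenCurrent j) (Int.negSucc l) w) ∈ A := by
        intro j l i m
        rw [← Module.End.mul_apply, even_even_comm]
        exact A.add_mem (A.add_mem (hop _ (evenCurrent_mem_span_op j l) _ (h.1 i m))
          (A.smul_mem _ (h.1 _ _))) (hone w hwA _ _)
      have hswap' : ∀ j l o m, mode (oddCurrent o) m (mode (evenCurrent j) (Int.negSucc l) w) ∈ A := by
        intro j l o m
        have e := LinearMap.congr_fun (even_odd_comm j o (Int.negSucc l) m) w
        rw [LinearMap.add_apply, Module.End.mul_apply, Module.End.mul_apply, ← sub_eq_iff_eq_add] at e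
        rw [← e]
        exact A.sub_mem (hop _ (evenCurrent_mem_span_op j l) _ (h.2 o m)) (A.smul_mem _ (h.2 _ _))
      rcases g with e | ⟨o, l⟩
      · obtain ⟨r, j, l, he⟩ := exists_ev_eq e
        change (∀ i m, mode (evenCurrent i) m (currentOps.ev e w) ∈ A) ∧
          ∀ o m, mode (oddCurrent o) m (currentOps.ev e w) ∈ A
        rw [he]
        exact ⟨fun i m => by rw [LinearMap.smul_apply, map_smul]; exact A.smul_mem _ (hswap j l i m),
          fun o m => by rw [LinearMap.smul_apply, map_smul]; exact A.smul_mem _ (hswap' j l o m)⟩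
      · change (∀ i m, mode (evenCurrent i) m (mode (oddCurrent o) (Int.negSucc l) w) ∈ A) ∧
          ∀ o' m, mode (oddCurrent o') m (mode (oddCurrent o) (Int.negSucc l) w) ∈ A
        refine ⟨fun i m => ?_, fun o' m => ?_⟩
        · rw [← Module.End.mul_apply, even_odd_comm]
          exact A.add_mem (hop _ (oddCurrent_mem_span_op o l) _ (h.1 i m)) (A.smul_mem _ (h.2 _ _))
        · rw [← Module.End.mul_apply, odd_odd_comm]
          exact A.neg_mem (hop _ (oddCurrent_mem_span_op o l) _ (h.2 o' m))
  have hle : A ≤ currentOrbit := by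
    refine iSup_le fun n => ?_
    have hE : ∀ i m, ∀ w ∈ currentOrbit, mode (evenCurrent i) m w ∈ currentOrbit := fun i m w hw =>
      (fockVacuum Root).mode_mem_orbit (by rw [D_generators]; exact Or.inl ⟨i, rfl⟩) m hw
    have hO : ∀ o m, ∀ w ∈ currentOrbit, mode (oddCurrent o) m w ∈ currentOrbit := fun o m w hw =>
      (fockVacuum Root).mode_mem_orbit (by rw [D_generators]; exact Or.inr ⟨o, rfl⟩) m hw
    refine wordSpan_exists currentOps.op fockΩ (fun _ w => w ∈ currentOrbit)
      (fun _ _ _ ha hb => Submodule.add_mem _ ha hb) (fun _ r _ ha => Submodule.smul_mem _ r ha)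
      ((fockVacuum Root).vacuum_mem_orbit _) (fun _ _ _ h => h) ?_ n
    rintro n (e | o) w - hw
    · obtain ⟨r, j, l, he⟩ := exists_ev_eq e
      change currentOps.ev e w ∈ _
      rw [he]
      exact Submodule.smul_mem _ _ (hE _ _ _ hw)
    · exact hO _ _ _ hw
  refine ⟨fun hv => ?_, fun hv => hle hv⟩
  refine (fockVacuum Root).orbit_le (A := A) ((hmem _).mpr ⟨0, vacuum_mem_wordSpan _ _⟩) ?_ hv
  intro s hs m w hw
  obtain ⟨n, hn⟩ := (hmem w).mp hw
  rw [D_generators] at hs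
  rcases hs with ⟨i, rfl⟩ | ⟨o, rfl⟩
  · exact (hgen n w hn).1 i m
  · exact (hgen n w hn).2 o m

end KoszulStructure

/-! ### Independence of the leading symbols of the currents. -/

section Separation

theorem quadSymbol_eq_coeff {I Λ : Type} [Ring Λ] [Algebra ℂ Λ] (c : SuperPoint I Λ)
    (x y : Bool × Bool × I) (k : ℕ) : quadSymbol c x y k =
      PowerSeries.coeff k ((PowerSeries.mk fun k => c.val x.1 (mkVar x.2.1 x.2.2 k)) *
        PowerSeries.mk fun k => c.val y.1 (mkVar y.2.1 y.2.2 k)) := by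
  rw [PowerSeries.coeff_mul, Finset.Nat.sum_antidiagonal_eq_sum_range_succ_mk, quadSymbol]
  simp only [PowerSeries.coeff_mk]

/-- The exterior algebra on the symbols of the odd currents. -/
abbrev OddSymbols : Type := ExteriorAlgebra ℂ (Bool × ℕ →₀ ℂ)

theorem koszul_ι_mul (p q : Bool) (a a' : ℂ) (m m' : Bool × ℕ →₀ ℂ) :
    (bif p then ExteriorAlgebra.ι ℂ m else algebraMap ℂ OddSymbols a) *
      (bif q then ExteriorAlgebra.ι ℂ m' else algebraMap ℂ OddSymbols a') =
    koszul p q • ((bif q then ExteriorAlgebra.ι ℂ m' else algebraMap ℂ OddSymbols a') *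
      (bif p then ExteriorAlgebra.ι ℂ m else algebraMap ℂ OddSymbols a)) := by
  cases p <;> cases q <;> simp only [cond_true, cond_false, koszul, Bool.and_true, Bool.and_false,
    if_true, if_false, Bool.false_eq_true, one_smul, neg_smul]
  · exact Algebra.commutes _ _
  · exact Algebra.commutes _ _
  · exact (Algebra.commutes _ _).symm
  · exact eq_neg_of_add_eq_zero_left (ExteriorAlgebra.ι_add_mul_swap m m')

/-- A point of the Fock space at which the currents take prescribed values. -/
theorem exists_superPoint (z : (Bool × ℕ) ⊕ ℕ → ℂ) (hz : z (Sum.inl (true, 0)) ≠ 0) :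
    ∃ c : SuperPoint Root OddSymbols, ∀ k : ℕ,
      (1 / 2 : ℂ) • (quadSymbol c (false, true, .h) (false, true, .h) k +
        quadSymbol c (false, true, .x) (false, true, .y) k) = algebraMap ℂ _ (z (Sum.inr k)) ∧
      (-1 / 2 : ℂ) • (quadSymbol c (false, false, .h) (false, false, .h) k +
        (4 : ℂ) • quadSymbol c (false, false, .x) (false, false, .y) k) =
          algebraMap ℂ _ (z (Sum.inl (true, k))) ∧
      quadSymbol c (false, false, .h) (false, true, .h) k +
        quadSymbol c (false, false, .x) (false, true, .x) k +
        quadSymbol c (false, false, .y) (false, true, .y) k =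
          -algebraMap ℂ _ (z (Sum.inl (false, k))) ∧
      quadSymbol c (false, true, .h) (true, false, .h) k +
        quadSymbol c (false, true, .x) (true, false, .x) k +
        quadSymbol c (false, true, .y) (true, false, .y) k = oddVar (false, k) ∧
      quadSymbol c (false, false, .h) (true, false, .h) k +
        (2 : ℂ) • quadSymbol c (false, false, .x) (true, false, .y) k +
        (2 : ℂ) • quadSymbol c (false, false, .y) (true, false, .x) k = oddVar (true, k) := by
  -- With β^y = 0 the symbol of v^y is -½ (β^h)², so β^h must be a square root of -2 times the
  -- prescribed series. It exists because the constant term is nonzero.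
  obtain ⟨u, hu, hu0⟩ := exists_sqrt_powerSeries
    (a := PowerSeries.mk fun k => -2 * z (Sum.inl (true, k))) (by
      rw [← PowerSeries.coeff_zero_eq_constantCoeff_apply, PowerSeries.coeff_mk]
      exact mul_ne_zero (by norm_num) hz)
  have hinv : u * u⁻¹ = 1 := PowerSeries.mul_inv_cancel u hu0
  -- With γ^x = 1 and γ^h = 0, the symbol of v^x is ½ γ^y and that of v^h is β^x, so both can be
  -- prescribed freely.
  let ev : Var Root → ℂ
    | Sum.inl (.x, k) => -z (Sum.inl (false, k))
    | Sum.inl (.y, _) => 0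
    | Sum.inl (.h, k) => PowerSeries.coeff k u
    | Sum.inr (.x, k) => PowerSeries.coeff k 1
    | Sum.inr (.y, k) => 2 * z (Sum.inr k)
    | Sum.inr (.h, _) => 0
  -- With b^y = 0 the symbol of K is b^x and that of Q is β^h b^h, so b^h is u⁻¹ times the series of
  -- odd variables belonging to Q.
  let od : Var Root → (Bool × ℕ →₀ ℂ)
    | Sum.inl (.x, k) => Finsupp.single (false, k) 1
    | Sum.inl (.y, _) => 0
    | Sum.inl (.h, k) => ∑ j ∈ Finset.range (k + 1),
        PowerSeries.coeff j u⁻¹ • Finsupp.single (true, k - j) 1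
    | Sum.inr _ => 0
  let c : SuperPoint Root OddSymbols :=
    { val := fun p v => bif p then ExteriorAlgebra.ι ℂ (od v) else algebraMap ℂ OddSymbols (ev v)
      comm := fun p q v w => koszul_ι_mul p q _ _ _ _ }
  let φ := PowerSeries.map (algebraMap ℂ OddSymbols)
  let B : Bool → PowerSeries OddSymbols := fun o => PowerSeries.mk fun k => oddVar (o, k)
  have e1 : (PowerSeries.mk fun k => c.val false (mkVar false .x k)) =
      φ (-PowerSeries.mk fun k => z (Sum.inl (false, k))) := by
    ext k; simp [φ, c, ev, mkVar]
  have e2 : (PowerSeries.mk fun k => c.val false (mkVar false .y k)) = 0 := by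
    ext k; simp [c, ev, mkVar]
  have e3 : (PowerSeries.mk fun k => c.val false (mkVar false .h k)) = φ u := by
    ext k; simp [φ, c, ev, mkVar]
  have e4 : (PowerSeries.mk fun k => c.val false (mkVar true .x k)) = 1 := by
    rw [← map_one φ]
    ext k; simp only [φ, c, ev, mkVar, PowerSeries.coeff_map, PowerSeries.coeff_mk, cond_true, cond_false]
  have e5 : (PowerSeries.mk fun k => c.val false (mkVar true .y k)) =
      φ ((2 : ℂ) • PowerSeries.mk fun k => z (Sum.inr k)) := by
    ext k; simp [φ, c, ev, mkVar]
  have e6 : (PowerSeries.mk fun k => c.val false (mkVar true .h k)) = 0 := by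
    ext k; simp [c, ev, mkVar]
  have e7 : (PowerSeries.mk fun k => c.val true (mkVar false .x k)) = B false := by
    ext k; simp [B, c, od, mkVar, oddVar]
  have e8 : (PowerSeries.mk fun k => c.val true (mkVar false .y k)) = 0 := by
    ext k; simp [c, od, mkVar]
  have e9 : (PowerSeries.mk fun k => c.val true (mkVar false .h k)) = φ u⁻¹ * B true := by
    ext k
    rw [PowerSeries.coeff_mul, Finset.Nat.sum_antidiagonal_eq_sum_range_succ_mk]
    simp only [φ, B, c, od, mkVar, PowerSeries.coeff_map, PowerSeries.coeff_mk, cond_true,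
      cond_false, map_sum, map_smul, oddVar, Algebra.smul_def]
  refine ⟨c, fun k => ?_⟩
  simp only [quadSymbol_eq_coeff, e1, e2, e3, e4, e5, e6, e7, e8, e9, ← mul_assoc, ← map_mul, hu,
    hinv, map_one, one_mul, mul_one, mul_zero, zero_mul, map_zero, add_zero, zero_add, smul_zero]
  refine ⟨?_, ?_, ?_, ?_, ?_⟩
  · simp [φ, Algebra.algebraMap_eq_smul_one, smul_smul]
  · simp [φ, Algebra.algebraMap_eq_smul_one, smul_smul]
    module
  · simp [φ]
  · simp [B]
  · simp [B]

/-- Each current is quadratic, so words of length n have degree at most 2n, and the evaluation in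
degree 2n is the required functional. The distinguished index is the first mode of v^y, whose
nonvanishing allows the square root. -/
theorem currentOps_separated : currentOps.Separated (true, 0) := by
  intro z hz
  obtain ⟨c, hc⟩ := exists_superPoint z hz
  obtain ⟨T, hT, hT0, hT1⟩ := c.exists_coeff
  have hq := fun x y k d u (hu : u ∈ fockFil Root d) => quad_symbol hT0 hT1 x y k d u hu
  have hx : ∀ d u, u ∈ fockFil Root d → ∀ k, mode vx (Int.negSucc k) u ∈ fockFil Root (d + 2) ∧
      T (d + 2) (mode vx (Int.negSucc k) u) = z (Sum.inr k) • T d u := by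
    intro d u hu k
    have h1 := hq (false, true, .h) (false, true, .h) k d u hu
    have h2 := hq (false, true, .x) (false, true, .y) k d u hu
    rw [vx_eq, mode_smul, mode_add, LinearMap.smul_apply, LinearMap.add_apply, map_smul, map_add,
      h1.2, h2.2, ← add_mul, ← smul_mul_assoc, (hc k).1, ← Algebra.smul_def]
    exact ⟨Submodule.smul_mem _ _ (Submodule.add_mem _ h1.1 h2.1), rfl⟩
  have hy : ∀ d u, u ∈ fockFil Root d → ∀ k, mode vy (Int.negSucc k) u ∈ fockFil Root (d + 2) ∧
      T (d + 2) (mode vy (Int.negSucc k) u) = z (Sum.inl (true, k)) • T d u := by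
    intro d u hu k
    have h1 := hq (false, false, .h) (false, false, .h) k d u hu
    have h2 := hq (false, false, .x) (false, false, .y) k d u hu
    rw [vy_eq, mode_smul, mode_add, mode_smul, LinearMap.smul_apply, LinearMap.add_apply,
      LinearMap.smul_apply, map_smul, map_add, map_smul, h1.2, h2.2, ← smul_mul_assoc, ← add_mul,
      ← smul_mul_assoc, (hc k).2.1, ← Algebra.smul_def]
    exact ⟨Submodule.smul_mem _ _ (Submodule.add_mem _ h1.1 (Submodule.smul_mem _ _ h2.1)), rfl⟩
  have hh : ∀ d u, u ∈ fockFil Root d → ∀ k, mode vh (Int.negSucc k) u ∈ fockFil Root (d + 2) ∧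
      T (d + 2) (mode vh (Int.negSucc k) u) = -(z (Sum.inl (false, k)) • T d u) := by
    intro d u hu k
    have h1 := hq (false, false, .h) (false, true, .h) k d u hu
    have h2 := hq (false, false, .x) (false, true, .x) k d u hu
    have h3 := hq (false, false, .y) (false, true, .y) k d u hu
    rw [vh_eq, mode_add, mode_add, LinearMap.add_apply, LinearMap.add_apply, map_add, map_add,
      h1.2, h2.2, h3.2, ← add_mul, ← add_mul, (hc k).2.2.1, neg_mul, ← Algebra.smul_def]
    exact ⟨Submodule.add_mem _ (Submodule.add_mem _ h1.1 h2.1) h3.1, rfl⟩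
  have hK : ∀ d u, u ∈ fockFil Root d → ∀ k, mode K (Int.negSucc k) u ∈ fockFil Root (d + 2) ∧
      T (d + 2) (mode K (Int.negSucc k) u) = oddVar (false, k) * T d u := by
    intro d u hu k
    have h1 := hq (false, true, .h) (true, false, .h) k d u hu
    have h2 := hq (false, true, .x) (true, false, .x) k d u hu
    have h3 := hq (false, true, .y) (true, false, .y) k d u hu
    rw [K_eq, mode_add, mode_add, LinearMap.add_apply, LinearMap.add_apply, map_add, map_add,
      h1.2, h2.2, h3.2, ← add_mul, ← add_mul, (hc k).2.2.2.1]
    exact ⟨Submodule.add_mem _ (Submodule.add_mem _ h1.1 h2.1) h3.1, rfl⟩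
  have hQ : ∀ d u, u ∈ fockFil Root d → ∀ k, mode Q (Int.negSucc k) u ∈ fockFil Root (d + 2) ∧
      T (d + 2) (mode Q (Int.negSucc k) u) = oddVar (true, k) * T d u := by
    intro d u hu k
    have h1 := hq (false, false, .h) (true, false, .h) k d u hu
    have h2 := hq (false, false, .x) (true, false, .y) k d u hu
    have h3 := hq (false, false, .y) (true, false, .x) k d u hu
    rw [Q_eq, mode_add, mode_add, mode_smul, mode_smul, LinearMap.add_apply, LinearMap.add_apply,
      LinearMap.smul_apply, LinearMap.smul_apply, map_add, map_add, map_smul, map_smul,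
      h1.2, h2.2, h3.2, ← smul_mul_assoc, ← smul_mul_assoc, ← add_mul, ← add_mul, (hc k).2.2.2.2]
    exact ⟨Submodule.add_mem _ (Submodule.add_mem _ h1.1 (Submodule.smul_mem _ _ h2.1))
      (Submodule.smul_mem _ _ h3.1), rfl⟩
  have hev : ∀ d u, u ∈ fockFil Root d → ∀ e, currentOps.ev e u ∈ fockFil Root (d + 2) ∧
      T (d + 2) (currentOps.ev e u) = z e • T d u := by
    rintro d u hu (⟨_ | _, k⟩ | k)
    · have e : currentOps.ev (Sum.inl (false, k)) u = -mode vh (Int.negSucc k) u :=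
        neg_one_smul ℂ _
      rw [e, map_neg, (hh d u hu k).2, neg_neg]
      exact ⟨Submodule.neg_mem _ (hh d u hu k).1, rfl⟩
    · have e : currentOps.ev (Sum.inl (true, k)) u = mode vy (Int.negSucc k) u := one_smul ℂ _
      rw [e]
      exact hy d u hu k
    · exact hx d u hu k
  have hod : ∀ d u, u ∈ fockFil Root d → ∀ o, currentOps.od o u ∈ fockFil Root (d + 2) ∧
      T (d + 2) (currentOps.od o u) = oddVar o * T d u := by
    rintro d u hu ⟨_ | _, k⟩
    exacts [hK d u hu k, hQ d u hu k]
  have hfil : ∀ n, ∀ v ∈ wordSpan currentOps.op currentOps.Ω n, v ∈ fockFil Root (2 * n) := by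
    refine wordSpan_exists _ _ (fun n v => v ∈ fockFil Root (2 * n))
      (fun _ _ _ ha hb => Submodule.add_mem _ ha hb) (fun _ r _ ha => Submodule.smul_mem _ r ha)
      (vacuum_mem_wordSpan _ _) (fun n v _ hv => fockFil_mono (by omega) hv) ?_
    rintro n (e | o) v - hv
    · exact (hev _ v hv e).1
    · exact (hod _ v hv o).1
  refine ⟨fun n => T (2 * n), hT, fun n v hv => ?_, fun n e v hv => ?_, fun n o v hv => ?_⟩
  · exact coeff_eq_zero_of_mem_fockFil hT0 hT1 _ v (hfil n v hv) _ (by omega)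
  · exact (hev _ v (hfil n v hv) e).2
  · exact (hod _ v (hfil n v hv) o).2

end Separation

section Grading

/-! ### The grading by `b`-number and the vanishing of cohomology -/

theorem LocalSpace.zero_mode_comm {V : Type} [AddCommGroup V] [Module ℂ V]
    {X : Vacuum V} {W : LocalSpace X} {p q : Bool} {a b : QO V} (ha : a ∈ W.carrier p)
    (hb : b ∈ W.carrier q) (n : ℤ) : mode a 0 * mode b n =
      koszul p q • (mode b n * mode a 0) + mode (circ X.σ 0 a b) n := by
  rw [LocalSpace.circ_eq ha hb, circE_zero, mode_bracketSeq, add_sub_cancel]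

/-- The operator of `b`-number. -/
def bOp : Module.End ℂ (Fock Root) := -mode F 0

theorem bOp_Ω : bOp fockΩ = 0 := by
  rw [bOp, LinearMap.neg_apply, creative_of_mem F_mem le_rfl, neg_zero]

/-- The even currents contain neither b nor c, so F(0) annihilates their states. -/
theorem bOp_even (i : Root) (n : ℤ) :
    bOp * mode (evenCurrent i) n = mode (evenCurrent i) n * bOp := by
  have h0 : mode F 0 fockΩ = 0 := creative_of_mem F_mem le_rfl
  have h : circ (fockVacuum Root).σ 0 F (evenCurrent i) = 0 := by
    refine eq_of_state_eq (LocalSpace.le_total _ _ (LocalSpace.circ_mem F_mem (evenCurrent_mem i) 0))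
      (Submodule.zero_mem _) ((LocalSpace.state_circ F_mem (evenCurrent_mem i) 0).trans ?_)
    cases i <;>
      simp [evenCurrent, state_vx, state_vy, state_vh, F_apply, adF, h0, mode_zero]
  have h1 := LocalSpace.zero_mode_comm F_mem (evenCurrent_mem i) n
  rw [h, mode_zero, add_zero, show koszul false false = 1 from rfl, one_smul] at h1
  rw [bOp, neg_mul, mul_neg, h1]

/-- Each term of K and Q contains exactly one b and no c, so a mode of either raises the b-number by
one. -/
theorem bOp_odd (o : Bool) (n : ℤ) : bOp * mode (oddCurrent o) n =
    mode (oddCurrent o) n * bOp + mode (oddCurrent o) n := by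
  have h0 : mode F 0 fockΩ = 0 := creative_of_mem F_mem le_rfl
  have h : circ (fockVacuum Root).σ 0 F (oddCurrent o) = -oddCurrent o := by
    refine eq_of_state_eq (LocalSpace.le_total _ _ (LocalSpace.circ_mem F_mem (oddCurrent_mem o) 0))
      (Submodule.neg_mem _ (LocalSpace.le_total _ _ (oddCurrent_mem o)))
      ((LocalSpace.state_circ F_mem (oddCurrent_mem o) 0).trans ?_)
    cases o <;>
      simp [oddCurrent, state_K, state_Q, F_apply, adF, h0, mode_zero, mode_neg] <;> abel
  have h1 := LocalSpace.zero_mode_comm F_mem (oddCurrent_mem o) n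
  rw [h, mode_neg, show koszul false true = 1 from rfl, one_smul] at h1
  rw [bOp, neg_mul, mul_neg, h1]
  abel

/-- The part of `b`-number `k` of the states of `𝒟`. -/
def orbitGr (k : ℕ) : Submodule ℂ (Fock Root) :=
  currentOrbit ⊓ Module.End.eigenspace bOp (k : ℂ)

theorem mem_orbitGr {k : ℕ} {v : Fock Root} :
    v ∈ orbitGr k ↔ v ∈ currentOrbit ∧ bOp v = (k : ℂ) • v := by
  rw [orbitGr, Submodule.mem_inf, Module.End.mem_eigenspace_iff]

theorem even_mem_currentOrbit (i : Root) (n : ℤ) {v : Fock Root} (hv : v ∈ currentOrbit) :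
    mode (evenCurrent i) n v ∈ currentOrbit :=
  (fockVacuum Root).mode_mem_orbit (by rw [D_generators]; exact Or.inl ⟨i, rfl⟩) n hv

theorem odd_mem_currentOrbit (o : Bool) (n : ℤ) {v : Fock Root} (hv : v ∈ currentOrbit) :
    mode (oddCurrent o) n v ∈ currentOrbit :=
  (fockVacuum Root).mode_mem_orbit (by rw [D_generators]; exact Or.inr ⟨o, rfl⟩) n hv

theorem even_mem_orbitGr (i : Root) (n : ℤ) {k : ℕ} {v : Fock Root} (hv : v ∈ orbitGr k) :
    mode (evenCurrent i) n v ∈ orbitGr k := by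
  rw [mem_orbitGr] at hv ⊢
  refine ⟨even_mem_currentOrbit i n hv.1, ?_⟩
  rw [← Module.End.mul_apply, bOp_even, Module.End.mul_apply, hv.2, map_smul]

theorem odd_mem_orbitGr (o : Bool) (n : ℤ) {k : ℕ} {v : Fock Root} (hv : v ∈ orbitGr k) :
    mode (oddCurrent o) n v ∈ orbitGr (k + 1) := by
  rw [mem_orbitGr] at hv ⊢
  refine ⟨odd_mem_currentOrbit o n hv.1, ?_⟩
  rw [← Module.End.mul_apply, bOp_odd, LinearMap.add_apply, Module.End.mul_apply, hv.2, map_smul]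
  push_cast
  module

theorem currentOrbit_le_iSup : currentOrbit ≤ ⨆ k, orbitGr k := by
  refine (fockVacuum Root).orbit_le ?_ fun s hs n v hv => ?_
  · refine Submodule.mem_iSup_of_mem 0 (mem_orbitGr.mpr ⟨(fockVacuum Root).vacuum_mem_orbit _, ?_⟩)
    rw [Nat.cast_zero, zero_smul]
    exact bOp_Ω
  · rw [D_generators] at hs
    revert v
    change (⨆ k, orbitGr k) ≤ (⨆ k, orbitGr k).comap (mode s n)
    rcases hs with ⟨i, rfl⟩ | ⟨o, rfl⟩
    · exact iSup_le fun k v hv => Submodule.mem_iSup_of_mem k (even_mem_orbitGr i n hv)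
    · exact iSup_le fun k v hv => Submodule.mem_iSup_of_mem (k + 1) (odd_mem_orbitGr o n hv)

theorem closedWords_le : currentOps.closedWords ≤ orbitGr 0 := by
  refine sInf_le ⟨?_, fun k v hv => even_mem_orbitGr .x _ hv⟩
  refine mem_orbitGr.mpr ⟨(fockVacuum Root).vacuum_mem_orbit _, ?_⟩
  rw [Nat.cast_zero, zero_smul]
  exact bOp_Ω

/-- A primitive up to closed words is projected to its component of b-number k. The closed words
have b-number 0, different from k + 1, and the images of the other components also avoid k + 1, so
independence of the eigenspaces of `bOp` makes the projected primitive exact. -/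
theorem exists_primitive_orbitGr {k : ℕ} {v : Fock Root} (hv : v ∈ orbitGr (k + 1))
    (hd : mode K 0 v = 0) : ∃ w ∈ orbitGr k, mode K 0 w = v := by
  obtain ⟨n, hn⟩ := mem_currentOrbit_iff.mp (mem_orbitGr.mp hv).1
  obtain ⟨w, hw, hc⟩ := currentOps_rel.exists_primitive currentOps_separated hn hd
  have hw' := currentOrbit_le_iSup (mem_currentOrbit_iff.mpr ⟨n, hw⟩)
  rw [iSup_split_single _ k] at hw'
  obtain ⟨w1, hw1, w2, hw2, rfl⟩ := Submodule.mem_sup.mp hw'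
  refine ⟨w1, hw1, ?_⟩
  have hind := Module.End.eigenspaces_iSupIndep bOp ((k + 1 : ℕ) : ℂ)
  have hle : ∀ l : ℕ, l ≠ k + 1 → orbitGr l ≤
      ⨆ (μ : ℂ) (_ : μ ≠ ((k + 1 : ℕ) : ℂ)), Module.End.eigenspace bOp μ := fun l hl =>
    inf_le_right.trans (le_iSup₂_of_le (l : ℂ) (by exact_mod_cast hl) le_rfl)
  have h2 : mode K 0 w2 ∈ ⨆ (μ : ℂ) (_ : μ ≠ ((k + 1 : ℕ) : ℂ)), Module.End.eigenspace bOp μ := by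
    have : (⨆ (l : ℕ) (_ : l ≠ k), orbitGr l) ≤
        (⨆ (μ : ℂ) (_ : μ ≠ ((k + 1 : ℕ) : ℂ)), Module.End.eigenspace bOp μ).comap (mode K 0) :=
      iSup₂_le fun l hl v hv => hle (l + 1) (by omega) (odd_mem_orbitGr false 0 hv)
    exact this hw2
  have h3 : v - mode K 0 w1 ∈
      ⨆ (μ : ℂ) (_ : μ ≠ ((k + 1 : ℕ) : ℂ)), Module.End.eigenspace bOp μ := by
    have h4 := Submodule.add_mem _ (hle 0 (by omega) (closedWords_le hc)) h2
    have e : v - currentOps.d (w1 + w2) + mode K 0 w2 = v - mode K 0 w1 := by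
      change v - mode K 0 (w1 + w2) + mode K 0 w2 = _
      rw [map_add]
      abel
    rwa [e] at h4
  have h5 : v - mode K 0 w1 ∈ Module.End.eigenspace bOp ((k + 1 : ℕ) : ℂ) :=
    Submodule.sub_mem _ hv.2 (odd_mem_orbitGr false 0 hw1).2
  exact (sub_eq_zero.mp (Submodule.disjoint_def.mp hind _ h5 h3)).symm

theorem generators_mem : ∀ s ∈ ({vx, vy, vh, K, Q} : Set WField),
    ∃ p, s ∈ (fockLocal Root).carrier p := by
  rw [D_generators]
  rintro s (⟨i, rfl⟩ | ⟨o, rfl⟩)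
  exacts [⟨_, evenCurrent_mem i⟩, ⟨_, oddCurrent_mem o⟩]

theorem D_le_total : D ≤ (fockLocal Root).total :=
  LocalSpace.generated_le_total (X := fockVacuum Root) fun s hs => by
    obtain ⟨p, hp⟩ := generators_mem s hs
    exact LocalSpace.le_total _ p hp

theorem map_state_D : D.map (fockVacuum Root).state = currentOrbit :=
  LocalSpace.map_state_generated (W := fockLocal Root) generators_mem

theorem state_circ_of_mem {p : Bool} {a u : WField} (ha : a ∈ (fockLocal Root).carrier p)
    (hu : u ∈ (fockLocal Root).total) (n : ℤ) : (fockVacuum Root).state (circLin (parity Root) n a u) =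
      mode a n ((fockVacuum Root).state u) :=
  LocalSpace.state_circ_total (X := fockVacuum Root) ha hu n

theorem circ_mem_of_mem {p : Bool} {a u : WField} (ha : a ∈ (fockLocal Root).carrier p)
    (hu : u ∈ (fockLocal Root).total) (n : ℤ) :
    circLin (parity Root) n a u ∈ (fockLocal Root).total :=
  LocalSpace.circ_mem_total (X := fockVacuum Root) ha hu n

/-- Injectivity of the state map converts the eigenvalue condition on fields into one on states. -/
theorem mem_bNumber_iff {u : WField} (hu : u ∈ (fockLocal Root).total) (k : ℕ) :
    u ∈ bNumber k ↔ bOp ((fockVacuum Root).state u) = (k : ℂ) • (fockVacuum Root).state u := by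
  have e : bOp ((fockVacuum Root).state u) =
      (fockVacuum Root).state (-circLin (parity Root) 0 F u) := by
    rw [map_neg, state_circ_of_mem F_mem hu, bOp, LinearMap.neg_apply]
  rw [bNumber, Module.End.mem_eigenspace_iff, LinearMap.neg_apply, e, ← map_smul]
  exact ⟨fun h => by rw [h], fun h => eq_of_state_eq (Submodule.neg_mem _ (circ_mem_of_mem F_mem hu 0))
    (Submodule.smul_mem _ _ hu) h⟩

theorem mem_Dgr_iff {u : WField} (hu : u ∈ D) (k : ℕ) :
    u ∈ Dgr k ↔ (fockVacuum Root).state u ∈ orbitGr k := by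
  rw [Dgr, Submodule.mem_inf, mem_bNumber_iff (D_le_total hu), mem_orbitGr, ← map_state_D]
  exact ⟨fun h => ⟨⟨u, hu, rfl⟩, h.2⟩, fun h => ⟨hu, h.2⟩⟩

theorem exists_mem_Dgr {k : ℕ} {v : Fock Root} (hv : v ∈ orbitGr k) :
    ∃ u ∈ Dgr k, (fockVacuum Root).state u = v := by
  have h := hv.1
  rw [← map_state_D] at h
  obtain ⟨u, hu, rfl⟩ := h
  exact ⟨u, (mem_Dgr_iff hu k).mpr hv, rfl⟩

theorem K0_mem_D {u : WField} (hu : u ∈ D) : K0 u ∈ D :=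
  circ_mem_generated _ _ (subset_generated _ _ (by simp)) hu 0

theorem state_K0 {u : WField} (hu : u ∈ D) :
    (fockVacuum Root).state (K0 u) = mode K 0 ((fockVacuum Root).state u) :=
  state_circ_of_mem K_mem (D_le_total hu) 0

theorem iSup_Dgr : (⨆ k : ℕ, Dgr k) = D := by
  refine le_antisymm (iSup_le fun k => inf_le_left) fun u hu => ?_
  have hle : (⨆ k, orbitGr k) ≤ (⨆ k, Dgr k).map (fockVacuum Root).state := by
    refine iSup_le fun k v hv => ?_
    obtain ⟨u, hu, rfl⟩ := exists_mem_Dgr hv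
    exact ⟨u, Submodule.mem_iSup_of_mem k hu, rfl⟩
  have h : (fockVacuum Root).state u ∈ currentOrbit := by
    rw [← map_state_D]
    exact ⟨u, hu, rfl⟩
  obtain ⟨u', hu', e⟩ := hle (currentOrbit_le_iSup h)
  have hD : u' ∈ D := (iSup_le fun k => inf_le_left : (⨆ k, Dgr k) ≤ D) hu'
  rwa [← eq_of_state_eq (D_le_total hD) (D_le_total hu) e]

theorem map_K0_le (k : ℕ) : (Dgr k).map K0 ≤ Dgr (k + 1) := by
  rintro _ ⟨u, hu, rfl⟩
  rw [mem_Dgr_iff (K0_mem_D hu.1), state_K0 hu.1]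
  exact odd_mem_orbitGr false 0 ((mem_Dgr_iff hu.1 k).mp hu)

theorem K0_K0 {u : WField} (hu : u ∈ D) : K0 (K0 u) = 0 := by
  refine eq_of_state_eq (D_le_total (K0_mem_D (K0_mem_D hu))) (Submodule.zero_mem _) ?_
  rw [state_K0 (K0_mem_D hu), state_K0 hu, map_zero]
  have h : (fockVacuum Root).state u ∈ currentOrbit := by
    rw [← map_state_D]
    exact ⟨u, hu, rfl⟩
  obtain ⟨n, hn⟩ := mem_currentOrbit_iff.mp h
  exact currentOps_rel.d_d n _ hn

theorem cocycles_le_coboundaries (k : ℕ) : cocycles (k + 1) ≤ coboundaries (k + 1) := by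
  rintro u ⟨hu, hk⟩
  have hs : mode K 0 ((fockVacuum Root).state u) = 0 := by
    rw [← state_K0 hu.1, LinearMap.mem_ker.mp hk, map_zero]
  obtain ⟨w, hw, hwu⟩ := exists_primitive_orbitGr ((mem_Dgr_iff hu.1 _).mp hu) hs
  obtain ⟨u', hu', rfl⟩ := exists_mem_Dgr hw
  refine ⟨u', hu', eq_of_state_eq (D_le_total (K0_mem_D hu'.1)) (D_le_total hu.1) ?_⟩
  rw [state_K0 hu'.1, hwu]

theorem subsingleton_cohomology {k : ℕ} (hk : 0 < k) : Subsingleton (Cohomology k) := by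
  obtain ⟨k, rfl⟩ := Nat.exists_eq_succ_of_ne_zero hk.ne'
  rw [Submodule.Quotient.subsingleton_iff, Submodule.submoduleOf_eq_top]
  exact cocycles_le_coboundaries k

end Grading

section Invariants

/-! ### Invariant polynomials on the jet scheme of the coadjoint representation -/

open MvPolynomial

/-- The polynomial functions in the variables `γ^l_k`. -/
abbrev Jet : Type := MvPolynomial (Root × ℕ) ℂ

/-- The derivation `γ^l_k ↦ ∑ i, M l i • γ^i_{k-n}`. -/
def jetDer (M : Root → Root → ℂ) (n : ℕ) : Derivation ℂ Jet Jet :=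
  mkDerivation ℂ fun v => if n ≤ v.2 then ∑ i, M v.1 i • X (i, v.2 - n) else 0

theorem jetDer_X (M : Root → Root → ℂ) (n : ℕ) (l : Root) (k : ℕ) :
    jetDer M n (X (l, k)) = if n ≤ k then ∑ i, M l i • X (i, k - n) else 0 :=
  mkDerivation_X _ _ _

/-- The generating series of the variables `γ^l_k`. -/
def jetSeries (l : Root) : PowerSeries Jet := PowerSeries.mk fun k => X (l, k)

/-- The coefficients of `½ (h(t)² + x(t) y(t))`. -/
def casimir (k : ℕ) : Jet :=
  PowerSeries.coeff k (PowerSeries.C (C (1 / 2)) *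
    (jetSeries .h * jetSeries .h + jetSeries .x * jetSeries .y))

theorem casimir_eq (k : ℕ) : casimir k = C (1 / 2) * ∑ p ∈ Finset.HasAntidiagonal.antidiagonal k,
    (X (.h, p.1) * X (.h, p.2) + X (.x, p.1) * X (.y, p.2)) := by
  rw [casimir, PowerSeries.coeff_C_mul, map_add, PowerSeries.coeff_mul, PowerSeries.coeff_mul,
    ← Finset.sum_add_distrib]
  simp only [jetSeries, PowerSeries.coeff_mk]

theorem coeff_mul_derivation {A : Type} [CommRing A] [Algebra ℂ A] (d : Derivation ℂ A A)
    (f g : PowerSeries A) (k : ℕ) : d (PowerSeries.coeff k (f * g)) =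
      PowerSeries.coeff k (f * PowerSeries.mk (fun i => d (PowerSeries.coeff i g)) +
        PowerSeries.mk (fun i => d (PowerSeries.coeff i f)) * g) := by
  rw [map_add, PowerSeries.coeff_mul, PowerSeries.coeff_mul, PowerSeries.coeff_mul, map_sum,
    ← Finset.sum_add_distrib]
  refine Finset.sum_congr rfl fun p _ => ?_
  rw [Derivation.leibniz, PowerSeries.coeff_mk, PowerSeries.coeff_mk, smul_eq_mul, smul_eq_mul,
    mul_comm (d _)]

/-- On generating series the derivation is the matrix M followed by multiplication by tⁿ. Invariance
of a quadratic series thus becomes invariance of a quadratic form over the series ring. -/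
theorem mk_jetDer (M : Root → Root → ℂ) (n : ℕ) (l : Root) :
    PowerSeries.mk (fun k => jetDer M n (PowerSeries.coeff k (jetSeries l))) =
      (∑ i, M l i • jetSeries i) * PowerSeries.X ^ n := by
  ext1 k
  rw [PowerSeries.coeff_mk, PowerSeries.coeff_mul_X_pow', jetSeries, PowerSeries.coeff_mk,
    jetDer_X, map_sum]
  simp only [PowerSeries.coeff_smul, jetSeries, PowerSeries.coeff_mk]

/-- The matrix of the coadjoint action of `ξ`. -/
def coadjoint (ξ : Root) (l i : Root) : ℂ := -bracket ξ i l

theorem jetDer_casimir (ξ : Root) (n k : ℕ) : jetDer (coadjoint ξ) n (casimir k) = 0 := by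
  rw [casimir, PowerSeries.coeff_C_mul, ← algebraMap_eq, ← Algebra.smul_def, Derivation.map_smul,
    map_add, map_add, coeff_mul_derivation, coeff_mul_derivation, mk_jetDer, mk_jetDer, mk_jetDer, ← map_add]
  have h : ∀ f : Root → PowerSeries Jet, ∑ i, f i = f .x + (f .y + f .h) := fun f => by
    simp [Finset.sum, Finset.univ, Fintype.elems]
  have key : ∀ g : PowerSeries Jet, g = 0 → (1 / 2 : ℂ) • PowerSeries.coeff k g = 0 := by
    rintro _ rfl
    rw [map_zero, smul_zero]
  refine key _ ?_
  simp only [h]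
  have h2 : algebraMap ℂ (PowerSeries Jet) 2 = 2 := map_ofNat _ 2
  cases ξ <;> simp [coadjoint, bracket, Algebra.smul_def, h2] <;> ring

/-- The substitution `x_k ↦ q_k`, where `q_k` are the coefficients of `½ (h(t)² + x(t) y(t))`. -/
def casimirSubst : Jet →ₐ[ℂ] Jet :=
  aeval fun v => if v.1 = .x then casimir v.2 else X v

/-- The substitution is dominant: where y₀ ≠ 0, the series y(t) is invertible and ½(h² + xy) = s can
be solved for x(t). So values of P are values of its substitution, and P·y₀ would vanish at every
point. -/
theorem casimirSubst_injective : Function.Injective casimirSubst := by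
  rw [injective_iff_map_eq_zero]
  intro P hP
  by_contra hne
  have h1 : P * X (.y, 0) ≠ 0 := mul_ne_zero hne (X_ne_zero _)
  obtain ⟨p, hp⟩ : ∃ p, eval p (P * X (.y, 0)) ≠ 0 := by
    by_contra h
    push Not at h
    exact h1 (MvPolynomial.funext fun x => by rw [h x, map_zero])
  rw [map_mul, eval_X] at hp
  let s : Root → PowerSeries ℂ := fun l => PowerSeries.mk fun k => p (l, k)
  have hy : PowerSeries.constantCoeff (s .y) ≠ 0 := by
    simpa [s] using right_ne_zero_of_mul hp
  let x : PowerSeries ℂ := (2 * s .x - s .h * s .h) * (s .y)⁻¹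
  have hx : PowerSeries.C (1 / 2 : ℂ) * (s .h * s .h + x * s .y) = s .x := by
    have h2 : PowerSeries.C (1 / 2 : ℂ) * 2 = 1 := by
      rw [show (2 : PowerSeries ℂ) = PowerSeries.C 2 from rfl, ← map_mul]
      norm_num
    rw [show x * s .y = 2 * s .x - s .h * s .h by
      simp only [x]; rw [mul_assoc, PowerSeries.inv_mul_cancel _ hy, mul_one],
      add_sub_cancel, ← mul_assoc, h2, one_mul]
  let p' : Root × ℕ → ℂ := fun v => if v.1 = .x then PowerSeries.coeff v.2 x else p v
  have hc : ∀ k, eval p' (casimir k) = p (.x, k) := by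
    intro k
    have h3 := congrArg (PowerSeries.coeff k) hx
    rw [PowerSeries.coeff_C_mul, map_add, PowerSeries.coeff_mul, PowerSeries.coeff_mul,
      ← Finset.sum_add_distrib] at h3
    simp only [s, PowerSeries.coeff_mk] at h3
    rw [casimir_eq, ← h3]
    simp [p']
  have h4 : eval p' (casimirSubst P) = eval p P := by
    have : (aeval p').comp casimirSubst = (aeval p : Jet →ₐ[ℂ] ℂ) := by
      refine MvPolynomial.algHom_ext fun v => ?_
      rw [AlgHom.comp_apply, casimirSubst, aeval_X, aeval_X]
      obtain ⟨l, k⟩ := v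
      split_ifs with hl
      · cases hl
        exact hc k
      · rw [aeval_X]
        exact if_neg hl
    exact DFunLike.congr_fun this P
  rw [hP, map_zero] at h4
  exact left_ne_zero_of_mul hp h4.symm

/-- In the coordinates q, y, h the elements x and h of sl₂ act linearly and fix q, which accounts
for the zero row of the matrix. The element y is excluded since it sends h_k to multiples of the old
coordinates x. -/
theorem jetDer_casimirSubst {ξ : Root} (hξ : ξ ≠ .y) (n : ℕ) (P : Jet) :
    jetDer (coadjoint ξ) n (casimirSubst P) =
      casimirSubst (jetDer (fun l i => if l = .x then 0 else coadjoint ξ l i) n P) := by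
  induction P using MvPolynomial.induction_on with
  | C a => rw [← algebraMap_eq, AlgHom.commutes, Derivation.map_algebraMap,
      Derivation.map_algebraMap, map_zero]
  | add f g hf hg => rw [map_add, map_add, hf, hg, map_add, map_add]
  | mul_X f v hf =>
    obtain ⟨l, k⟩ := v
    rw [map_mul, Derivation.leibniz, hf, Derivation.leibniz, map_add, smul_eq_mul, smul_eq_mul,
      smul_eq_mul, smul_eq_mul, map_mul, map_mul]
    congr 2
    rw [jetDer_X, casimirSubst, aeval_X]
    cases l
    · rw [if_pos rfl, jetDer_casimir]
      simp
    all_goals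
      rw [if_neg (by simp), jetDer_X]
      by_cases hn : n ≤ k
      · have h0 : ∀ f : Root → Jet, ∑ i, f i = f .x + (f .y + f .h) := fun f => by
          simp [Finset.sum, Finset.univ, Fintype.elems]
        rw [if_pos hn, if_pos hn, h0, h0]
        cases ξ <;> simp [coadjoint, bracket] at hξ ⊢
      · rw [if_neg hn, if_neg hn, map_zero]

/-- After inverting y₀ the variables x_k are expressed through q, y, h: the coefficient q_k contains
y₀ x_k, and its other terms involve only h, y and x of smaller index. -/
theorem exists_pow_mul_eq_casimirSubst (f : Jet) :
    ∃ (N : ℕ) (P : Jet), X (.y, 0) ^ N * f = casimirSubst P := by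
  let S : Subalgebra ℂ Jet :=
    { carrier := {f | ∃ (N : ℕ) (P : Jet), X (.y, 0) ^ N * f = casimirSubst P}
      mul_mem' := by
        rintro f g ⟨N, P, hP⟩ ⟨M, R, hR⟩
        exact ⟨N + M, P * R, by rw [map_mul, ← hP, ← hR]; ring⟩
      add_mem' := by
        rintro f g ⟨N, P, hP⟩ ⟨M, R, hR⟩
        refine ⟨N + M, X (.y, 0) ^ M * P + X (.y, 0) ^ N * R, ?_⟩
        rw [map_add, map_mul, map_mul, ← hP, ← hR, map_pow, map_pow, casimirSubst, aeval_X,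
          if_neg (by simp)]
        ring
      algebraMap_mem' := fun r => ⟨0, algebraMap ℂ Jet r, by simp⟩ }
  have hdiv : ∀ f, X (.y, 0) * f ∈ S → f ∈ S := by
    rintro f ⟨N, P, hP⟩
    exact ⟨N + 1, P, by rw [← hP]; ring⟩
  have hq : ∀ k, casimir k ∈ S := fun k => ⟨0, X (.x, k), by simp [casimirSubst]⟩
  have hv : ∀ l k, l ≠ .x → (X (l, k) : Jet) ∈ S := fun l k hl =>
    ⟨0, X (l, k), by simp [casimirSubst, hl]⟩
  have hx : ∀ k, (X (.x, k) : Jet) ∈ S := by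
    intro k
    induction k using Nat.strong_induction_on with
    | _ k ih =>
      apply hdiv
      -- Here 2q_k is solved for its term with x-index k; erasing (k, 0) from the antidiagonal
      -- leaves only smaller x-indices.
      have h : X (.y, 0) * X (.x, k) = (2 : ℂ) • casimir k -
          ∑ p ∈ Finset.HasAntidiagonal.antidiagonal k, X (.h, p.1) * X (.h, p.2) -
          ∑ p ∈ (Finset.HasAntidiagonal.antidiagonal k).erase (k, 0), X (.x, p.1) * X (.y, p.2) := by
        rw [casimir_eq, Finset.sum_add_distrib, ← Finset.add_sum_erase (Finset.HasAntidiagonal.antidiagonal k)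
          (fun p => (X (Root.x, p.1) * X (Root.y, p.2) : Jet)) (show (k, 0) ∈ _ by simp),
          ← algebraMap_eq, ← Algebra.smul_def, smul_smul]
        norm_num
        ring
      rw [h]
      refine sub_mem (sub_mem (S.smul_mem (hq k) _) (sum_mem fun p _ =>
        mul_mem (hv _ _ (by simp)) (hv _ _ (by simp)))) (sum_mem fun p hp => ?_)
      rw [Finset.mem_erase, Finset.HasAntidiagonal.mem_antidiagonal] at hp
      refine mul_mem (ih _ ?_) (hv _ _ (by simp))
      have : p.2 ≠ 0 := fun h0 => hp.1 (Prod.ext (by simp; omega) h0)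
      omega
  have htop : S = ⊤ := by
    rw [← top_le_iff, ← MvPolynomial.adjoin_range_X, Algebra.adjoin_le_iff]
    rintro _ ⟨⟨l, k⟩, rfl⟩
    cases l
    exacts [hx k, hv _ k (by simp), hv _ k (by simp)]
  have hf : f ∈ S := by
    rw [htop]
    exact Algebra.mem_top
  exact hf

theorem notMem_vars_of_pderiv_eq_zero {σ : Type} {P : MvPolynomial σ ℂ} {v : σ}
    (h : pderiv v P = 0) : v ∉ P.vars := by
  classical
  rw [mem_vars_iff_mem_support]
  rintro ⟨d, hd, hv⟩
  have h1 := coeff_pderiv (i := v) P (d - Finsupp.single v 1)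
  have hd' : d - Finsupp.single v 1 + Finsupp.single v 1 = d :=
    tsub_add_cancel_of_le (by
      rw [Finsupp.single_le_iff]
      exact Nat.one_le_iff_ne_zero.mpr (Finsupp.mem_support_iff.mp hv))
  rw [h, coeff_zero, hd'] at h1
  rcases mul_eq_zero.mp h1.symm with h2 | h2
  · exact mem_support_iff.mp hd h2
  · exact Nat.cast_add_one_ne_zero _ h2

/-- Let m be the largest index with a_m in P. The derivation with shift m kills every a_k with k < m
and sends a_m to c·y₀, so on P it equals c·y₀ ∂/∂a_m. Its vanishing shows that a_m does not occur.
-/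
theorem notMem_vars_of_jetDer_eq_zero {M : Root → Root → ℂ} {a : Root} {c : ℂ} (hc : c ≠ 0)
    (hM : ∀ l i, M l i = if l = a ∧ i = .y then c else 0) {s : ℕ} {P : Jet}
    (hP : ∀ n, s ≤ n → jetDer M n P = 0) (k : ℕ) (hk : s ≤ k) : (a, k) ∉ P.vars := by
  intro hmem
  obtain ⟨m, hm, hmax⟩ : ∃ m, (s ≤ m ∧ (a, m) ∈ P.vars) ∧ ∀ k, s ≤ k ∧ (a, k) ∈ P.vars → k ≤ m := by
    have hfin : {k | s ≤ k ∧ (a, k) ∈ P.vars}.Finite :=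
      (P.vars.finite_toSet.preimage (f := fun k => (a, k)) fun _ _ _ _ h => by simpa using h).subset
        fun k hk => hk.2
    obtain ⟨m, hm⟩ := hfin.exists_maximal ⟨k, hk, hmem⟩
    exact ⟨m, hm.1, fun k hk => (le_total k m).elim id fun h => hm.2 hk h⟩
  have h1 : jetDer M m P = (c • (X (.y, 0) : Jet) • pderiv (a, m) : Derivation ℂ Jet Jet) P := by
    refine derivation_eq_of_forall_mem_vars fun v hv => ?_
    obtain ⟨l, k⟩ := v
    rw [jetDer_X, Derivation.smul_apply, Derivation.smul_apply]
    simp only [hM]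
    rcases eq_or_ne l a with rfl | hl
    · split_ifs with hmk
      · have : k = m := by
          refine le_antisymm (hmax k ⟨?_, hv⟩) hmk
          omega
        subst this
        simp
      · rw [pderiv_X_of_ne (by simp; omega), smul_zero, smul_zero]
    · rw [pderiv_X_of_ne (by simp [hl])]
      simp [hl]
  rw [hP m hm.1, Derivation.smul_apply, Derivation.smul_apply, smul_eq_mul, eq_comm,
    smul_eq_zero_iff_right hc, mul_eq_zero] at h1
  exact notMem_vars_of_pderiv_eq_zero (h1.resolve_left (X_ne_zero _)) hm.2

theorem coeff_X_mul_pderiv {σ : Type} (v : σ) (P : MvPolynomial σ ℂ) (d : σ →₀ ℕ) :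
    coeff d (X v * pderiv v P) = d v * coeff d P := by
  classical
  induction P using MvPolynomial.induction_on' with
  | monomial m r =>
    rw [X_mul_pderiv_monomial, coeff_smul, coeff_monomial]
    split_ifs with h
    · rw [h, nsmul_eq_mul]
    · simp
  | add f g hf hg => rw [map_add, mul_add, coeff_add, hf, hg, coeff_add, mul_add]

/-- When only the x_k and y₀ occur, and y₀ with exponent N in every monomial, the power of y₀
factors out and the rest is a polynomial in the q_k. -/
theorem casimirSubst_eq_pow_mul {P : Jet} {N : ℕ}
    (hP : ∀ d ∈ P.support, d (.y, 0) = N ∧ ∀ l k, d (l, k) ≠ 0 → l = .x ∨ (l, k) = (.y, 0)) :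
    ∃ p : MvPolynomial ℕ ℂ, casimirSubst P = X (.y, 0) ^ N * aeval casimir p := by
  let ρ : Jet →ₐ[ℂ] MvPolynomial ℕ ℂ := aeval fun v => if v.1 = .x then X v.2 else 1
  refine ⟨ρ P, ?_⟩
  have hρ : (aeval casimir).comp ρ =
      (aeval fun v => if v.1 = .x then casimir v.2 else 1 : Jet →ₐ[ℂ] Jet) := by
    refine MvPolynomial.algHom_ext fun v => ?_
    rw [AlgHom.comp_apply, aeval_X, aeval_X]
    split_ifs <;> simp
  rw [← AlgHom.comp_apply, hρ]
  conv_lhs => rw [P.as_sum]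
  conv_rhs => rw [P.as_sum]
  rw [map_sum, map_sum, Finset.mul_sum]
  refine Finset.sum_congr rfl fun d hd => ?_
  rw [casimirSubst, aeval_monomial, aeval_monomial, mul_left_comm]
  congr 1
  obtain ⟨hN, hx⟩ := hP d hd
  have h1 : (d.prod fun v e => (if v.1 = .x then casimir v.2 else X v : Jet) ^ e) =
      (d.prod fun v e => if v = (.y, 0) then (X (.y, 0) : Jet) ^ e else 1) *
        d.prod fun v e => (if v.1 = .x then casimir v.2 else 1 : Jet) ^ e := by
    rw [Finsupp.prod, Finsupp.prod, Finsupp.prod, ← Finset.prod_mul_distrib]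
    refine Finset.prod_congr rfl fun v hv => ?_
    obtain ⟨l, k⟩ := v
    rcases hx l k (Finsupp.mem_support_iff.mp hv) with rfl | h
    · simp
    · obtain ⟨rfl, rfl⟩ := Prod.ext_iff.mp h
      simp
  rw [h1, Finsupp.prod, Finset.prod_ite_eq']
  congr 1
  split_ifs with h
  · rw [hN]
  · rw [Finsupp.notMem_support_iff, hN] at h
    rw [h, pow_zero]

/-- Write y₀^N f as a substituted polynomial P. Invariance under xtⁿ removes all h_k from P,
invariance under htⁿ with n ≥ 1 removes y_k with k ≥ 1, and the weight under h fixes the exponent of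
y₀ to be N. Cancelling y₀^N finishes. The element y is not needed: Borel invariants suffice. -/
theorem exists_aeval_casimir {f : Jet} (hf : ∀ ξ n, jetDer (coadjoint ξ) n f = 0) :
    ∃ p : MvPolynomial ℕ ℂ, aeval casimir p = f := by
  obtain ⟨N, P, hP⟩ := exists_pow_mul_eq_casimirSubst f
  -- Since f is invariant, a derivation acts on y₀^N f only through y₀. This vanishes for ξ = x, and
  -- for ξ = h with n ≥ 1.
  have hd : ∀ ξ n, jetDer (coadjoint ξ) n (casimirSubst P) =
      ((N : Jet) * X (Root.y, 0) ^ (N - 1) * jetDer (coadjoint ξ) n (X (.y, 0))) * f := by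
    intro ξ n
    rw [← hP, Derivation.leibniz, hf, smul_zero, zero_add, Derivation.leibniz_pow]
    simp only [smul_eq_mul, nsmul_eq_mul]
    ring
  have h0 : ∀ f : Root → Jet, ∑ i, f i = f .x + (f .y + f .h) := fun f => by
    simp [Finset.sum, Finset.univ, Fintype.elems]
  have hh : ∀ k, (.h, k) ∉ P.vars := fun k => by
    refine notMem_vars_of_jetDer_eq_zero (M := fun l i => if l = .x then 0 else coadjoint .x l i)
      (c := -1) (by norm_num) (s := 0) ?_ (fun n _ => ?_) k (Nat.zero_le k)
    · intro l i
      cases l <;> cases i <;> simp [coadjoint, bracket]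
    · apply casimirSubst_injective
      rw [← jetDer_casimirSubst (by simp), hd, jetDer_X, h0, map_zero]
      simp [coadjoint, bracket]
  have hM : ∀ l i, (if l = .x then 0 else coadjoint .h l i) =
      if l = .y ∧ i = .y then (2 : ℂ) else 0 := by
    intro l i
    cases l <;> cases i <;> simp [coadjoint, bracket]
  -- The bound s = 1 is essential: h itself scales y₀, so the shift n = 0 gives no vanishing.
  have hy : ∀ k, 1 ≤ k → (.y, k) ∉ P.vars := fun k hk => by
    refine notMem_vars_of_jetDer_eq_zero (M := fun l i => if l = .x then 0 else coadjoint .h l i)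
      (c := 2) (by norm_num) (s := 1) hM (fun n hn => ?_) k hk
    apply casimirSubst_injective
    rw [← jetDer_casimirSubst (by simp), hd, jetDer_X, if_neg (by omega), map_zero]
    simp
  have hv : ∀ l k, (l, k) ∈ P.vars → l = .x ∨ (l, k) = (.y, 0) := by
    intro l k hk
    cases l
    · exact Or.inl rfl
    · refine Or.inr ?_
      by_contra h
      exact hy k (Nat.one_le_iff_ne_zero.mpr fun h0 => h (by rw [h0])) hk
    · exact absurd hk (hh k)
  -- Euler's identity for the scaling of y₀: the weight of y₀^N f under h is 2N.
  have hN : (2 : ℂ) • (X (.y, 0) * pderiv (.y, 0) P) = (2 * N : ℂ) • P := by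
    have h1 : jetDer (fun l i => if l = .x then 0 else coadjoint .h l i) 0 P =
        ((2 : ℂ) • (X (.y, 0) : Jet) • pderiv (.y, 0) : Derivation ℂ Jet Jet) P := by
      refine derivation_eq_of_forall_mem_vars fun v hv' => ?_
      obtain ⟨l, k⟩ := v
      rw [jetDer_X, Derivation.smul_apply, Derivation.smul_apply]
      simp only [hM]
      rcases hv l k hv' with rfl | h
      · rw [pderiv_X_of_ne (by simp)]
        simp
      · cases h
        simp
    rw [Derivation.smul_apply, Derivation.smul_apply, smul_eq_mul] at h1
    rw [← h1]
    apply casimirSubst_injective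
    rw [← jetDer_casimirSubst (by simp), hd, jetDer_X, h0, map_smul, ← hP, Algebra.smul_def]
    rcases N with _ | N
    · simp
    · simp [coadjoint, bracket, Algebra.smul_def]
      ring
  obtain ⟨p, hp⟩ := casimirSubst_eq_pow_mul (P := P) (N := N) fun d hd => by
    constructor
    · have h1 := congrArg (coeff d) hN
      rw [coeff_smul, coeff_smul, coeff_X_mul_pderiv, smul_eq_mul, smul_eq_mul, ← mul_assoc] at h1
      have h2 := mul_right_cancel₀ (mem_support_iff.mp hd) h1
      exact_mod_cast mul_left_cancel₀ (two_ne_zero) h2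
    · intro l k hlk
      exact hv l k ((mem_vars_iff_mem_support _).mpr ⟨d, hd, Finsupp.mem_support_iff.mpr hlk⟩)
  refine ⟨p, (mul_left_cancel₀ (pow_ne_zero N (X_ne_zero _)) (hP.trans hp)).symm⟩

/-- The q_k are the images of the x_k under the injective substitution, so they are algebraically
independent. -/
theorem aeval_casimir_injective :
    Function.Injective (aeval casimir : MvPolynomial ℕ ℂ →ₐ[ℂ] Jet) := by
  have h : (aeval casimir : MvPolynomial ℕ ℂ →ₐ[ℂ] Jet) =
      casimirSubst.comp (rename fun k => (Root.x, k)) := by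
    refine MvPolynomial.algHom_ext fun k => ?_
    simp [casimirSubst]
  rw [h]
  exact casimirSubst_injective.comp (rename_injective _ fun _ _ h => by simpa using h)

theorem jetDer_aeval_casimir (ξ : Root) (n : ℕ) (p : MvPolynomial ℕ ℂ) :
    jetDer (coadjoint ξ) n (aeval casimir p) = 0 := by
  induction p using MvPolynomial.induction_on with
  | C a => rw [← algebraMap_eq, AlgHom.commutes, Derivation.map_algebraMap]
  | add f g hf hg => rw [map_add, map_add, hf, hg, add_zero]
  | mul_X f k hf => rw [map_mul, Derivation.leibniz, hf, aeval_X, jetDer_casimir, smul_zero,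
      smul_zero, add_zero]

end Invariants

section GammaAlgebra

/-! ### The algebra `⟨γ⟩` -/

open MvPolynomial

/-- The state of a polynomial in the variables `γ^l_k`. -/
def jetState : Jet →ₗ[ℂ] Fock Root :=
  (Fock.equiv Root).symm.toLinearMap ∘ₗ (TensorProduct.mk ℂ (Bos Root) (Fer Root)).flip 1 ∘ₗ
    (rename Sum.inr : Jet →ₐ[ℂ] Bos Root).toLinearMap

theorem jetState_apply (f : Jet) : jetState f =
    (Fock.equiv Root).symm (rename Sum.inr f ⊗ₜ[ℂ] (1 : Fer Root)) := rfl

theorem jetState_one : jetState 1 = fockΩ := by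
  rw [jetState_apply, map_one]
  rfl

theorem jetState_injective : Function.Injective jetState := by
  have h : Function.Injective fun f : Bos Root => f ⊗ₜ[ℂ] (1 : Fer Root) := by
    refine Function.LeftInverse.injective (g := fun z => TensorProduct.rid ℂ (Bos Root)
      (LinearMap.lTensor (Bos Root) (ExteriorAlgebra.algebraMapInv
        (R := ℂ) (M := Var Root →₀ ℂ)).toLinearMap z)) fun f => ?_
    simp
  exact (Fock.equiv Root).symm.injective.comp (h.comp (rename_injective _ Sum.inr_injective))

theorem gamma_jetState_negSucc (l : Root) (k : ℕ) (f : Jet) :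
    mode (gamma l) (Int.negSucc k) (jetState f) = jetState (X (l, k) * f) := by
  rw [show gamma l = free false true l from rfl, mode_free_negSucc, jetState_apply, jetState_apply,
    map_mul, rename_X]
  rfl

theorem gamma_jetState_natCast (l : Root) (k : ℕ) (f : Jet) :
    mode (gamma l) (Int.ofNat k) (jetState f) = 0 := by
  rw [show gamma l = free false true l from rfl, mode_free_natCast, LinearMap.smul_apply]
  have h : (pderiv (Sum.inl (l, k)) (rename Sum.inr f) : Bos Root) = 0 := by
    refine pderiv_eq_zero_of_notMem_vars fun hv => ?_
    classical
    have := vars_rename Sum.inr f hv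
    simp at this
  have h' : varDer false (mkVar (!true) l k) (jetState f) = (Fock.equiv Root).symm
      ((pderiv (Sum.inl (l, k)) (rename Sum.inr f) : Bos Root) ⊗ₜ[ℂ] (1 : Fer Root)) := rfl
  rw [h', h, TensorProduct.zero_tmul, map_zero, smul_zero]

/-- The bc part of Θ does not contract with γ, and the βγ part contracts once. The sign of the
resulting matrix makes the action coadjoint. -/
theorem Theta_gamma (ξ l : Root) (m n : ℤ) (v : Fock Root) :
    mode (Theta ξ) m (mode (gamma l) n v) = mode (gamma l) n (mode (Theta ξ) m v) +
      ∑ i, coadjoint ξ l i • mode (gamma i) (m + n) v := by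
  have hq : ∀ i j, mode (quad (true, false, j) (true, true, i) -
      quad (false, false, j) (false, true, i)) m (mode (gamma l) n v) =
      mode (gamma l) n (mode (quad (true, false, j) (true, true, i) -
        quad (false, false, j) (false, true, i)) m v) -
      (if j = l then (1 : ℂ) else 0) • mode (gamma i) (m + n) v := by
    intro i j
    rw [mode_sub, LinearMap.sub_apply, LinearMap.sub_apply, map_sub,
      show gamma l = free false true l from rfl, quad_free_apply, quad_free_apply]
    simp only [pairing, freeSign, koszul, free]
    by_cases h : j = l
    · subst h
      simp
      abel
    · simp [h, Ne.symm h]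
  rw [Theta_eq]
  simp only [mode_sum, mode_smul, LinearMap.sum_apply, LinearMap.smul_apply, hq, map_sum, map_smul]
  rw [← Finset.sum_add_distrib]
  refine Finset.sum_congr rfl fun i _ => ?_
  simp only [smul_sub, Finset.sum_sub_distrib, ite_smul, one_smul, zero_smul, smul_ite, smul_zero,
    Finset.sum_ite_eq', Finset.mem_univ, if_true, coadjoint, neg_smul]
  exact sub_eq_add_neg _ _

/-- A nonnegative mode of Θ kills the vacuum and acts on creation modes of γ by the coadjoint matrix
with shifted index, hence as a derivation. Modes shifted into the annihilation range vanish,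
matching the condition n ≤ k in `jetDer`. -/
theorem Theta_jetState (ξ : Root) (n : ℕ) (f : Jet) :
    mode (Theta ξ) n (jetState f) = jetState (jetDer (coadjoint ξ) n f) := by
  induction f using MvPolynomial.induction_on with
  | C a => rw [← algebraMap_eq, Derivation.map_algebraMap, Algebra.algebraMap_eq_smul_one, map_smul,
      map_smul, jetState_one, creative_of_mem (Theta_mem ξ) (by omega), smul_zero, map_zero]
  | add f g hf hg => rw [map_add, map_add, hf, hg, map_add, map_add]
  | mul_X f v hf =>
    obtain ⟨l, k⟩ := v
    rw [mul_comm, ← gamma_jetState_negSucc, Theta_gamma, hf, gamma_jetState_negSucc,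
      Derivation.leibniz, map_add, smul_eq_mul, smul_eq_mul, jetDer_X, add_right_inj]
    split_ifs with hn
    · rw [show (n : ℤ) + Int.negSucc k = Int.negSucc (k - n) by omega, Finset.mul_sum, map_sum]
      refine Finset.sum_congr rfl fun i _ => ?_
      rw [gamma_jetState_negSucc, mul_smul_comm, map_smul, mul_comm f]
    · rw [show (n : ℤ) + Int.negSucc k = Int.ofNat (n - k - 1) by
        rw [Int.ofNat_eq_natCast]; omega, mul_zero, map_zero]
      exact Finset.sum_eq_zero fun i _ => by rw [gamma_jetState_natCast, smul_zero]

theorem range_gamma_mem : ∀ s ∈ Set.range (gamma (I := Root)),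
    ∃ p, s ∈ (fockLocal Root).carrier p := by
  rintro _ ⟨l, rfl⟩
  exact ⟨false, free_mem false true l⟩

theorem gammaAlg_le_carrier : gammaAlg ≤ (fockLocal Root).carrier false := by
  refine generated_le _ _ (fockLocal Root).one_mem ?_ fun a ha b hb n =>
    LocalSpace.circ_mem (X := fockVacuum Root) ha hb n
  rintro _ ⟨l, rfl⟩
  exact free_mem false true l

theorem gammaAlg_le_total : gammaAlg ≤ (fockLocal Root).total :=
  gammaAlg_le_carrier.trans (LocalSpace.le_total _ _)

theorem map_state_gammaAlg : gammaAlg.map (fockVacuum Root).state = LinearMap.range jetState := by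
  refine (LocalSpace.map_state_generated (W := fockLocal Root) range_gamma_mem).trans ?_
  refine le_antisymm ((fockVacuum Root).orbit_le ⟨1, jetState_one⟩ ?_) ?_
  · rintro _ ⟨l, rfl⟩ (k | k) _ ⟨f, rfl⟩
    · rw [gamma_jetState_natCast]
      exact Submodule.zero_mem _
    · exact ⟨_, (gamma_jetState_negSucc l k f).symm⟩
  · rintro _ ⟨f, rfl⟩
    induction f using MvPolynomial.induction_on with
    | C a =>
      rw [← algebraMap_eq, Algebra.algebraMap_eq_smul_one, map_smul, jetState_one]
      exact Submodule.smul_mem _ _ ((fockVacuum Root).vacuum_mem_orbit _)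
    | add f g hf hg => rw [map_add]; exact Submodule.add_mem _ hf hg
    | mul_X f v hf =>
      rw [mul_comm, ← gamma_jetState_negSucc]
      exact (fockVacuum Root).mode_mem_orbit (Set.mem_range_self _) _ hf

theorem exists_state_eq_jetState {u : WField} (hu : u ∈ gammaAlg) :
    ∃ f, (fockVacuum Root).state u = jetState f := by
  have h : (fockVacuum Root).state u ∈ LinearMap.range jetState :=
    map_state_gammaAlg ▸ Submodule.mem_map_of_mem hu
  obtain ⟨f, hf⟩ := h
  exact ⟨f, hf.symm⟩

theorem exists_mem_gammaAlg (f : Jet) : ∃ u ∈ gammaAlg, (fockVacuum Root).state u = jetState f := by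
  have h : jetState f ∈ gammaAlg.map (fockVacuum Root).state :=
    map_state_gammaAlg ▸ LinearMap.mem_range_self _ f
  exact h

/-- All nonnegative modes of γ annihilate states of ⟨γ⟩, since a γ contracts only with a β. So all
products of γ with u are regular. -/
theorem mode_gamma_comm {u : WField} (hu : u ∈ gammaAlg) (l : Root) (m n : ℤ) :
    mode (gamma l) m * mode u n = mode u n * mode (gamma l) m := by
  have hc := gammaAlg_le_carrier hu
  obtain ⟨f, hf⟩ := exists_state_eq_jetState hu
  have h : ∀ k : ℕ, circ (fockVacuum Root).σ k (gamma l) u = 0 := fun k => by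
    refine eq_of_state_eq (LocalSpace.le_total _ _ (LocalSpace.circ_mem (free_mem false true l) hc k))
      (Submodule.zero_mem _) ((LocalSpace.state_circ (free_mem false true l) hc k).trans ?_)
    rw [hf, map_zero]
    exact gamma_jetState_natCast l k f
  have h2 := LocalSpace.commutator_of_circ_eq_zero (free_mem false true l) hc
    (fun j => h (j + 2)) m n
  rw [show circ (fockVacuum Root).σ 0 (free false true l) u = 0 from h 0,
    show circ (fockVacuum Root).σ 1 (free false true l) u = 0 from h 1, mode_zero, mode_zero,
    smul_zero, add_zero, add_zero, show koszul false false = 1 from rfl, one_smul] at h2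
  exact h2

/-- A mode of u commutes with the creation modes of γ, so on the states of ⟨γ⟩ it is multiplication
by its value on the vacuum. In particular the Wick product becomes polynomial multiplication. -/
theorem mode_jetState {u : WField} (hu : u ∈ gammaAlg) {n : ℤ} {f : Jet}
    (hf : mode u n fockΩ = jetState f) (g : Jet) :
    mode u n (jetState g) = jetState (f * g) := by
  induction g using MvPolynomial.induction_on with
  | C a => rw [← algebraMap_eq, Algebra.algebraMap_eq_smul_one, map_smul, map_smul, jetState_one, hf,
      mul_smul_comm, mul_one, map_smul]
  | add g g' hg hg' => rw [map_add, map_add, hg, hg', mul_add, map_add]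
  | mul_X g v hg => rw [mul_comm g, ← gamma_jetState_negSucc, ← Module.End.mul_apply,
      ← mode_gamma_comm hu, Module.End.mul_apply, hg, gamma_jetState_negSucc, mul_left_comm]

theorem wick_mem_gammaAlg {u w : WField} (hu : u ∈ gammaAlg) (hw : w ∈ gammaAlg) :
    wickW u w ∈ gammaAlg := circ_mem_generated _ _ hu hw (-1)

theorem state_wick {u w : WField} (hu : u ∈ gammaAlg) (hw : w ∈ gammaAlg) {f g : Jet}
    (hf : (fockVacuum Root).state u = jetState f) (hg : (fockVacuum Root).state w = jetState g) :
    (fockVacuum Root).state (wickW u w) = jetState (f * g) := by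
  rw [← mode_jetState hu hf, ← hg]
  exact LocalSpace.state_circ (gammaAlg_le_carrier hu) (gammaAlg_le_carrier hw) (-1)

/-- Under the state map, Θ acts by the coadjoint derivations, whose common kernel in the polynomial
ring is generated by the q_k. -/
theorem mem_gammaInv_iff {u : WField} (hu : u ∈ gammaAlg) :
    u ∈ gammaInv ↔ ∃ p : MvPolynomial ℕ ℂ, (fockVacuum Root).state u = jetState (aeval casimir p) := by
  obtain ⟨f, hf⟩ := exists_state_eq_jetState hu
  have h : u ∈ gammaInv ↔ ∀ ξ n, jetDer (coadjoint ξ) n f = 0 := by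
    rw [gammaInv, Submodule.mem_inf]
    simp only [Submodule.mem_iInf, LinearMap.mem_ker]
    refine ⟨fun h ξ n => jetState_injective ?_, fun h => ⟨hu, fun ξ n => ?_⟩⟩
    · rw [← Theta_jetState, ← hf, ← state_circ_of_mem (Theta_mem ξ) (gammaAlg_le_total hu), h.2,
        map_zero, map_zero]
    · refine eq_of_state_eq (circ_mem_of_mem (Theta_mem ξ) (gammaAlg_le_total hu) n)
        (Submodule.zero_mem _) ?_
      rw [state_circ_of_mem (Theta_mem ξ) (gammaAlg_le_total hu), hf, Theta_jetState, h, map_zero,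
        map_zero]
  rw [h, hf]
  constructor
  · intro h'
    obtain ⟨p, rfl⟩ := exists_aeval_casimir h'
    exact ⟨p, rfl⟩
  · rintro ⟨p, hp⟩ ξ n
    rw [jetState_injective hp, jetDer_aeval_casimir]

theorem gammaInv_le_gammaAlg : gammaInv ≤ gammaAlg := inf_le_left

theorem map_state_gammaInv : gammaInv.map (fockVacuum Root).state =
    LinearMap.range (jetState ∘ₗ (aeval casimir).toLinearMap) := by
  ext v
  constructor
  · rintro ⟨u, hu, rfl⟩
    obtain ⟨p, hp⟩ := (mem_gammaInv_iff (gammaInv_le_gammaAlg hu)).mp hu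
    exact ⟨p, hp.symm⟩
  · rintro ⟨p, rfl⟩
    obtain ⟨u, hu, h⟩ := exists_mem_gammaAlg (aeval casimir p)
    exact ⟨u, (mem_gammaInv_iff hu).mpr ⟨p, h⟩, h⟩

/-! ### The derivatives of `v^x` -/

theorem vx_mem_gammaAlg : vx ∈ gammaAlg := by
  have h : ∀ l, gamma l ∈ gammaAlg := fun l => subset_generated _ _ (Set.mem_range_self l)
  exact Submodule.smul_mem _ _ (Submodule.add_mem _ (wick_mem_gammaAlg (h _) (h _))
    (wick_mem_gammaAlg (h _) (h _)))

theorem quad_gamma_vacuum (i j : Root) (k : ℕ) :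
    mode (quad (false, true, i) (false, true, j)) (Int.negSucc k) fockΩ =
      jetState (∑ p ∈ Finset.HasAntidiagonal.antidiagonal k, X (i, p.1) * X (j, p.2)) := by
  have h : quad (false, true, i) (false, true, j) =
      circE (koszul false false) (-1) (gamma i) (gamma j) :=
    LocalSpace.circ_eq (X := fockVacuum Root) (free_mem false true i) (free_mem false true j) (-1)
  rw [h, mode_circE_vacuum (a := gamma i) fun n hn => creative_of_mem (free_mem false true i) hn,
    finsum_eq_sum_of_support_subset (s := Finset.range (k + 1)),
    Finset.Nat.sum_antidiagonal_eq_sum_range_succ_mk, map_sum]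
  · refine Finset.sum_congr rfl fun m hm => ?_
    rw [Finset.mem_range] at hm
    rw [circCoeff_neg_one, one_smul, show (-1 - m : ℤ) = Int.negSucc m by omega,
      show Int.negSucc k + m = Int.negSucc (k - m) by omega, ← jetState_one, gamma_jetState_negSucc,
      gamma_jetState_negSucc, mul_one]
  · intro m hm
    by_contra hk
    refine hm ?_
    have hk' : k + 1 ≤ m := by simpa using hk
    have h0 : mode (gamma j) (Int.negSucc k + m) fockΩ = 0 :=
      creative_of_mem (free_mem false true j) (by omega)
    simp only [h0, map_zero, smul_zero]

/-- The coefficients q_k are the vacuum values of the creation modes of v^x, which links the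
invariants to the closed words of the Koszul complex. -/
theorem vx_vacuum (k : ℕ) : mode vx (Int.negSucc k) fockΩ = jetState (casimir k) := by
  rw [vx_eq, mode_smul, mode_add, LinearMap.smul_apply, LinearMap.add_apply, quad_gamma_vacuum,
    quad_gamma_vacuum, ← map_add, ← map_smul, casimir_eq, ← Finset.sum_add_distrib, ← algebraMap_eq,
    ← Algebra.smul_def]

theorem deriv_mem_gammaAlg {u : WField} (hu : u ∈ gammaAlg) : deriv u ∈ gammaAlg := by
  have h : circ (fockVacuum Root).σ (-2) u one = deriv u :=
    circ_neg_two_one ((fockLocal Root).good (gammaAlg_le_carrier hu)).hom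
  rw [← h]
  exact circ_mem_generated _ _ hu (one_mem_generated _ _) (-2)

theorem iterate_deriv_mem_gammaAlg (k : ℕ) : deriv^[k] vx ∈ gammaAlg := by
  induction k with
  | zero => exact vx_mem_gammaAlg
  | succ k ih => rw [Function.iterate_succ_apply']; exact deriv_mem_gammaAlg ih

/-- This is the source of the factor k! between the state of ∂^k v^x and q_k. -/
theorem mode_iterate_deriv {V : Type} [AddCommGroup V] [Module ℂ V] (k : ℕ) (a : QO V) :
    mode (deriv^[k] a) (-1) = (k.factorial : ℂ) • mode a (Int.negSucc k) := by
  induction k generalizing a with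
  | zero => simp
  | succ k ih =>
    rw [Function.iterate_succ_apply, ih, mode_deriv, smul_smul, Nat.factorial_succ,
      show Int.negSucc k - 1 = Int.negSucc (k + 1) by omega]
    congr 1
    rw [Int.negSucc_eq]
    push_cast
    ring

theorem state_iterate_deriv (k : ℕ) : (fockVacuum Root).state (deriv^[k] vx) =
    jetState ((k.factorial : ℂ) • casimir k) := by
  rw [map_smul, ← vx_vacuum, ← LinearMap.smul_apply, ← mode_iterate_deriv]
  rfl

/-! ### Cohomology in degree zero -/

/-- Creation modes of v^x act on states of ⟨γ⟩ by multiplication by q_k, so words in them applied to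
the vacuum are polynomials in the q_k. -/
theorem closedWords_eq : currentOps.closedWords =
    LinearMap.range (jetState ∘ₗ (aeval casimir).toLinearMap) := by
  have hvx : ∀ k f, mode vx (Int.negSucc k) (jetState f) = jetState (casimir k * f) := fun k f =>
    mode_jetState vx_mem_gammaAlg (vx_vacuum k) f
  refine le_antisymm (sInf_le ⟨⟨1, ?_⟩, ?_⟩) ?_
  · exact (congrArg jetState (map_one (aeval casimir : MvPolynomial ℕ ℂ →ₐ[ℂ] Jet))).trans jetState_one
  · rintro k _ ⟨p, rfl⟩
    refine ⟨X k * p, ?_⟩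
    refine Eq.trans ?_ (hvx k _).symm
    exact congrArg jetState (by simp)
  · rintro _ ⟨p, rfl⟩
    change jetState (aeval casimir p) ∈ _
    induction p using MvPolynomial.induction_on with
    | C a =>
      rw [← algebraMap_eq, AlgHom.commutes, Algebra.algebraMap_eq_smul_one, map_smul, jetState_one]
      exact Submodule.smul_mem _ _ KoszulOps.Ω_mem_closedWords
    | add f g hf hg => rw [map_add, map_add]; exact Submodule.add_mem _ hf hg
    | mul_X f k hf =>
      rw [map_mul, aeval_X, mul_comm, ← hvx]
      exact KoszulOps.ev_mem_closedWords k hf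

/-- Modulo a closed word, v equals a boundary. That boundary has only components of positive
b-number, while the difference of v and the closed word has b-number 0, so the boundary is zero. -/
theorem mem_closedWords_of_mem_orbitGr {v : Fock Root} (hv : v ∈ orbitGr 0) (hd : mode K 0 v = 0) :
    v ∈ currentOps.closedWords := by
  obtain ⟨n, hn⟩ := mem_currentOrbit_iff.mp (mem_orbitGr.mp hv).1
  obtain ⟨w, hw, hc⟩ := currentOps_rel.exists_primitive currentOps_separated hn hd
  have hw' := currentOrbit_le_iSup (mem_currentOrbit_iff.mpr ⟨n, hw⟩)
  have h1 : mode K 0 w ∈ ⨆ (μ : ℂ) (_ : μ ≠ ((0 : ℕ) : ℂ)), Module.End.eigenspace bOp μ := by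
    have : (⨆ l : ℕ, orbitGr l) ≤
        (⨆ (μ : ℂ) (_ : μ ≠ ((0 : ℕ) : ℂ)), Module.End.eigenspace bOp μ).comap (mode K 0) :=
      iSup_le fun l v hv => Submodule.mem_iSup_of_mem (l + 1 : ℕ)
        (Submodule.mem_iSup_of_mem (by exact_mod_cast l.succ_ne_zero)
          (odd_mem_orbitGr false 0 hv).2)
    exact this hw'
  have h2 : mode K 0 w ∈ Module.End.eigenspace bOp ((0 : ℕ) : ℂ) := by
    rw [← sub_sub_cancel v (mode K 0 w)]
    exact Submodule.sub_mem _ hv.2 (closedWords_le hc).2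
  have h3 := Submodule.disjoint_def.mp (Module.End.eigenspaces_iSupIndep bOp ((0 : ℕ) : ℂ)) _ h2 h1
  have e : v - currentOps.d w = v := (congrArg (v - ·) h3).trans (sub_zero v)
  rwa [e] at hc

/-- Both spaces have the same states, namely the polynomials in the q_k, and all their fields lie in
the local space, where states determine fields. -/
theorem cocycles_zero : cocycles 0 = gammaInv := by
  ext u
  constructor
  · rintro ⟨hu, hk⟩
    have hs : mode K 0 ((fockVacuum Root).state u) = 0 := by
      rw [← state_K0 hu.1, LinearMap.mem_ker.mp hk, map_zero]
    have h := mem_closedWords_of_mem_orbitGr ((mem_Dgr_iff hu.1 _).mp hu) hs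
    rw [closedWords_eq, ← map_state_gammaInv] at h
    obtain ⟨u', hu', e⟩ := h
    rwa [← eq_of_state_eq (gammaAlg_le_total (gammaInv_le_gammaAlg hu')) (D_le_total hu.1) e]
  · intro hu
    have h : (fockVacuum Root).state u ∈ currentOps.closedWords := by
      rw [closedWords_eq, ← map_state_gammaInv]
      exact Submodule.mem_map_of_mem hu
    obtain ⟨u', hu', e⟩ := exists_mem_Dgr (closedWords_le h)
    have e' := eq_of_state_eq (D_le_total hu'.1) (gammaAlg_le_total (gammaInv_le_gammaAlg hu)) e
    subst e'
    refine ⟨hu', eq_of_state_eq (D_le_total (K0_mem_D hu'.1)) (Submodule.zero_mem _) ?_⟩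
    rw [state_K0 hu'.1, map_zero]
    exact currentOps_rel.d_closedWords h

theorem exists_cohomology_zero_equiv : ∃ e : Cohomology 0 ≃ₗ[ℂ] gammaInv,
    ∀ z : cocycles 0, (e (Submodule.Quotient.mk z) : WField) = z := by
  have h : (coboundaries 0).submoduleOf (cocycles 0) = ⊥ := by
    rw [Submodule.submoduleOf, coboundaries, Submodule.comap_bot, Submodule.ker_subtype]
  exact ⟨(Submodule.quotEquivOfEqBot _ h).trans (LinearEquiv.ofEq _ _ cocycles_zero), fun z => rfl⟩

/-! ### The structure of the invariants -/

/-- Rescaling of the variables of a polynomial ring by nonzero constants. -/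
theorem aeval_smul_X_bijective {σ : Type} {r : σ → ℂ} (hr : ∀ i, r i ≠ 0) :
    Function.Bijective (aeval (fun i => r i • X i) : MvPolynomial σ ℂ →ₐ[ℂ] MvPolynomial σ ℂ) := by
  have h : ∀ (s t : σ → ℂ), (∀ i, s i * t i = 1) → ∀ p : MvPolynomial σ ℂ,
      aeval (fun i => s i • X i) (aeval (fun i => t i • (X i : MvPolynomial σ ℂ)) p) =
        (p : MvPolynomial σ ℂ) := by
    intro s t hst p
    have : (aeval (fun i => s i • (X i : MvPolynomial σ ℂ))).comp
        (aeval (fun i => t i • (X i : MvPolynomial σ ℂ))) = AlgHom.id ℂ _ := by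
      refine MvPolynomial.algHom_ext fun i => ?_
      rw [AlgHom.comp_apply, aeval_X, map_smul, aeval_X, smul_smul, mul_comm, hst, one_smul]
      rfl
    exact DFunLike.congr_fun this p
  exact Function.bijective_iff_has_inverse.mpr ⟨aeval fun i => (r i)⁻¹ • X i,
    h _ _ fun i => inv_mul_cancel₀ (hr i), h _ _ fun i => mul_inv_cancel₀ (hr i)⟩

theorem aeval_factorial_casimir (p : MvPolynomial ℕ ℂ) :
    aeval (fun k => (k.factorial : ℂ) • casimir k) p =
      aeval casimir (aeval (fun k : ℕ => (k.factorial : ℂ) • (X k : MvPolynomial ℕ ℂ)) p) := by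
  rw [← AlgHom.comp_apply]
  congr 1
  refine MvPolynomial.algHom_ext fun k => ?_
  rw [AlgHom.comp_apply, aeval_X, aeval_X, map_smul, aeval_X]

theorem exists_gammaInv_equiv : ∃ Φ : MvPolynomial ℕ ℂ ≃ₗ[ℂ] gammaInv,
    (Φ 1 : WField) = one ∧
    (∀ p q : MvPolynomial ℕ ℂ, (Φ (p * q) : WField) = wickW (Φ p) (Φ q)) ∧
    (∀ k : ℕ, (Φ (X k) : WField) = deriv^[k] vx) := by
  have hfac : ∀ k : ℕ, (k.factorial : ℂ) ≠ 0 := fun k => Nat.cast_ne_zero.mpr k.factorial_ne_zero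
  have hbij := aeval_smul_X_bijective hfac
  let f : MvPolynomial ℕ ℂ →ₗ[ℂ] Fock Root :=
    jetState ∘ₗ (aeval fun k => (k.factorial : ℂ) • casimir k).toLinearMap
  let g : gammaInv →ₗ[ℂ] Fock Root := (fockVacuum Root).state ∘ₗ gammaInv.subtype
  have hf : Function.Injective f := by
    refine jetState_injective.comp fun p q h => ?_
    have h' : aeval (fun k : ℕ => (k.factorial : ℂ) • casimir k) p =
      aeval (fun k : ℕ => (k.factorial : ℂ) • casimir k) q := h
    rw [aeval_factorial_casimir, aeval_factorial_casimir] at h'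
    exact hbij.1 (aeval_casimir_injective h')
  have htot : ∀ u : gammaInv, (u : WField) ∈ (fockLocal Root).total := fun u =>
    gammaAlg_le_total (gammaInv_le_gammaAlg u.2)
  have hg : Function.Injective g := fun u w h => Subtype.ext (eq_of_state_eq (htot u) (htot w) h)
  -- Rescaling the variables by k! is an automorphism of the polynomial ring, so polynomials in k!
  -- q_k and polynomials in q_k give the same states.
  have hfg : LinearMap.range f = LinearMap.range g := by
    have hgr : LinearMap.range g = gammaInv.map (fockVacuum Root).state := by
      rw [LinearMap.range_comp, Submodule.range_subtype]
    rw [hgr, map_state_gammaInv]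
    refine le_antisymm ?_ ?_
    · rintro _ ⟨p, rfl⟩
      exact ⟨_, (congrArg jetState (aeval_factorial_casimir p)).symm⟩
    · rintro _ ⟨p, rfl⟩
      obtain ⟨p, rfl⟩ := hbij.2 p
      exact ⟨p, congrArg jetState (aeval_factorial_casimir p)⟩
  -- Both f and g are injective into the Fock space with equal range, so Φ is f followed by the
  -- inverse of g. All its properties are then verified on states.
  let Φ : MvPolynomial ℕ ℂ ≃ₗ[ℂ] gammaInv := (LinearEquiv.ofInjective f hf).trans
    ((LinearEquiv.ofEq _ _ hfg).trans (LinearEquiv.ofInjective g hg).symm)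
  have hΦ : ∀ p, (fockVacuum Root).state (Φ p : WField) =
      jetState (aeval (fun k => (k.factorial : ℂ) • casimir k) p) := fun p =>
    congrArg Subtype.val ((LinearEquiv.ofInjective g hg).apply_symm_apply
      (LinearEquiv.ofEq _ _ hfg (LinearEquiv.ofInjective f hf p)))
  refine ⟨Φ, ?_, fun p q => ?_, fun k => ?_⟩
  · refine eq_of_state_eq (htot _) (LocalSpace.le_total _ _ (fockLocal Root).one_mem) ?_
    rw [hΦ, map_one, jetState_one, (fockVacuum Root).state_one]
    rfl
  · have hp := gammaInv_le_gammaAlg (Φ p).2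
    have hq := gammaInv_le_gammaAlg (Φ q).2
    refine eq_of_state_eq (htot _) (gammaAlg_le_total (wick_mem_gammaAlg hp hq)) ?_
    rw [hΦ, map_mul, state_wick hp hq (hΦ p) (hΦ q)]
  · refine eq_of_state_eq (htot _) (gammaAlg_le_total (iterate_deriv_mem_gammaAlg k)) ?_
    rw [hΦ, aeval_X, state_iterate_deriv]

end GammaAlgebra

end WeilVA

end

theorem lemma8p1 :
    -- `𝒟` is graded by `b`-number, and `(𝒟^{(*)}, K(0))` is a cochain complex
    ((⨆ k : ℕ, WeilVA.Dgr k) = WeilVA.D ∧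
      (∀ k : ℕ, (WeilVA.Dgr k).map WeilVA.K0 ≤ WeilVA.Dgr (k + 1)) ∧
      (∀ u ∈ WeilVA.D, WeilVA.K0 (WeilVA.K0 u) = 0)) ∧
    -- its cohomology vanishes in positive `b`-number
    (∀ k : ℕ, 0 < k → Subsingleton (WeilVA.Cohomology k)) ∧
    -- in `b`-number zero it is `⟨γ⟩^{sl₂[t]}`, by taking a class to its representative
    (∃ e : WeilVA.Cohomology 0 ≃ₗ[ℂ] WeilVA.gammaInv,
      ∀ z : WeilVA.cocycles 0, (e (Submodule.Quotient.mk z) : WeilVA.WField) = z) ∧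
    -- `⟨γ⟩^{sl₂[t]}`, with the Wick product, is the polynomial algebra on the `∂^k v^x`
    (∃ Φ : MvPolynomial ℕ ℂ ≃ₗ[ℂ] WeilVA.gammaInv,
      (Φ 1 : WeilVA.WField) = WeilVA.one ∧
      (∀ p q : MvPolynomial ℕ ℂ,
        (Φ (p * q) : WeilVA.WField) = WeilVA.wickW (Φ p) (Φ q)) ∧
      (∀ k : ℕ, (Φ (MvPolynomial.X k) : WeilVA.WField) = WeilVA.deriv^[k] WeilVA.vx)) :=
  ⟨⟨WeilVA.iSup_Dgr, WeilVA.map_K0_le, fun _ => WeilVA.K0_K0⟩,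
    fun _ => WeilVA.subsingleton_cohomology, WeilVA.exists_cohomology_zero_equiv,
    WeilVA.exists_gammaInv_equiv⟩
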